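/- Let $\mathbf F$ be an algebraically closed field of characteristic $p>3$, $\Gamma$ a finite abelian group with a bicharacter $(\cdot,\cdot):\Gamma\times\Gamma\to\mathbf F^\times$ (bimultiplicative, with $(\alpha,\beta)(\beta,\alpha)=1$), and $V=\bigoplus_{\alpha\in\Gamma}V_\alpha$ an $m$-dimensional $\Gamma$-graded vector space with an ordered homogeneous basis $v_1,\dots,v_m$. Let $\mathfrak g=\mathfrak{gl}(m,\Gamma)=\mathfrak{gl}(V)$, the Lie color algebra with bracket $[x,y]=xy-(\alpha,\beta)yx$ for $x\in\mathfrak g_\alpha$, $y\in\mathfrak g_\beta$, and with $p$-map $x^{[p]}=x^p$ on $\mathfrak g_\alpha$ for $(\alpha,\alpha)=1$. Let $e_{ij}$ be the matrix units with respect to $v_1,\dots,v_m$, $H=\langle e_{ii}\rangle$, $N^+=\langle e_{ij}: i<j\rangle$, $N^-=\langle e_{ij}:i>j\rangle$, $B=H\oplus N^+$, $\Phi=\{\varepsilon_i-\varepsilon_j : i\ne j\}$ and $\Phi^+=\{\varepsilon_i-\varepsilon_j : i<j\}$. For $\delta=\varepsilon_i-\varepsilon_j\in\Phi^+$ put $e_\delta=e_{ij}$,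 $f_\delta=e_{ji}$, $H_\delta=[e_\delta,f_\delta]$, and let $\alpha$ be the degree of $e_\delta$. Thus $H_\delta=e_{ii}-e_{jj}$ if $(\alpha,\alpha)=1$ and $H_\delta=e_{ii}+e_{jj}$ if $(\alpha,\alpha)=-1$; put $\bar p_\delta=p$ in the first case and $\bar p_\delta=2$ in the second. Let $\chi\in\mathfrak g^*$ be standard semisimple, that is, $\chi(\mathfrak g_\alpha)=0$ for $\alpha\ne\bar 0$ and $\chi(N^\pm)=0$. For a restricted color subalgebra $S$ of $\mathfrak g$ let $u_\chi(S)$ be the quotient of the universal enveloping algebra of $S$ by the relations $x^p-x^{[p]}=\chi(x)^p$ for $x\in S_\alpha$, $(\alpha,\alpha)=1$. Let $\delta_1,\dots,\delta_N$ be an ordering of $\Phi^+$ for which $(\mathfrak g,H,\Phi^+)$ is a Friedlander–Parshall triple: for every $1\le k\le N$ the set $\{-\delta_1,\dots,-\delta_{k-1},\delta_k,\dots,\delta_N\}$ is a system of positive roots of $\Phi$ in which $\delta_k$ is simple, and $\{-\delta_1,\dots,-\delta_k\}$ is an additive subset of $\Phi$ (it contains the sum of any two of its elements whenever that sum lies in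 $\Phi$). Write $\bar p_i=\bar p_{\delta_i}$. Then there is a unique $f\in u_\chi(H)$, the Harish-Chandra projection of $$e_{\delta_1}^{\bar p_1-1}\cdots e_{\delta_N}^{\bar p_N-1}\,f_{\delta_1}^{\bar p_1-1}\cdots f_{\delta_N}^{\bar p_N-1},$$ such that this product, which has weight $0$ under $\operatorname{ad}H$, is congruent to $f$ modulo $u_\chi(\mathfrak g)N^+\cap u_\chi(\mathfrak g)_0$, where $u_\chi(\mathfrak g)_0$ is the zero weight space of $\operatorname{ad} H$. For $\lambda\in H^*$ with $\lambda(h)^p-\lambda(h^{[p]})=\chi(h)^p$ for all $h\in H$, let $\mathbf Fv$ be the one-dimensional $\Gamma$-graded $u_\chi(B)$-module with $N^+v=0$ and $hv=\lambda(h)v$ for $h\in H$ (with $v$ in any degree), let $Z^\chi(\lambda)=u_\chi(\mathfrak g)\otimes_{u_\chi(B)}\mathbf Fv$ be the baby Verma module, and let $f(\lambda)\in\mathbf F$ be the image of $f$ under the algebra homomorphism $u_\chi(H)\to\mathbf F$ extending $\lambda$. Then for every such $\lambda$: $$Z^\chi(\lambda)\text{ is simple (it is nonzero and has no nontrivial }\Gamma\text{-graded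 submodules)}\iff f(\lambda)\neq0 .$$ Moreover, there is a constant $c\in\mathbf F^\times$ such that for every such $\lambda$ $$f(\lambda)=c\prod_{i=1}^N\Big[\big(\lambda_i(H_{\delta_i})+1\big)^{\bar p_i-1}-1\Big],\qquad \lambda_i=\lambda-\sum_{k<i}(\bar p_k-1)\,\delta_k .$$ -/

import Mathlib

open scoped TensorProduct

noncomputable section

/-- A bicharacter on the abelian group `Γ` with values in `F^×`. -/
structure Bicharacter (Γ F : Type*) [AddCommGroup Γ] [Field F] where
  toFun : Γ → Γ → Fˣ
  mul_swap : ∀ α β, toFun α β * toFun β α = 1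
  add_right : ∀ α β γ, toFun α (β + γ) = toFun α β * toFun α γ
  add_left : ∀ α β γ, toFun (α + β) γ = toFun α γ * toFun β γ

namespace GLColor

section Basic

variable {F Γ : Type*} [Field F] [AddCommGroup Γ] {m : ℕ}

/-- The degree `α` part of `gl(m,Γ)`.  Here `V` has the ordered homogeneous basis `v_1, …, v_m`
with `v_i` of degree `deg i`, endomorphisms of `V` are written as matrices in this basis, and
`e_{ij}` has degree `deg i - deg j`. -/
def glDegree (F : Type*) [Field F] (deg : Fin m → Γ) (α : Γ) :
    Submodule F (Matrix (Fin m) (Fin m) F) where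
  carrier := {x | ∀ i j, deg i - deg j ≠ α → x i j = 0}
  zero_mem' := by intro i j _; rfl
  add_mem' := by
    intro x y hx hy i j h
    simp [hx i j h, hy i j h]
  smul_mem' := by
    intro c x hx i j h
    simp [hx i j h]

/-- A restricted Lie color subalgebra of `gl(m,Γ)`: a graded subspace closed under the color
bracket `[x,y] = xy - (α,β)yx` (`x` of degree `α`, `y` of degree `β`) and under the `p`-map
`x^{[p]} = x^p` on homogeneous elements of even degree. -/
structure RestrictedSubalgebra (p : ℕ) (ε : Bicharacter Γ F) (deg : Fin m → Γ) where
  carrier : Submodule F (Matrix (Fin m) (Fin m) F)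
  graded : carrier ≤ ⨆ α, carrier ⊓ glDegree F deg α
  bracket_mem : ∀ α β x y, x ∈ carrier → y ∈ carrier → x ∈ glDegree F deg α →
    y ∈ glDegree F deg β → x * y - (ε.toFun α β : F) • (y * x) ∈ carrier
  pow_mem : ∀ α x, ε.toFun α α = 1 → x ∈ carrier → x ∈ glDegree F deg α → x ^ p ∈ carrier

/-- The defining relations of `u_χ(S)` in the tensor algebra of `S`: the relations
`x ⊗ y - (α,β) y ⊗ x = [x,y]` of the universal enveloping algebra, and
`x^p - x^{[p]} = χ(x)^p` for homogeneous `x` of even degree. -/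
inductive ReducedRel (p : ℕ) (ε : Bicharacter Γ F) (deg : Fin m → Γ)
    (χ : Module.Dual F (Matrix (Fin m) (Fin m) F)) (S : RestrictedSubalgebra p ε deg) :
    TensorAlgebra F S.carrier → TensorAlgebra F S.carrier → Prop
  | bracket (α β : Γ) (x y z : S.carrier) (hx : x.1 ∈ glDegree F deg α)
      (hy : y.1 ∈ glDegree F deg β) (hz : z.1 = x.1 * y.1 - (ε.toFun α β : F) • (y.1 * x.1)) :
      ReducedRel p ε deg χ S
        (TensorAlgebra.ι F x * TensorAlgebra.ι F y
          - (ε.toFun α β : F) • (TensorAlgebra.ι F y * TensorAlgebra.ι F x))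
        (TensorAlgebra.ι F z)
  | pow (α : Γ) (x z : S.carrier) (hα : ε.toFun α α = 1) (hx : x.1 ∈ glDegree F deg α)
      (hz : z.1 = x.1 ^ p) :
      ReducedRel p ε deg χ S (TensorAlgebra.ι F x ^ p - TensorAlgebra.ι F z)
        (algebraMap F _ (χ x.1 ^ p))

/-- The `χ`-reduced universal enveloping algebra `u_χ(S)`, for `χ` a linear function on
`gl(m,Γ)` vanishing in all nonzero degrees. -/
def ReducedEnv (p : ℕ) (ε : Bicharacter Γ F) (deg : Fin m → Γ)
    (χ : Module.Dual F (Matrix (Fin m) (Fin m) F)) (S : RestrictedSubalgebra p ε deg) :=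
  RingQuot (ReducedRel p ε deg χ S)

variable {p : ℕ} {ε : Bicharacter Γ F} {deg : Fin m → Γ}

instance (χ : Module.Dual F (Matrix (Fin m) (Fin m) F)) (S : RestrictedSubalgebra p ε deg) :
    Ring (ReducedEnv p ε deg χ S) :=
  inferInstanceAs (Ring (RingQuot (ReducedRel p ε deg χ S)))

instance (χ : Module.Dual F (Matrix (Fin m) (Fin m) F)) (S : RestrictedSubalgebra p ε deg) :
    Algebra F (ReducedEnv p ε deg χ S) :=
  inferInstanceAs (Algebra F (RingQuot (ReducedRel p ε deg χ S)))

/-- The canonical map `σ : S → u_χ(S)`. -/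
def sigma (χ : Module.Dual F (Matrix (Fin m) (Fin m) F)) (S : RestrictedSubalgebra p ε deg) :
    S.carrier →ₗ[F] ReducedEnv p ε deg χ S :=
  (RingQuot.mkAlgHom F (ReducedRel p ε deg χ S)).toLinearMap ∘ₗ TensorAlgebra.ι F

theorem sigma_bracket (χ : Module.Dual F (Matrix (Fin m) (Fin m) F))
    (S : RestrictedSubalgebra p ε deg) (α β : Γ) (x y z : S.carrier)
    (hx : x.1 ∈ glDegree F deg α) (hy : y.1 ∈ glDegree F deg β)
    (hz : z.1 = x.1 * y.1 - (ε.toFun α β : F) • (y.1 * x.1)) :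
    sigma χ S x * sigma χ S y - (ε.toFun α β : F) • (sigma χ S y * sigma χ S x) =
      sigma χ S z := by
  have h := RingQuot.mkAlgHom_rel F (ReducedRel.bracket (χ := χ) α β x y z hx hy hz)
  rw [map_sub, map_mul, map_smul, map_mul] at h
  exact h

theorem sigma_pow (χ : Module.Dual F (Matrix (Fin m) (Fin m) F))
    (S : RestrictedSubalgebra p ε deg) (α : Γ) (x z : S.carrier) (hα : ε.toFun α α = 1)
    (hx : x.1 ∈ glDegree F deg α) (hz : z.1 = x.1 ^ p) :
    sigma χ S x ^ p - sigma χ S z = algebraMap F _ (χ x.1 ^ p) := by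
  have h := RingQuot.mkAlgHom_rel F (ReducedRel.pow (χ := χ) α x z hα hx hz)
  rw [map_sub, map_pow, AlgHom.commutes] at h
  exact h

/-- The universal property of `u_χ(S)`. -/
def reducedLift {A : Type*} [Ring A] [Algebra F A]
    (χ : Module.Dual F (Matrix (Fin m) (Fin m) F)) (S : RestrictedSubalgebra p ε deg)
    (g : S.carrier →ₗ[F] A)
    (hb : ∀ (α β : Γ) (x y z : S.carrier), x.1 ∈ glDegree F deg α → y.1 ∈ glDegree F deg β →
      z.1 = x.1 * y.1 - (ε.toFun α β : F) • (y.1 * x.1) →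
      g x * g y - (ε.toFun α β : F) • (g y * g x) = g z)
    (hp : ∀ (α : Γ) (x z : S.carrier), ε.toFun α α = 1 → x.1 ∈ glDegree F deg α →
      z.1 = x.1 ^ p → g x ^ p - g z = algebraMap F A (χ x.1 ^ p)) :
    ReducedEnv p ε deg χ S →ₐ[F] A :=
  RingQuot.liftAlgHom F ⟨TensorAlgebra.lift F g, by
    intro a b h
    cases h with
    | bracket α β x y z hx hy hz => simpa using hb α β x y z hx hy hz
    | pow α x z hα hx hz => simpa using hp α x z hα hx hz⟩

/-- The canonical homomorphism `u_χ(S) → u_χ(S')` for `S ⊆ S'`. -/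
def envIncl (χ : Module.Dual F (Matrix (Fin m) (Fin m) F)) (S S' : RestrictedSubalgebra p ε deg)
    (h : S.carrier ≤ S'.carrier) : ReducedEnv p ε deg χ S →ₐ[F] ReducedEnv p ε deg χ S' :=
  reducedLift χ S (sigma χ S' ∘ₗ Submodule.inclusion h)
    (fun α β x y z hx hy hz => sigma_bracket χ S' α β (Submodule.inclusion h x)
      (Submodule.inclusion h y) (Submodule.inclusion h z) hx hy hz)
    (fun α x z hα hx hz => sigma_pow χ S' α (Submodule.inclusion h x)
      (Submodule.inclusion h z) hα hx hz)

/-- The degree `α` part of `u_χ(S)`: spanned by the products `x_1 ⋯ x_k` of homogeneous elements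
of `S` whose degrees add up to `α`. -/
def envDegree (χ : Module.Dual F (Matrix (Fin m) (Fin m) F)) (S : RestrictedSubalgebra p ε deg)
    (α : Γ) : Submodule F (ReducedEnv p ε deg χ S) :=
  Submodule.span F {t | ∃ l : List (Γ × S.carrier),
    (∀ q ∈ l, q.2.1 ∈ glDegree F deg q.1) ∧ (l.map Prod.fst).sum = α ∧
      t = (l.map fun q => sigma χ S q.2).prod}

end Basic

section Triangular

variable {F Γ : Type*} [Field F] [AddCommGroup Γ] {m : ℕ}

/-- Upper triangular matrices. -/
def upperTri (F : Type*) [Field F] (m : ℕ) : Submodule F (Matrix (Fin m) (Fin m) F) where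
  carrier := {x | ∀ i j, j < i → x i j = 0}
  zero_mem' := by intro i j _; rfl
  add_mem' := by
    intro x y hx hy i j h
    simp [hx i j h, hy i j h]
  smul_mem' := by
    intro c x hx i j h
    simp [hx i j h]

/-- Diagonal matrices. -/
def diagMat (F : Type*) [Field F] (m : ℕ) : Submodule F (Matrix (Fin m) (Fin m) F) where
  carrier := {x | ∀ i j, i ≠ j → x i j = 0}
  zero_mem' := by intro i j _; rfl
  add_mem' := by
    intro x y hx hy i j h
    simp [hx i j h, hy i j h]
  smul_mem' := by
    intro c x hx i j h
    simp [hx i j h]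

theorem le_graded (deg : Fin m → Γ) (C : Submodule F (Matrix (Fin m) (Fin m) F))
    (h : ∀ x ∈ C, ∀ i j, Matrix.single i j (x i j) ∈ C) :
    C ≤ ⨆ α, C ⊓ glDegree F deg α := by
  intro x hx
  rw [Matrix.matrix_eq_sum_single x]
  refine Submodule.sum_mem _ fun i _ => Submodule.sum_mem _ fun j _ => ?_
  refine Submodule.mem_iSup_of_mem (deg i - deg j) ⟨h x hx i j, ?_⟩
  intro a b hab
  rw [Matrix.single_apply, if_neg]
  rintro ⟨rfl, rfl⟩
  exact hab rfl

theorem upperTri_mul {x y : Matrix (Fin m) (Fin m) F} (hx : x ∈ upperTri F m)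
    (hy : y ∈ upperTri F m) : x * y ∈ upperTri F m := by
  intro i j hij
  rw [Matrix.mul_apply]
  refine Finset.sum_eq_zero fun k _ => ?_
  rcases lt_or_ge k i with h | h
  · rw [hx i k h, zero_mul]
  · rw [hy k j (lt_of_lt_of_le hij h), mul_zero]

theorem upperTri_mul_diag {x y : Matrix (Fin m) (Fin m) F} (hx : x ∈ upperTri F m)
    (hy : y ∈ upperTri F m) (i : Fin m) : (x * y) i i = x i i * y i i := by
  rw [Matrix.mul_apply]
  refine Finset.sum_eq_single i (fun k _ hk => ?_) (by simp)
  rcases lt_or_gt_of_ne hk with h | h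
  · rw [hx i k h, zero_mul]
  · rw [hy k i h, mul_zero]

theorem upperTri_pow {x : Matrix (Fin m) (Fin m) F} (hx : x ∈ upperTri F m) (n : ℕ) :
    x ^ n ∈ upperTri F m := by
  induction n with
  | zero =>
    intro i j hij
    rw [pow_zero, Matrix.one_apply_ne (ne_of_gt hij)]
  | succ n ih => rw [pow_succ]; exact upperTri_mul ih hx

theorem upperTri_pow_diag {x : Matrix (Fin m) (Fin m) F} (hx : x ∈ upperTri F m) (n : ℕ)
    (i : Fin m) : (x ^ n) i i = x i i ^ n := by
  induction n with
  | zero => simp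
  | succ n ih => rw [pow_succ, upperTri_mul_diag (upperTri_pow hx n) hx, ih, pow_succ]

theorem diagMat_mul {x y : Matrix (Fin m) (Fin m) F} (hx : x ∈ diagMat F m)
    (hy : y ∈ diagMat F m) : x * y ∈ diagMat F m := by
  intro i j hij
  rw [Matrix.mul_apply]
  refine Finset.sum_eq_zero fun k _ => ?_
  by_cases h : i = k
  · subst h; rw [hy i j hij, mul_zero]
  · rw [hx i k h, zero_mul]

theorem diagMat_pow {x : Matrix (Fin m) (Fin m) F} (hx : x ∈ diagMat F m) (n : ℕ) :
    x ^ n ∈ diagMat F m := by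
  induction n with
  | zero =>
    intro i j hij
    rw [pow_zero, Matrix.one_apply_ne hij]
  | succ n ih => rw [pow_succ]; exact diagMat_mul ih hx

variable (p : ℕ) (ε : Bicharacter Γ F) (deg : Fin m → Γ)

/-- `g = gl(m,Γ)` itself. -/
abbrev glSub : RestrictedSubalgebra p ε deg where
  carrier := ⊤
  graded := le_graded deg ⊤ (fun _ _ _ _ => trivial)
  bracket_mem := fun _ _ _ _ _ _ _ _ => trivial
  pow_mem := fun _ _ _ _ _ => trivial

/-- The Borel subalgebra `B = H ⊕ N⁺`. -/
abbrev borel : RestrictedSubalgebra p ε deg where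
  carrier := upperTri F m
  graded := le_graded deg _ (by
    intro x hx i j a b hab
    rw [Matrix.single_apply]
    split_ifs with h
    · obtain ⟨rfl, rfl⟩ := h
      exact hx _ _ hab
    · rfl)
  bracket_mem := fun _ _ _ _ hx hy _ _ =>
    Submodule.sub_mem _ (upperTri_mul hx hy) (Submodule.smul_mem _ _ (upperTri_mul hy hx))
  pow_mem := fun _ _ _ hx _ => upperTri_pow hx p

/-- The torus `H` of diagonal matrices. -/
abbrev torus : RestrictedSubalgebra p ε deg where
  carrier := diagMat F m
  graded := le_graded deg _ (by
    intro x hx i j a b hab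
    rw [Matrix.single_apply]
    split_ifs with h
    · obtain ⟨rfl, rfl⟩ := h
      exact hx _ _ hab
    · rfl)
  bracket_mem := fun _ _ _ _ hx hy _ _ =>
    Submodule.sub_mem _ (diagMat_mul hx hy) (Submodule.smul_mem _ _ (diagMat_mul hy hx))
  pow_mem := fun _ _ _ hx _ => diagMat_pow hx p

theorem torus_le_borel : (torus p ε deg).carrier ≤ (borel p ε deg).carrier :=
  fun _ hx i j hij => hx i j (ne_of_gt hij)

/-- `χ ∈ g*_{0̄}` is standard semisimple: it vanishes on `g_α` for `α ≠ 0̄`, and on `N⁺` and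
`N⁻`, which are spanned by the `e_{ij}` with `i < j` and `i > j` respectively. -/
structure IsStandardSemisimple (deg : Fin m → Γ)
    (χ : Module.Dual F (Matrix (Fin m) (Fin m) F)) : Prop where
  degree_zero : ∀ α, α ≠ 0 → ∀ x ∈ glDegree F deg α, χ x = 0
  upper : ∀ i j, i < j → χ (Matrix.single i j 1) = 0
  lower : ∀ i j, j < i → χ (Matrix.single i j 1) = 0

variable {p ε deg}

/-- The weights `l ∈ H*` with `l(h)^p - l(h^{[p]}) = χ(h)^p` for all `h ∈ H`. -/
def IsWeight (p : ℕ) (χ : Module.Dual F (Matrix (Fin m) (Fin m) F))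
    (l : Module.Dual F (diagMat F m)) : Prop :=
  ∀ h h' : diagMat F m, h'.1 = h.1 ^ p → l h ^ p - l h' = χ h.1 ^ p

/-- The projection `B = H ⊕ N⁺ → H`. -/
def diagPart (F : Type*) [Field F] (m : ℕ) : upperTri F m →ₗ[F] diagMat F m where
  toFun x := ⟨Matrix.diagonal fun i => x.1 i i, fun _ _ h => Matrix.diagonal_apply_ne _ h⟩
  map_add' x y := by
    apply Subtype.ext
    ext i j
    by_cases h : i = j <;> simp [h]
  map_smul' c x := by
    apply Subtype.ext
    ext i j
    by_cases h : i = j <;> simp [h]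

theorem diagPart_eq_zero {α : Γ} (hα : α ≠ 0) (x : upperTri F m)
    (hx : x.1 ∈ glDegree F deg α) : diagPart F m x = 0 := by
  apply Subtype.ext
  ext i j
  by_cases h : i = j
  · subst h
    simpa [diagPart] using hx i i (by simpa using hα.symm)
  · simp [diagPart, h]

theorem chi_diagPart {χ : Module.Dual F (Matrix (Fin m) (Fin m) F)}
    (hχ : IsStandardSemisimple deg χ) (x : upperTri F m) : χ (diagPart F m x).1 = χ x.1 := by
  have hs : ∀ i j, ∀ c : F, i ≠ j → χ (Matrix.single i j c) = 0 := by
    intro i j c hij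
    have h1 : Matrix.single i j c = c • (Matrix.single i j (1 : F)) := by simp
    rw [h1, map_smul]
    rcases lt_or_gt_of_ne hij with h | h
    · rw [hχ.upper i j h, smul_zero]
    · rw [hχ.lower i j h, smul_zero]
  rw [Matrix.matrix_eq_sum_single x.1, Matrix.matrix_eq_sum_single (diagPart F m x).1]
  simp only [map_sum]
  refine Finset.sum_congr rfl fun i _ => Finset.sum_congr rfl fun j _ => ?_
  by_cases h : i = j
  · subst h
    simp [diagPart]
  · rw [hs i j _ h, hs i j _ h]

theorem diagPart_bracket (l : Module.Dual F (diagMat F m)) (α β : Γ) (x y z : upperTri F m)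
    (hx : x.1 ∈ glDegree F deg α) (hy : y.1 ∈ glDegree F deg β)
    (hz : z.1 = x.1 * y.1 - (ε.toFun α β : F) • (y.1 * x.1)) :
    l (diagPart F m x) * l (diagPart F m y)
      - (ε.toFun α β : F) • (l (diagPart F m y) * l (diagPart F m x)) = l (diagPart F m z) := by
  have hzd : ∀ i, z.1 i i = x.1 i i * y.1 i i - (ε.toFun α β : F) * (y.1 i i * x.1 i i) := by
    intro i
    rw [hz, Matrix.sub_apply, Matrix.smul_apply, upperTri_mul_diag x.2 y.2,
      upperTri_mul_diag y.2 x.2, smul_eq_mul]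
  have hd : ∀ i, (x.1 i i * y.1 i i - (ε.toFun α β : F) * (y.1 i i * x.1 i i)) = 0 := by
    intro i
    by_cases hα : α = 0
    · by_cases hβ : β = 0
      · subst hα hβ
        have h1 : ε.toFun 0 0 = 1 := by
          have := ε.add_right 0 0 0
          rw [add_zero] at this
          exact left_eq_mul.mp this
        rw [h1, Units.val_one]
        ring
      · rw [hy i i (by rw [sub_self]; exact fun h => hβ h.symm)]
        ring
    · rw [hx i i (by rw [sub_self]; exact fun h => hα h.symm)]
      ring
  have hz1 : diagPart F m z = 0 := by
    apply Subtype.ext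
    ext i j
    by_cases h : i = j
    · subst h
      simp [diagPart, hzd, hd]
    · simp [diagPart, h]
  rw [hz1, map_zero]
  by_cases hα : α = 0
  · by_cases hβ : β = 0
    · subst hα hβ
      have h1 : ε.toFun 0 0 = 1 := by
        have := ε.add_right 0 0 0
        rw [add_zero] at this
        exact left_eq_mul.mp this
      rw [h1, Units.val_one, one_smul, mul_comm, sub_self]
    · rw [diagPart_eq_zero hβ y hy]
      simp
  · rw [diagPart_eq_zero hα x hx]
    simp

theorem diagPart_pow {χ : Module.Dual F (Matrix (Fin m) (Fin m) F)}
    (hχ : IsStandardSemisimple deg χ) {l : Module.Dual F (diagMat F m)} (hl : IsWeight p χ l)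
    (x z : upperTri F m) (hz : z.1 = x.1 ^ p) :
    l (diagPart F m x) ^ p - l (diagPart F m z) = χ x.1 ^ p := by
  rw [← chi_diagPart hχ x]
  refine hl _ _ ?_
  change Matrix.diagonal (fun i => z.1 i i) = Matrix.diagonal (fun i => x.1 i i) ^ p
  rw [Matrix.diagonal_pow, hz]
  congr 1
  funext i
  rw [upperTri_pow_diag x.2]
  rfl

/-- The one-dimensional `u_χ(B)`-module `F v` with `N⁺ v = 0` and `h v = l(h) v`, as an algebra
homomorphism `u_χ(B) → F`. -/
def borelChar {χ : Module.Dual F (Matrix (Fin m) (Fin m) F)} (hχ : IsStandardSemisimple deg χ)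
    {l : Module.Dual F (diagMat F m)} (hl : IsWeight p χ l) :
    ReducedEnv p ε deg χ (borel p ε deg) →ₐ[F] F :=
  reducedLift χ (borel p ε deg) (l ∘ₗ diagPart F m)
    (fun α β x y z hx hy hz => diagPart_bracket l α β x y z hx hy hz)
    (fun _ x z _ _ hz => diagPart_pow hχ hl x z hz)

end Triangular

section Verma

variable {F Γ : Type*} [Field F] [AddCommGroup Γ] {m : ℕ} {p : ℕ} {ε : Bicharacter Γ F}
  {deg : Fin m → Γ}

/-- The relations `ua ⊗ x = u ⊗ ax` of the tensor product over `A`. -/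
def balanced {A U M : Type*} [Ring A] [Algebra F A] [Ring U] [Algebra F U] [AddCommGroup M]
    [Module F M] (φ : A →ₐ[F] U) (ρ : A →ₐ[F] Module.End F M) : Submodule U (U ⊗[F] M) :=
  Submodule.span U {t | ∃ (u : U) (a : A) (x : M), t = (u * φ a) ⊗ₜ[F] x - u ⊗ₜ[F] (ρ a x)}

/-- The induced module `U ⊗_A M`: here `U` is a right `A`-module through `φ : A → U`, and `M` is
a left `A`-module through `ρ`. -/
abbrev Induced {A U M : Type*} [Ring A] [Algebra F A] [Ring U] [Algebra F U] [AddCommGroup M]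
    [Module F M] (φ : A →ₐ[F] U) (ρ : A →ₐ[F] Module.End F M) :=
  (U ⊗[F] M) ⧸ balanced φ ρ

/-- The baby Verma module `Z^χ(l) = u_χ(g) ⊗_{u_χ(B)} F v`. -/
abbrev BabyVerma {χ : Module.Dual F (Matrix (Fin m) (Fin m) F)}
    (ε : Bicharacter Γ F) (hχ : IsStandardSemisimple deg χ)
    {l : Module.Dual F (diagMat F m)} (hl : IsWeight p χ l) :=
  Induced (envIncl χ (borel p ε deg) (glSub p ε deg) le_top)
    ((Algebra.lmul F F).comp (borelChar (ε := ε) hχ hl))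

/-- The degree `γ` part of `Z^χ(l)`, when `v` is given the degree `d`. -/
def vermaDegree {χ : Module.Dual F (Matrix (Fin m) (Fin m) F)}
    (ε : Bicharacter Γ F) (hχ : IsStandardSemisimple deg χ)
    {l : Module.Dual F (diagMat F m)} (hl : IsWeight p χ l) (d γ : Γ) :
    Submodule F (BabyVerma ε hχ hl) :=
  Submodule.span F {z | ∃ (α : Γ) (u : ReducedEnv p ε deg χ (glSub p ε deg)) (x : F),
    u ∈ envDegree χ (glSub p ε deg) α ∧ α + d = γ ∧
      z = Submodule.Quotient.mk (u ⊗ₜ[F] x)}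

/-- A module `M` over the `F`-algebra `U`, with grading `𝓜`, is (graded) simple: it is nonzero
and its only graded submodules are `0` and `M`. -/
def IsGradedSimple {U M : Type*} [Ring U] [Algebra F U] [AddCommGroup M] [Module F M] [Module U M]
    [IsScalarTower F U M] (𝓜 : Γ → Submodule F M) : Prop :=
  Nontrivial M ∧ ∀ N : Submodule U M,
    N.restrictScalars F ≤ (⨆ γ, N.restrictScalars F ⊓ 𝓜 γ) → N = ⊥ ∨ N = ⊤

end Verma

section Roots

/-- The positive roots `ε_i - ε_j`, `i < j`, as pairs. -/
abbrev PosRoot (m : ℕ) := {q : Fin m × Fin m // q.1 < q.2}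

/-- The character `ε_i - ε_j` of the diagonal torus `T`. -/
def rootVec {m : ℕ} (q : Fin m × Fin m) : Fin m → ℤ :=
  Pi.single q.1 1 - Pi.single q.2 1

/-- The root system `Φ` of `gl(m,Γ)`. -/
def rootSet (m : ℕ) : Set (Fin m → ℤ) := {a | ∃ q : Fin m × Fin m, q.1 ≠ q.2 ∧ a = rootVec q}

/-- Additive subsets of `Φ`. -/
def IsAdditive {m : ℕ} (P : Set (Fin m → ℤ)) : Prop :=
  P ⊆ rootSet m ∧ ∀ a ∈ P, ∀ b ∈ P, a + b ∈ rootSet m → a + b ∈ P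

/-- Systems of positive roots of `Φ`. -/
def IsPositiveSystem {m : ℕ} (P : Set (Fin m → ℤ)) : Prop :=
  IsAdditive P ∧ (∀ a ∈ rootSet m, a ∈ P ∨ -a ∈ P) ∧ ∀ a ∈ P, -a ∉ P

/-- `a` is a simple root of the positive system `P`. -/
def IsSimpleIn {m : ℕ} (P : Set (Fin m → ℤ)) (a : Fin m → ℤ) : Prop :=
  a ∈ P ∧ ∀ b ∈ P, ∀ c ∈ P, a ≠ b + c

/-- The enumeration `δ_1, …, δ_N` of `Φ⁺` makes `(g, H, Φ⁺)` a Friedlander–Parshall triple: for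
each `k`, the set `{-δ_1, …, -δ_{k-1}, δ_k, …, δ_N}` is a positive system in which `δ_k` is
simple, and `{-δ_1, …, -δ_k}` is an additive subset of `Φ`. -/
def IsFPOrder {m N : ℕ} (δ : Fin N ≃ PosRoot m) : Prop :=
  ∀ k : Fin N,
    IsPositiveSystem ({a | ∃ i < k, a = -rootVec (δ i).1} ∪ {a | ∃ i ≥ k, a = rootVec (δ i).1}) ∧
    IsSimpleIn ({a | ∃ i < k, a = -rootVec (δ i).1} ∪ {a | ∃ i ≥ k, a = rootVec (δ i).1})
      (rootVec (δ k).1) ∧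
    IsAdditive {a | ∃ i ≤ k, a = -rootVec (δ i).1}

variable {F Γ : Type*} [Field F] [AddCommGroup Γ] {m : ℕ}

open Classical in
/-- The number `p̄` attached to `e_{ij}`: it is `p` in even degree and `2` in odd degree. -/
def pbar (p : ℕ) (ε : Bicharacter Γ F) (deg : Fin m → Γ) (q : Fin m × Fin m) : ℕ :=
  if ε.toFun (deg q.1 - deg q.2) (deg q.1 - deg q.2) = 1 then p else 2

open Classical in
/-- `H_δ = [e_δ, f_δ]`: it is `e_{ii} - e_{jj}` in even degree, `e_{ii} + e_{jj}` in odd degree. -/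
def coroot (ε : Bicharacter Γ F) (deg : Fin m → Γ) (q : Fin m × Fin m) : diagMat F m :=
  ⟨if ε.toFun (deg q.1 - deg q.2) (deg q.1 - deg q.2) = 1
    then Matrix.single q.1 q.1 1 - Matrix.single q.2 q.2 1
    else Matrix.single q.1 q.1 1 + Matrix.single q.2 q.2 1, by
      intro a b hab
      have h : ∀ i : Fin m, Matrix.single i i (1 : F) a b = 0 := by
        intro i
        rw [Matrix.single_apply, if_neg]
        rintro ⟨rfl, rfl⟩
        exact hab rfl
      split_ifs <;> simp [h]⟩

/-- The root `ε_i - ε_j` as an element of `H*`. -/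
def rootDual (F : Type*) [Field F] {m : ℕ} (q : Fin m × Fin m) : Module.Dual F (diagMat F m) where
  toFun h := h.1 q.1 q.1 - h.1 q.2 q.2
  map_add' x y := by simp; ring
  map_smul' c x := by simp; ring

/-- `l_i = l - (p̄-1)δ_1 - ⋯ - (p̄-1)δ_{i-1}`. -/
def shiftedWeight (p : ℕ) (ε : Bicharacter Γ F) (deg : Fin m → Γ) {N : ℕ} (δ : Fin N ≃ PosRoot m)
    (l : Module.Dual F (diagMat F m)) (i : Fin N) : Module.Dual F (diagMat F m) :=
  l - ∑ k ∈ Finset.univ.filter (· < i), (pbar p ε deg (δ k).1 - 1) • rootDual F (δ k).1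

/-- The image of `e_{ij}` in `u_χ(g)`. -/
def envE (p : ℕ) (ε : Bicharacter Γ F) (deg : Fin m → Γ)
    (χ : Module.Dual F (Matrix (Fin m) (Fin m) F)) (i j : Fin m) :
    ReducedEnv p ε deg χ (glSub p ε deg) :=
  sigma χ (glSub p ε deg) ⟨Matrix.single i j 1, trivial⟩

/-- `e_{δ_1}^{p̄-1} ⋯ e_{δ_N}^{p̄-1} f_{δ_1}^{p̄-1} ⋯ f_{δ_N}^{p̄-1} ∈ u_χ(g)`. -/
def topProduct (p : ℕ) (ε : Bicharacter Γ F) (deg : Fin m → Γ)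
    (χ : Module.Dual F (Matrix (Fin m) (Fin m) F)) {N : ℕ} (δ : Fin N ≃ PosRoot m) :
    ReducedEnv p ε deg χ (glSub p ε deg) :=
  (List.ofFn fun i => envE p ε deg χ (δ i).1.1 (δ i).1.2 ^ (pbar p ε deg (δ i).1 - 1)).prod *
  (List.ofFn fun i => envE p ε deg χ (δ i).1.2 (δ i).1.1 ^ (pbar p ε deg (δ i).1 - 1)).prod

/-- The weight zero part `u_χ(g)_0` for the adjoint action of `H`. -/
def envWeightZero (p : ℕ) (ε : Bicharacter Γ F) (deg : Fin m → Γ)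
    (χ : Module.Dual F (Matrix (Fin m) (Fin m) F)) :
    Set (ReducedEnv p ε deg χ (glSub p ε deg)) :=
  {u | ∀ i : Fin m, envE p ε deg χ i i * u - u * envE p ε deg χ i i = 0}

/-- The left ideal `u_χ(g) N⁺`. -/
def envIdeal (p : ℕ) (ε : Bicharacter Γ F) (deg : Fin m → Γ)
    (χ : Module.Dual F (Matrix (Fin m) (Fin m) F)) :
    Submodule (ReducedEnv p ε deg χ (glSub p ε deg)) (ReducedEnv p ε deg χ (glSub p ε deg)) :=
  Submodule.span _ {t | ∃ i j : Fin m, i < j ∧ t = envE p ε deg χ i j}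

/-- The graph of the Harish-Chandra projection: `u ∈ u_χ(g)_0`, and `u` is congruent to
`w ∈ u_χ(H)` modulo `L = u_χ(g) N⁺ ∩ u_χ(g)_0`. -/
def IsHarishChandra {p : ℕ} {ε : Bicharacter Γ F} {deg : Fin m → Γ}
    {χ : Module.Dual F (Matrix (Fin m) (Fin m) F)}
    (u : ReducedEnv p ε deg χ (glSub p ε deg)) (w : ReducedEnv p ε deg χ (torus p ε deg)) :
    Prop :=
  u ∈ envWeightZero p ε deg χ ∧
  u - envIncl χ (torus p ε deg) (glSub p ε deg) le_top w ∈ envIdeal p ε deg χ ∧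
  u - envIncl χ (torus p ε deg) (glSub p ε deg) le_top w ∈ envWeightZero p ε deg χ

/-- Evaluation at `l`: the homomorphism `u_χ(H) → F` extending `l`. -/
def evalWeight {p : ℕ} {deg : Fin m → Γ} {χ : Module.Dual F (Matrix (Fin m) (Fin m) F)}
    (ε : Bicharacter Γ F) (hχ : IsStandardSemisimple deg χ) {l : Module.Dual F (diagMat F m)}
    (hl : IsWeight p χ l) : ReducedEnv p ε deg χ (torus p ε deg) →ₐ[F] F :=
  (borelChar hχ hl).comp (envIncl χ (torus p ε deg) (borel p ε deg) (torus_le_borel p ε deg))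

end Roots

end GLColor

end

open scoped TensorProduct

universe u

noncomputable section

/-! ### The Jacobson formula -/

section Jacobson

variable {R : Type*} [Ring R] (p : ℕ) [Fact p.Prime] [CharP R p]

/-! Let `v` generate the baby Verma module `Z`. Apply `f_{δ_1}^{p̄-1}`, `f_{δ_2}^{p̄-1}`, …
successively to `v`. Before step `k` the vector is a highest weight vector, of weight `λ_k`, for the
positive system `{-δ_1, …, -δ_{k-1}, δ_k, …, δ_N}`. Since `δ_k` is simple there, the power of
`f_{δ_k}` leads to a highest weight vector for the next system. The final vector `w` is a lowest
weight vector. On the way back, `e_{δ_k}^{p̄-1}` undoes step `k` up to the rank-one scalar `(p̄-1)!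
[(λ_k(H_{δ_k})+1)^{p̄-1} - 1]` (`IsGLFamily.rankOne`, `IsGLFamily.chain`). So the `e`-product sends
`w` to the product of these scalars times `v`.

The link with simplicity is the equality `dim Z = ∏ p̄_i` (`finrank_babyVerma`). The bound from
above holds because additivity of `{-δ_1, …, -δ_k}` makes the lowering root vectors a skew-commuting
(Ore) family, so that ordered truncated monomials applied to `v` span (`IsGLFamily.ore_lower`,
`oreSpan_stable`). The bound from below comes from an explicit highest weight representation of the
right dimension. It is built by inducing from `gl(n) ⊕ gl(1)` to `gl(n+1)` on truncated color
polynomials (`exists_highestWeightRep`), and `Z` maps onto it. Its `p`-th power relations rest on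
Jacobson's formula.

Given the dimension, the vectors killed by all `f_δ` are the multiples of `w`, and every nonzero
submodule contains a nonzero one (`exists_killed`, `mem_span_top_of_killed`). If the scalar is
nonzero, each nonzero submodule therefore contains `v`. If `Z` is simple, then `w` generates it, the
ordered `e`-monomials applied to `w` form a basis by counting, and the top one is nonzero
(`IsGLFamily.top_apply_ne_zero`).

The Harish-Chandra projection exists because a height-zero product acting on the generator of
`u_χ(g)/u_χ(g)N⁺` ends in the image of `u_χ(H)`. It is unique because the weights separate `u_χ(H)`
(`eq_zero_of_evalWeight`). The theorem multiplies the `f`-powers in the order opposite to the chain.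
Both products have the maximal degree of an ordered monomial, hence are proportional
(`exists_smul_top_eq`). -/

theorem neg_one_pow_mul_choose_pred_char (j : ℕ) (hj : j < p) :
    (-1 : R) ^ j * ((p - 1).choose j : R) = 1 := by
  have hp : 0 < p := (Fact.out : p.Prime).pos
  induction j with
  | zero => simp
  | succ j ih =>
    have h1 : p.choose (j + 1) = (p - 1).choose j + (p - 1).choose (j + 1) := by
      conv_lhs => rw [← Nat.sub_add_cancel hp]
      rw [Nat.choose_succ_succ]
    have h2 : (p.choose (j + 1) : R) = 0 := by
      rw [CharP.cast_eq_zero_iff R p]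
      exact (Fact.out : p.Prime).dvd_choose_self (by omega) hj
    rw [h1, Nat.cast_add] at h2
    rw [eq_neg_of_add_eq_zero_right h2, pow_succ]
    simpa using ih (by omega)

/-- In characteristic `p` the binomial coefficients of `p - 1` are alternately `1` and `-1`, which
cancels the signs of the expansion. -/
theorem Commute.sub_pow_pred_char {x y : R} (h : Commute x y) :
    (x - y) ^ (p - 1) = ∑ j ∈ Finset.range p, x ^ (p - 1 - j) * y ^ j := by
  have hp : 0 < p := (Fact.out : p.Prime).pos
  rw [sub_eq_neg_add, (h.symm.neg_left).add_pow, Nat.sub_add_cancel hp]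
  refine Finset.sum_congr rfl fun j hj => ?_
  rw [neg_pow]
  have := neg_one_pow_mul_choose_pred_char (R := R) p j (Finset.mem_range.1 hj)
  calc (-1 : R) ^ j * y ^ j * x ^ (p - 1 - j) * ((p - 1).choose j : R)
      = ((-1 : R) ^ j * ((p - 1).choose j : R)) * (y ^ j * x ^ (p - 1 - j)) := by
        rw [← Nat.cast_comm, ← mul_assoc, ← mul_assoc, Nat.cast_comm, mul_assoc]
    _ = _ := by rw [this, one_mul, (h.symm.pow_pow j _).eq]

open Polynomial in
theorem Polynomial.derivative_pow_eq_sum (w : R[X]) (n : ℕ) :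
    derivative (w ^ n) =
      ∑ j ∈ Finset.range n, w ^ (n - 1 - j) * derivative w * w ^ j := by
  induction n with
  | zero => simp
  | succ n ih =>
    rw [pow_succ', derivative_mul, ih, Finset.sum_range_succ, add_comm, Finset.mul_sum]
    congr 1
    · refine Finset.sum_congr rfl fun j hj => ?_
      have hj := Finset.mem_range.1 hj
      rw [← mul_assoc, ← mul_assoc, ← pow_succ']
      congr 3
      omega
    · simp

/-- `ad x` is the difference of left and right multiplication by `x`, which commute. The resulting
sum has the shape of the derivative of a noncommutative `p`-th power, and this is how Lie brackets
enter Jacobson's formula. -/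
theorem lie_iterate_pred_char (x y : R) :
    (fun z => x * z - z * x)^[p - 1] y =
      ∑ j ∈ Finset.range p, x ^ (p - 1 - j) * y * x ^ j := by
  have hC : CharP (Module.End ℤ R) p := by
    constructor
    intro k
    rw [← CharP.cast_eq_zero_iff R p k]
    constructor
    · intro h
      have := congrArg (fun f : Module.End ℤ R => f 1) h
      simpa using this
    · intro h
      refine LinearMap.ext fun z => ?_
      have : ((k : Module.End ℤ R)) z = (k : R) * z := by
        simp
      rw [this, h]; simp
  have h := (LinearMap.commute_mulLeft_right (R := ℤ) x x).sub_pow_pred_char p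
  have h1 := congrArg (fun f : Module.End ℤ R => f y) h
  simp only [Module.End.pow_apply] at h1
  rw [LinearMap.sum_apply] at h1
  refine Eq.trans ?_ (h1.trans (Finset.sum_congr rfl fun j _ => ?_))
  · rfl
  · simp [LinearMap.pow_mulLeft, LinearMap.pow_mulRight, mul_assoc]

open Polynomial in
/-- Jacobson's formula: `(u + v)^p - u^p - v^p` is a Lie polynomial in `u` and `v`. -/
theorem add_pow_char_sub_mem {F : Type*} [Field F] [Algebra F R] (D : Submodule F R) (u v : R)
    (hv : v ∈ D) (hu' : ∀ z ∈ D, u * z - z * u ∈ D) (hv' : ∀ z ∈ D, v * z - z * v ∈ D) :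
    (u + v) ^ p - u ^ p - v ^ p ∈ D := by
  have hp : 0 < p := (Fact.out : p.Prime).pos
  -- The variable is central, so `w ^ p` has constant coefficient `u ^ p`, top coefficient `v ^ p`
  -- and value `(u + v) ^ p` at `1`. Only the middle coefficients have to be placed in `D`, and the
  -- derivative of `w ^ p` is `(ad w)^{p-1}(v)`.
  set w : R[X] := C u + C v * X with hw
  have hdeg : w.natDegree ≤ 1 := by
    rw [hw]
    compute_degree
  have hcoeff : ∀ n, (derivative (w ^ p)).coeff n ∈ D := by
    have h1 : derivative (w ^ p) = (fun z => w * z - z * w)^[p - 1] (C v) := by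
      rw [derivative_pow_eq_sum, lie_iterate_pred_char p]
      refine Finset.sum_congr rfl fun j _ => ?_
      simp [hw]
    rw [h1]
    have h2 : ∀ k n, ((fun z => w * z - z * w)^[k] (C v)).coeff n ∈ D := by
      intro k
      induction k with
      | zero =>
        intro n
        rw [Function.iterate_zero, id, coeff_C]
        split_ifs
        exacts [hv, D.zero_mem]
      | succ k ih =>
        intro n
        rw [Function.iterate_succ_apply']
        set z := (fun z => w * z - z * w)^[k] (C v)
        have : (w * z - z * w).coeff n = (u * z.coeff n - z.coeff n * u) +
            (if n = 0 then 0 else v * z.coeff (n - 1) - z.coeff (n - 1) * v) := by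
          rw [hw, add_mul, mul_add, coeff_sub, coeff_add, coeff_add, coeff_C_mul, coeff_mul_C,
            mul_assoc, coeff_C_mul, ← mul_assoc]
          rcases n with _ | n
          · simp
          · rw [coeff_mul_X, coeff_X_mul, coeff_mul_C]
            simp
            abel
        rw [this]
        refine D.add_mem (hu' _ (ih _)) ?_
        split_ifs
        exacts [D.zero_mem, hv' _ (ih _)]
    exact h2 _
  -- Recovering a coefficient from the derivative costs a division by `n + 1`, which is invertible
  -- below `p`.
  have hmid : ∀ n, n + 1 < p → (w ^ p).coeff (n + 1) ∈ D := by
    intro n hn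
    have h1 := hcoeff n
    rw [coeff_derivative] at h1
    have h2 : ((n : F) + 1) ≠ 0 := by
      intro h0
      have h3 : ((n + 1 : ℕ) : R) = 0 := by
        have := congrArg (algebraMap F R) h0
        simpa using this
      rw [CharP.cast_eq_zero_iff R p] at h3
      exact absurd (Nat.le_of_dvd (by omega) h3) (by omega)
    have h4 : (w ^ p).coeff (n + 1) * ((n : R) + 1)
        = ((n : F) + 1) • (w ^ p).coeff (n + 1) := by
      rw [Algebra.smul_def, Algebra.commutes]
      simp
    rw [h4] at h1
    exact (D.smul_mem_iff h2).1 h1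
  have hX : ∀ n, (w ^ n).eval 1 = (u + v) ^ n := by
    intro n
    induction n with
    | zero => simp
    | succ n ih =>
      rw [pow_succ, eval, eval₂_mul_noncomm _ _ fun k => Commute.one_right _]
      change (w ^ n).eval 1 * w.eval 1 = _
      rw [ih, pow_succ, hw]
      simp
  have h0 : ∀ n, (w ^ n).coeff 0 = u ^ n := by
    intro n
    induction n with
    | zero => simp
    | succ n ih => rw [pow_succ, mul_coeff_zero, ih, pow_succ]; simp [hw]
  have htop : ∀ n, (w ^ n).coeff n = v ^ n := by
    intro n
    have := coeff_pow_of_natDegree_le (m := n) hdeg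
    rw [mul_one] at this
    rw [this, hw]
    simp
  have hsum : (u + v) ^ p = ∑ i ∈ Finset.range (p + 1), (w ^ p).coeff i := by
    rw [← hX, eval_eq_sum_range' (n := p + 1)]
    · simp
    · refine Nat.lt_succ_of_le ((natDegree_pow_le).trans ?_)
      simpa using Nat.mul_le_mul_left p hdeg
  rw [hsum, Finset.sum_range_succ, htop]
  obtain ⟨q, rfl⟩ : ∃ q, p = q + 1 := ⟨p - 1, by omega⟩
  rw [Finset.sum_range_succ', h0]
  have : ∀ a b c : R, a + b + c - b - c = a := by intro a b c; abel
  rw [this]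
  exact D.sum_mem fun i hi => hmid i (by simpa using hi)

end Jacobson

namespace GLColor

variable {F Γ : Type*} [Field F] [AddCommGroup Γ]

/-! ### Bicharacters -/

section Bichar

variable (ε : Bicharacter Γ F)

theorem bichar_zero_left (β : Γ) : ε.toFun 0 β = 1 := by
  have := ε.add_left 0 0 β
  rw [add_zero] at this
  exact left_eq_mul.mp this

theorem bichar_zero_right (β : Γ) : ε.toFun β 0 = 1 := by
  have := ε.add_right β 0 0
  rw [add_zero] at this
  exact left_eq_mul.mp this

theorem bichar_neg_left (α β : Γ) : ε.toFun (-α) β = (ε.toFun α β)⁻¹ := by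
  rw [eq_inv_iff_mul_eq_one, ← ε.add_left, neg_add_cancel, bichar_zero_left]

theorem bichar_neg_right (α β : Γ) : ε.toFun α (-β) = (ε.toFun α β)⁻¹ := by
  rw [eq_inv_iff_mul_eq_one, ← ε.add_right, neg_add_cancel, bichar_zero_right]

theorem bichar_swap (α β : Γ) : ε.toFun β α = (ε.toFun α β)⁻¹ := by
  rw [eq_inv_iff_mul_eq_one, ε.mul_swap]

theorem bichar_nsmul_right (α β : Γ) (k : ℕ) : ε.toFun α (k • β) = ε.toFun α β ^ k := by
  induction k with
  | zero => simp [bichar_zero_right]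
  | succ k ih => rw [succ_nsmul, ε.add_right, ih, pow_succ]

theorem bichar_self (α : Γ) : (ε.toFun α α : F) = 1 ∨ (ε.toFun α α : F) = -1 := by
  have h := congrArg (Units.val) (ε.mul_swap α α)
  exact mul_self_eq_one_iff.1 (by simpa using h)

theorem bichar_neg_neg (α β : Γ) : ε.toFun (-α) (-β) = ε.toFun α β := by
  rw [bichar_neg_left, bichar_neg_right, inv_inv]

end Bichar

/-! ### The grading of matrices -/

section Degree

variable {m : ℕ} {d : Fin m → Γ}

theorem glDegree_mul {α β : Γ} {x y : Matrix (Fin m) (Fin m) F} (hx : x ∈ glDegree F d α)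
    (hy : y ∈ glDegree F d β) : x * y ∈ glDegree F d (α + β) := by
  intro i j hij
  rw [Matrix.mul_apply]
  refine Finset.sum_eq_zero fun k _ => ?_
  by_cases h : d i - d k = α
  · rw [hy k j, mul_zero]
    rintro rfl
    exact hij (by rw [← h]; abel)
  · rw [hx i k h, zero_mul]

theorem single_mem_glDegree (i j : Fin m) (c : F) :
    Matrix.single i j c ∈ glDegree F d (d i - d j) := by
  intro a b hab
  rw [Matrix.single_apply, if_neg]
  rintro ⟨rfl, rfl⟩
  exact hab rfl

theorem single_mem_glDegree_of_eq {i j : Fin m} {α : Γ} (h : d i - d j = α) (c : F) :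
    Matrix.single i j c ∈ glDegree F d α :=
  h ▸ single_mem_glDegree i j c

/-- A homogeneous component is spanned by the matrix units it contains; this reduces all linear or
`p`-semilinear checks to matrix units. -/
theorem glDegree_le {α : Γ} {P : Submodule F (Matrix (Fin m) (Fin m) F)}
    (h : ∀ i j, d i - d j = α → Matrix.single i j 1 ∈ P) : glDegree F d α ≤ P := by
  intro x hx
  rw [Matrix.matrix_eq_sum_single x]
  refine P.sum_mem fun i _ => P.sum_mem fun j _ => ?_
  by_cases hij : d i - d j = α
  · have : Matrix.single i j (x i j) = x i j • (Matrix.single i j (1 : F)) := by simp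
    rw [this]
    exact P.smul_mem _ (h i j hij)
  · rw [hx i j hij]
    simp

end Degree

/-! ### Color representations of `gl(m,Γ)` -/

section Rep

variable {A : Type*} [Ring A] [Algebra F A]

/-- The bracket `xy - c yx`. -/
def cbr (c : F) (x y : A) : A := x * y - c • (y * x)

theorem cbr_add_left (c : F) (x x' y : A) : cbr c (x + x') y = cbr c x y + cbr c x' y := by
  simp only [cbr, add_mul, mul_add, smul_add]; abel

theorem cbr_add_right (c : F) (x y y' : A) : cbr c x (y + y') = cbr c x y + cbr c x y' := by
  simp only [cbr, add_mul, mul_add, smul_add]; abel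

theorem cbr_smul_left (c a : F) (x y : A) : cbr c (a • x) y = a • cbr c x y := by
  simp only [cbr, smul_mul_assoc, mul_smul_comm, smul_sub, smul_comm a c]

theorem cbr_smul_right (c a : F) (x y : A) : cbr c x (a • y) = a • cbr c x y := by
  simp only [cbr, smul_mul_assoc, mul_smul_comm, smul_sub, smul_comm a c]

@[simp] theorem cbr_zero_left (c : F) (y : A) : cbr c 0 y = 0 := by simp [cbr]

@[simp] theorem cbr_zero_right (c : F) (y : A) : cbr c y 0 = 0 := by simp [cbr]

theorem cbr_swap {c c' : F} (h : c' * c = 1) (x y : A) : cbr c' y x = -(c' • cbr c x y) := by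
  simp only [cbr, smul_sub, smul_smul, h, one_smul]
  abel

/-- The color Jacobi identity. -/
theorem cbr_cbr (a b y : A) {e₁ e₁' e₂ e₃ : F} (h : e₁ * e₁' = 1) :
    cbr (e₂ * e₃) (cbr e₁ a b) y =
      cbr (e₁ * e₂) a (cbr e₃ b y) - e₁ • cbr (e₁' * e₃) b (cbr e₂ a y) := by
  have h' : e₁ * (e₁' * e₃) = e₃ := by rw [← mul_assoc, h, one_mul]
  have h2 : e₁ * (e₁' * (e₃ * e₂)) = e₂ * e₃ := by rw [← mul_assoc, h]; ring
  simp only [cbr, sub_mul, mul_sub, smul_sub, smul_mul_assoc, mul_smul_comm, smul_smul, mul_assoc,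
    h', h2]
  rw [show e₁ * (e₂ * e₃) = e₂ * (e₃ * e₁) by ring]
  abel

variable {m : ℕ}

/-- `L` respects the color brackets. -/
def IsColorRep (ε : Bicharacter Γ F) (d : Fin m → Γ) (L : Matrix (Fin m) (Fin m) F →ₗ[F] A) :
    Prop :=
  ∀ α β x y, x ∈ glDegree F d α → y ∈ glDegree F d β →
    cbr (ε.toFun α β : F) (L x) (L y) = L (cbr (ε.toFun α β : F) x y)

variable {ε : Bicharacter Γ F} {d : Fin m → Γ} {L : Matrix (Fin m) (Fin m) F →ₗ[F] A}

theorem cbr_mem_glDegree {α β : Γ} {x y : Matrix (Fin m) (Fin m) F} (c : F)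
    (hx : x ∈ glDegree F d α) (hy : y ∈ glDegree F d β) : cbr c x y ∈ glDegree F d (α + β) :=
  Submodule.sub_mem _ (glDegree_mul hx hy)
    (Submodule.smul_mem _ _ (add_comm β α ▸ glDegree_mul hy hx))

theorem cbr_rep_of_single_left {α : Γ} {c : F} {y : Matrix (Fin m) (Fin m) F}
    (h : ∀ i j, d i - d j = α →
      cbr c (L (Matrix.single i j 1)) (L y) = L (cbr c (Matrix.single i j 1) y))
    {x : Matrix (Fin m) (Fin m) F} (hx : x ∈ glDegree F d α) :
    cbr c (L x) (L y) = L (cbr c x y) := by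
  let P : Submodule F (Matrix (Fin m) (Fin m) F) :=
    { carrier := {x | cbr c (L x) (L y) = L (cbr c x y)}
      zero_mem' := by simp
      add_mem' := by
        intro a b ha hb
        simp only [Set.mem_ofPred_eq, map_add, cbr_add_left] at *
        rw [ha, hb]
      smul_mem' := by
        intro a b hb
        simp only [Set.mem_ofPred_eq, map_smul, cbr_smul_left] at *
        rw [hb] }
  exact glDegree_le (P := P) h hx

theorem cbr_rep_of_single_right {β : Γ} {c : F} {x : Matrix (Fin m) (Fin m) F}
    (h : ∀ i j, d i - d j = β →
      cbr c (L x) (L (Matrix.single i j 1)) = L (cbr c x (Matrix.single i j 1)))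
    {y : Matrix (Fin m) (Fin m) F} (hy : y ∈ glDegree F d β) :
    cbr c (L x) (L y) = L (cbr c x y) := by
  let P : Submodule F (Matrix (Fin m) (Fin m) F) :=
    { carrier := {y | cbr c (L x) (L y) = L (cbr c x y)}
      zero_mem' := by simp
      add_mem' := by
        intro a b ha hb
        simp only [Set.mem_ofPred_eq, map_add, cbr_add_right] at *
        rw [ha, hb]
      smul_mem' := by
        intro a b hb
        simp only [Set.mem_ofPred_eq, map_smul, cbr_smul_right] at *
        rw [hb] }
  exact glDegree_le (P := P) h hy

theorem isColorRep_of_single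
    (h : ∀ i j k l, cbr (ε.toFun (d i - d j) (d k - d l) : F) (L (Matrix.single i j 1))
        (L (Matrix.single k l 1)) =
      L (cbr (ε.toFun (d i - d j) (d k - d l) : F) (Matrix.single i j 1)
        (Matrix.single k l 1))) : IsColorRep ε d L := by
  intro α β x y hx hy
  refine cbr_rep_of_single_left (fun i j hij => ?_) hx
  refine cbr_rep_of_single_right (fun k l hkl => ?_) hy
  rw [← hij, ← hkl]
  exact h i j k l

theorem cbr_swap_rep {α β : Γ} {x y : Matrix (Fin m) (Fin m) F}
    (h : cbr (ε.toFun α β : F) (L x) (L y) = L (cbr (ε.toFun α β : F) x y)) :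
    cbr (ε.toFun β α : F) (L y) (L x) = L (cbr (ε.toFun β α : F) y x) := by
  have h1 : (ε.toFun β α : F) * ε.toFun α β = 1 := by
    rw [← Units.val_mul, ε.mul_swap, Units.val_one]
  rw [cbr_swap h1, cbr_swap h1, h, map_neg, map_smul]

variable (p : ℕ) [Fact p.Prime] [CharP F p]

theorem add_pow_char_sub_mem' (D : Submodule F A) (u v : A)
    (hv : v ∈ D) (hu' : ∀ z ∈ D, u * z - z * u ∈ D) (hv' : ∀ z ∈ D, v * z - z * v ∈ D) :
    (u + v) ^ p - u ^ p - v ^ p ∈ D := by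
  rcases subsingleton_or_nontrivial A with h | h
  · rw [Subsingleton.elim ((u + v) ^ p - u ^ p - v ^ p) 0]
    exact D.zero_mem
  · have : CharP A p := charP_of_injective_algebraMap (algebraMap F A).injective p
    exact add_pow_char_sub_mem p D u v hv hu' hv'

/-- By Jacobson's formula the failure of the `p`-th power to be additive is a Lie polynomial, and
`L` respects the brackets occurring in it. The defect `L x ^ p - L (x ^ p)` is therefore additive.
-/
theorem IsColorRep.add_pow (hL : IsColorRep ε d L) {α : Γ} (hα : ε.toFun α α = 1)
    {x y : Matrix (Fin m) (Fin m) F} (hx : x ∈ glDegree F d α) (hy : y ∈ glDegree F d α) :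
    L (x + y) ^ p - L ((x + y) ^ p) =
      (L x ^ p - L (x ^ p)) + (L y ^ p - L (y ^ p)) := by
  -- Working in the graph of `L` treats the Lie polynomial in `A` and in matrices at once. Only
  -- degrees `k • α` occur; there `(α, kα) = 1`, so color brackets with degree `α` are plain
  -- commutators.
  let D : Submodule F (A × Matrix (Fin m) (Fin m) F) :=
    ⨆ k : ℕ, (glDegree F d (k • α)).map (L.prod LinearMap.id)
  have hmem : ∀ k : ℕ, ∀ z ∈ glDegree F d (k • α), (L z, z) ∈ D := fun k z hz =>
    Submodule.mem_iSup_of_mem k ⟨z, hz, rfl⟩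
  have hgr : D ≤ LinearMap.ker (LinearMap.fst F A (Matrix (Fin m) (Fin m) F) -
      L ∘ₗ LinearMap.snd F A (Matrix (Fin m) (Fin m) F)) := by
    refine iSup_le fun k => ?_
    rintro _ ⟨z, _, rfl⟩
    simp
  have had : ∀ z ∈ glDegree F d α, ∀ w ∈ D,
      ((L z, z) : A × Matrix (Fin m) (Fin m) F) * w - w * (L z, z) ∈ D := by
    intro z hz w hw
    induction hw using Submodule.iSup_induction' with
    | mem k w hw =>
      obtain ⟨t, ht, rfl⟩ := hw
      have h1 : (ε.toFun α (k • α) : F) = 1 := by simp [bichar_nsmul_right, hα]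
      have h2 := hL α (k • α) z t hz ht
      have h3 := cbr_mem_glDegree (1 : F) hz ht
      rw [h1] at h2
      simp only [cbr, one_smul] at h2 h3
      have h4 := hmem (k + 1) (z * t - t * z) (by rwa [succ_nsmul, add_comm])
      rw [← h2] at h4
      exact h4
    | zero => simp
    | add a b _ _ ha hb =>
      have : ((L z, z) : A × Matrix (Fin m) (Fin m) F) * (a + b) - (a + b) * (L z, z) =
        ((L z, z) * a - a * (L z, z)) + ((L z, z) * b - b * (L z, z)) := by
        rw [mul_add, add_mul]; abel
      rw [this]
      exact D.add_mem ha hb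
  have h1 := hgr (add_pow_char_sub_mem' p D (L x, x) (L y, y)
    (hmem 1 y (by rwa [one_nsmul])) (had x hx) (had y hy))
  have h2 : (L x + L y) ^ p - L x ^ p - L y ^ p = L ((x + y) ^ p - x ^ p - y ^ p) := by
    have := LinearMap.mem_ker.1 h1
    simpa [sub_eq_zero] using this
  rw [map_sub, map_sub] at h2
  rw [map_add]
  have h3 : (L x + L y) ^ p = L ((x + y) ^ p) - L (x ^ p) - L (y ^ p) + L x ^ p + L y ^ p := by
    rw [← h2]; abel
  rw [h3]
  abel

/-- It suffices to check the `p`-th power relations on matrix units. -/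
theorem IsColorRep.pow (hL : IsColorRep ε d L) (X : Fin m → F)
    (hoff : ∀ i j, i ≠ j → ε.toFun (d i - d j) (d i - d j) = 1 → L (Matrix.single i j 1) ^ p = 0)
    (hdiag : ∀ i, L (Matrix.single i i 1) ^ p - L (Matrix.single i i 1) = algebraMap F A (X i))
    {α : Γ} (hα : ε.toFun α α = 1) {x : Matrix (Fin m) (Fin m) F} (hx : x ∈ glDegree F d α) :
    L x ^ p - L (x ^ p) = algebraMap F A (∑ i, x i i ^ p * X i) := by
  have hp0 : p ≠ 0 := (Fact.out : p.Prime).pos.ne'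
  let P : Submodule F (Matrix (Fin m) (Fin m) F) :=
    { carrier := {x | x ∈ glDegree F d α ∧
        L x ^ p - L (x ^ p) = algebraMap F A (∑ i, x i i ^ p * X i)}
      zero_mem' := by
        refine ⟨Submodule.zero_mem _, ?_⟩
        simp [zero_pow hp0]
      add_mem' := by
        rintro a b ⟨ha, ha'⟩ ⟨hb, hb'⟩
        refine ⟨Submodule.add_mem _ ha hb, ?_⟩
        rw [hL.add_pow p hα ha hb, ha', hb', ← map_add, ← Finset.sum_add_distrib]
        congr 1
        refine Finset.sum_congr rfl fun i _ => ?_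
        rw [Matrix.add_apply, add_pow_char, add_mul]
      smul_mem' := by
        rintro c a ⟨ha, ha'⟩
        refine ⟨Submodule.smul_mem _ _ ha, ?_⟩
        rw [map_smul, smul_pow, smul_pow, map_smul, ← smul_sub, ha', ← Algebra.linearMap_apply,
          ← map_smul, Algebra.linearMap_apply, Finset.smul_sum]
        congr 1
        refine Finset.sum_congr rfl fun i _ => ?_
        rw [Matrix.smul_apply, smul_eq_mul, smul_eq_mul, mul_pow, mul_assoc] }
  refine (glDegree_le (P := P) (fun i j hij => ⟨single_mem_glDegree_of_eq hij 1, ?_⟩) hx).2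
  obtain ⟨q, rfl⟩ : ∃ q, p = q + 1 + 1 := ⟨p - 2, by have := (Fact.out : p.Prime).two_le; omega⟩
  by_cases h : i = j
  · subst h
    have h1 : ∀ n : ℕ, (Matrix.single i i (1 : F)) ^ (n + 1) = Matrix.single i i (1 : F) := by
      intro n
      induction n with
      | zero => simp
      | succ n ih => rw [_root_.pow_succ, ih]; simp
    rw [h1, hdiag]
    congr 1
    rw [Finset.sum_eq_single i]
    · simp
    · intro b _ hb
      simp [hb.symm]
    · simp
  · have h1 : (Matrix.single i j (1 : F)) ^ (q + 1 + 1) = 0 := by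
      rw [_root_.pow_succ, _root_.pow_succ, mul_assoc]
      have : Matrix.single i j (1 : F) * Matrix.single i j 1 = 0 := by
        simp [Ne.symm h]
      rw [this, mul_zero]
    rw [h1, hoff i j h (by rw [hij]; exact hα), map_zero, sub_zero]
    symm
    rw [Finset.sum_eq_zero, map_zero]
    intro k _
    rw [Matrix.single_apply, if_neg, zero_pow (by omega), zero_mul]
    rintro ⟨rfl, rfl⟩
    exact h rfl

end Rep

/-! ### Truncated color polynomials and color derivations -/

section Shift

variable {F S : Type*} [Field F] [AddCommGroup S] [Module F S] (N : ℕ)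

/-- Multiplication by the new variable on `S[y]/(y^N)`. -/
def shiftUp : Module.End F (Fin N → S) where
  toFun f a := if h : 0 < a.1 then f ⟨a.1 - 1, by omega⟩ else 0
  map_add' f g := by funext a; by_cases h : 0 < a.1 <;> simp [h]
  map_smul' c f := by funext a; by_cases h : 0 < a.1 <;> simp [h]

/-- The derivative with respect to the new variable on `S[y]/(y^N)`. -/
def shiftDown : Module.End F (Fin N → S) where
  toFun f a := if h : a.1 + 1 < N then ((a.1 : F) + 1) • f ⟨a.1 + 1, h⟩ else 0
  map_add' f g := by funext a; by_cases h : a.1 + 1 < N <;> simp [h]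
  map_smul' c f := by
    funext a
    by_cases h : a.1 + 1 < N
    · simp [h, smul_comm c]
    · simp [h]

/-- The operator `y^a s ↦ c^a y^a T s` on `S[y]/(y^N)`. -/
def twist (c : F) (T : Module.End F S) : Module.End F (Fin N → S) where
  toFun f a := c ^ a.1 • T (f a)
  map_add' f g := by funext a; simp
  map_smul' c f := by funext a; simp [smul_comm c]

variable {N}

theorem shiftUp_apply (f : Fin N → S) (a : Fin N) :
    shiftUp (F := F) N f a = if h : 0 < a.1 then f ⟨a.1 - 1, by omega⟩ else 0 := rfl

theorem shiftDown_apply (f : Fin N → S) (a : Fin N) : shiftDown (F := F) N f a =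
    if h : a.1 + 1 < N then ((a.1 : F) + 1) • f ⟨a.1 + 1, h⟩ else 0 := rfl

theorem twist_apply (c : F) (T : Module.End F S) (f : Fin N → S) (a : Fin N) :
    twist N c T f a = c ^ a.1 • T (f a) := rfl

theorem twist_mul (c c' : F) (T T' : Module.End F S) :
    twist N c T * twist N c' T' = twist N (c * c') (T * T') := by
  refine LinearMap.ext fun f => funext fun a => ?_
  simp only [Module.End.mul_apply, twist_apply, map_smul, smul_smul, mul_pow]

theorem twist_shiftUp (c : F) (T : Module.End F S) :
    twist N c T * shiftUp N = c • (shiftUp N * twist N c T) := by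
  refine LinearMap.ext fun f => funext fun a => ?_
  simp only [Module.End.mul_apply, twist_apply, LinearMap.smul_apply, Pi.smul_apply, shiftUp_apply]
  split_ifs with h
  · rw [smul_smul, ← pow_succ', Nat.sub_add_cancel h]
  · simp

theorem shiftDown_twist (c : F) (T : Module.End F S) :
    shiftDown N * twist N c T = c • (twist N c T * shiftDown N) := by
  refine LinearMap.ext fun f => funext fun a => ?_
  simp only [Module.End.mul_apply, twist_apply, LinearMap.smul_apply, Pi.smul_apply,
    shiftDown_apply]
  split_ifs with h
  · rw [map_smul, smul_smul, smul_smul, smul_smul]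
    congr 1
    ring
  · simp

/-- The Leibniz rule could fail only on `y^{N-1}`: there `∂ y` gives `0` while `y ∂ + 1` gives `N
y^{N-1}`. The hypothesis `N = 0` in `F` is what makes the truncation compatible with the derivation.
-/
theorem shiftDown_shiftUp_even (hN : (N : F) = 0) :
    shiftDown N * shiftUp N = shiftUp N * shiftDown N + (1 : Module.End F (Fin N → S)) := by
  refine LinearMap.ext fun f => funext fun a => ?_
  have ha := a.2
  simp only [Module.End.mul_apply, LinearMap.add_apply, Pi.add_apply, shiftUp_apply,
    shiftDown_apply, Module.End.one_apply]
  rcases Nat.eq_zero_or_pos a.1 with h0 | h0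
  · by_cases h1 : a.1 + 1 < N
    · obtain ⟨a, ha'⟩ := a
      obtain rfl : a = 0 := h0
      simp at h1
      simp [h1]
    · have : N = 1 := by omega
      subst this
      simp at hN
  · have e : (⟨a.1 - 1 + 1, by omega⟩ : Fin N) = a := Fin.ext (by simp; omega)
    have e2 : ((a.1 - 1 : ℕ) : F) + 1 = a.1 := by
      rw [← Nat.cast_succ]; congr 1; omega
    have h3 : a.1 - 1 + 1 < N := by omega
    by_cases h1 : a.1 + 1 < N
    · simp only [h1, h0, h3, dif_pos, e, e2, Nat.add_sub_cancel, Nat.zero_lt_succ]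
      rw [add_smul, one_smul]
    · have h4 : ((a.1 : ℕ) : F) + 1 = 0 := by
        rw [← Nat.cast_succ, ← hN]; congr 1; omega
      simp only [h1, h0, h3, dif_pos, dif_neg, e, e2, not_false_eq_true]
      rw [eq_neg_of_add_eq_zero_left h4]
      simp

/-- For an anticommuting variable the truncation at `2` needs no condition on the characteristic: `∂
y + y ∂` is the identity on both `1` and `y`. -/
theorem shiftDown_shiftUp_odd :
    shiftDown 2 * shiftUp 2 = - (shiftUp 2 * shiftDown 2) + (1 : Module.End F (Fin 2 → S)) := by
  refine LinearMap.ext fun f => funext fun a => ?_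
  simp only [Module.End.mul_apply, LinearMap.add_apply, Pi.add_apply, shiftUp_apply,
    shiftDown_apply, Module.End.one_apply, LinearMap.neg_apply, Pi.neg_apply]
  fin_cases a <;> simp

theorem shiftUp_pow_apply (k : ℕ) (f : Fin N → S) (a : Fin N) :
    (shiftUp (F := F) N ^ k) f a = if h : k ≤ a.1 then f ⟨a.1 - k, by omega⟩ else 0 := by
  induction k generalizing a with
  | zero => simp
  | succ k ih =>
    rw [pow_succ', Module.End.mul_apply, shiftUp_apply]
    by_cases h : 0 < a.1
    · rw [dif_pos h, ih]
      by_cases h1 : k + 1 ≤ a.1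
      · rw [dif_pos h1, dif_pos (by simp; omega)]
        congr 2
        simp; omega
      · rw [dif_neg h1, dif_neg (by simp; omega)]
    · rw [dif_neg h, dif_neg (by omega)]

theorem shiftUp_pow_self : (shiftUp N : Module.End F (Fin N → S)) ^ N = 0 := by
  refine LinearMap.ext fun f => funext fun a => ?_
  rw [shiftUp_pow_apply, dif_neg (by have := a.2; omega)]
  rfl

theorem shiftUp_pow_single (h0 : 0 < N) (a : Fin N) (s : S) :
    (shiftUp (F := F) N ^ a.1) (Pi.single ⟨0, h0⟩ s) = Pi.single a s := by
  funext b
  rw [shiftUp_pow_apply]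
  by_cases h : b = a
  · subst h
    simp
  · rw [Pi.single_eq_of_ne h]
    split_ifs with h1
    · refine Pi.single_eq_of_ne (fun h2 => h (Fin.ext ?_)) _
      have := congrArg Fin.val h2
      simp at this
      omega
    · rfl

end Shift

/-! ### Modules over truncated color Weyl algebras. -/

section Weyl

variable {F : Type u} {Γ : Type*} [Field F] [AddCommGroup Γ]

open Classical in
/-- The truncation exponent in degree `α`. -/
def trunc (p : ℕ) (ε : Bicharacter Γ F) (α : Γ) : ℕ := if ε.toFun α α = 1 then p else 2

/-- A module over the color Weyl algebra in `n` variables of degrees `η`, generated by a vacuum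
vector. -/
structure ColorWeyl (p : ℕ) (ε : Bicharacter Γ F) {n : ℕ} (η : Fin n → Γ) (S : Type*)
    [AddCommGroup S] [Module F S] where
  Y : Fin n → Module.End F S
  D : Fin n → Module.End F S
  τ : Γ → Module.End F S
  s₀ : S
  Y_Y : ∀ i j, Y i * Y j = (ε.toFun (η i) (η j) : F) • (Y j * Y i)
  D_Y : ∀ i j, D i * Y j =
    (ε.toFun (-η i) (η j) : F) • (Y j * D i) + if i = j then 1 else 0
  τ_Y : ∀ γ j, τ γ * Y j = (ε.toFun γ (η j) : F) • (Y j * τ γ)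
  D_s₀ : ∀ i, D i s₀ = 0
  τ_s₀ : ∀ γ, τ γ s₀ = s₀
  Y_pow : ∀ i, ε.toFun (η i) (η i) = 1 → Y i ^ p = 0
  generated : ∀ P : Submodule F S, s₀ ∈ P → (∀ i, ∀ s ∈ P, Y i s ∈ P) → P = ⊤

theorem trunc_cases (p : ℕ) (ε : Bicharacter Γ F) (α : Γ) :
    ε.toFun α α = 1 ∧ trunc p ε α = p ∨ (ε.toFun α α : F) = -1 ∧ trunc p ε α = 2 := by
  by_cases h : ε.toFun α α = 1
  · exact Or.inl ⟨h, by simp [trunc, h]⟩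
  · refine Or.inr ⟨(bichar_self ε α).resolve_left fun h1 => h (Units.ext h1), by simp [trunc, h]⟩

theorem bichar_mul_swap (ε : Bicharacter Γ F) (α β : Γ) :
    (ε.toFun α β : F) * ε.toFun β α = 1 := by
  rw [← Units.val_mul, ε.mul_swap, Units.val_one]

/-- Variables are adjoined one at a time: `S` becomes `S[y]/(y^N)` with `N` equal to `p` or `2` by
parity. As `y^a` is written on the left, an old operator crosses it and picks up the `a`-th power of
a bicharacter value, which is the purpose of `twist`. -/
theorem exists_colorWeyl (p : ℕ) [Fact p.Prime] [CharP F p] (ε : Bicharacter Γ F) (n : ℕ)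
    (η : Fin n → Γ) :
    ∃ (S : Type u) (_ : AddCommGroup S) (_ : Module F S) (_ : ColorWeyl p ε η S),
      FiniteDimensional F S ∧ Module.finrank F S = ∏ i, trunc p ε (η i) := by
  induction n with
  | zero =>
    refine ⟨F, inferInstance, inferInstance,
      { Y := Fin.elim0, D := Fin.elim0, τ := fun _ => 1, s₀ := 1,
        Y_Y := fun i => i.elim0, D_Y := fun i => i.elim0, τ_Y := fun _ i => i.elim0,
        D_s₀ := fun i => i.elim0, τ_s₀ := fun _ => rfl, Y_pow := fun i => i.elim0,
        generated := ?_ }, inferInstance, by simp⟩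
    intro P hP _
    exact (Ideal.eq_top_iff_one P).2 hP
  | succ n ih =>
    obtain ⟨S, _, _, W, hfd, hfr⟩ := ih (fun i => η i.castSucc)
    set θ := η (Fin.last n) with hθ
    obtain ⟨N, hN⟩ : ∃ N, N = trunc p ε θ := ⟨_, rfl⟩
    have hN0 : 0 < N := by
      rw [hN, trunc]
      have := (Fact.out : p.Prime).pos
      split_ifs <;> omega
    let Y : Fin (n + 1) → Module.End F (Fin N → S) := fun i =>
      Fin.lastCases (motive := fun _ => Module.End F (Fin N → S))
          (shiftUp N) (fun i => twist N (ε.toFun (η i.castSucc) θ : F) (W.Y i)) i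
    let D : Fin (n + 1) → Module.End F (Fin N → S) := fun i =>
      Fin.lastCases (motive := fun _ => Module.End F (Fin N → S))
          (shiftDown N) (fun i => twist N (ε.toFun (-η i.castSucc) θ : F) (W.D i)) i
    have hY₁ : Y (Fin.last n) = shiftUp N := by simp [Y]
    have hY₂ : ∀ k, Y (Fin.castSucc k) = twist N (ε.toFun (η k.castSucc) θ : F) (W.Y k) := by
      simp [Y]
    have hD₁ : D (Fin.last n) = shiftDown N := by simp [D]
    have hD₂ : ∀ k, D (Fin.castSucc k) = twist N (ε.toFun (-η k.castSucc) θ : F) (W.D k) := by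
      simp [D]
    have hsw := bichar_mul_swap ε
    have htw : ∀ (a c : F) (T T' : Module.End F S), T = c • T' →
        twist N a T = c • twist N a T' := by
      rintro a c _ T' rfl
      refine LinearMap.ext fun f => funext fun b => ?_
      simp [twist_apply, smul_comm c]
    refine ⟨Fin N → S, inferInstance, inferInstance,
      { Y := Y, D := D, τ := fun γ => twist N (ε.toFun γ θ : F) (W.τ γ),
        s₀ := Pi.single ⟨0, hN0⟩ W.s₀
        Y_Y := ?_, D_Y := ?_, τ_Y := ?_, D_s₀ := ?_, τ_s₀ := ?_, Y_pow := ?_, generated := ?_ },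
      inferInstance, ?_⟩
    · intro i j
      induction i using Fin.lastCases with
      | last =>
        induction j using Fin.lastCases with
        | last =>
          rw [hY₁]
          rcases trunc_cases p ε θ with ⟨h, -⟩ | ⟨-, h⟩
          · rw [← hθ, h, Units.val_one, one_smul]
          · rw [h] at hN
            subst hN
            -- For odd `y` the relation `y y = -y y` holds because `y^2 = 0`.
            have : (shiftUp 2 : Module.End F (Fin 2 → S)) * shiftUp 2 = 0 := by
              rw [← sq, shiftUp_pow_self]
            rw [this, smul_zero]
        | cast j => rw [hY₁, hY₂, twist_shiftUp, smul_smul, ← hθ, hsw, one_smul]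
      | cast i =>
        induction j using Fin.lastCases with
        | last => rw [hY₁, hY₂, twist_shiftUp]
        | cast j =>
          rw [hY₂, hY₂, twist_mul, twist_mul, mul_comm]
          exact htw _ _ _ _ (W.Y_Y i j)
    · intro i j
      induction i using Fin.lastCases with
      | last =>
        induction j using Fin.lastCases with
        | last =>
          rw [hY₁, hD₁, if_pos rfl, bichar_neg_left, ← hθ]
          rcases trunc_cases p ε θ with ⟨h, h'⟩ | ⟨h, h'⟩
          · rw [h, inv_one, Units.val_one, one_smul]
            exact shiftDown_shiftUp_even (by rw [hN, h']; exact CharP.cast_eq_zero F p)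
          · rw [h'] at hN
            subst hN
            rw [Units.val_inv_eq_inv_val, h, inv_neg, inv_one, neg_one_smul]
            exact shiftDown_shiftUp_odd
        | cast j =>
          rw [hY₂, hD₁, if_neg (Fin.castSucc_ne_last j).symm, add_zero, shiftDown_twist, ← hθ,
            bichar_neg_left, ← bichar_swap]
      | cast i =>
        induction j using Fin.lastCases with
        | last =>
          rw [hY₁, hD₂, if_neg (Fin.castSucc_ne_last i), add_zero, twist_shiftUp]
        | cast j =>
          rw [hY₂, hD₂, twist_mul, twist_mul, W.D_Y, mul_comm (ε.toFun (η j.castSucc) θ : F)]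
          by_cases hij : i = j
          · subst hij
            rw [if_pos rfl, if_pos rfl, bichar_neg_left, Units.val_inv_eq_inv_val,
              inv_mul_cancel₀ (Units.ne_zero _)]
            refine LinearMap.ext fun f => funext fun b => ?_
            simp [twist_apply]
          · rw [if_neg hij, if_neg (by simpa using hij), add_zero, add_zero]
            exact htw _ _ _ _ rfl
    · intro γ j
      induction j using Fin.lastCases with
      | last => rw [hY₁, twist_shiftUp]
      | cast j =>
        rw [hY₂, twist_mul, twist_mul, mul_comm]
        exact htw _ _ _ _ (W.τ_Y γ j)
    · intro i
      induction i using Fin.lastCases with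
      | last =>
        rw [hD₁]
        funext b
        simp [shiftDown_apply]
      | cast i =>
        rw [hD₂]
        funext b
        by_cases hb : b = ⟨0, hN0⟩
        · subst hb
          simp [twist_apply, W.D_s₀]
        · simp [twist_apply, hb]
    · intro γ
      funext b
      by_cases hb : b = ⟨0, hN0⟩
      · subst hb
        simp [twist_apply, W.τ_s₀]
      · simp [twist_apply, hb]
    · intro i hi
      induction i using Fin.lastCases with
      | last =>
        have : N = p := by rw [hN, trunc, if_pos hi]
        rw [hY₁]
        subst this
        exact shiftUp_pow_self
      | cast i =>
        rw [hY₂]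
        have : ∀ (k : ℕ) (c : F) (T : Module.End F S), twist N c T ^ k = twist N (c ^ k) (T ^ k) := by
          intro k c T
          induction k with
          | zero =>
            refine LinearMap.ext fun f => funext fun b => ?_
            simp [twist_apply]
          | succ k ih => rw [pow_succ, pow_succ, pow_succ, ih, twist_mul]
        rw [this, W.Y_pow i hi]
        refine LinearMap.ext fun f => funext fun b => ?_
        simp [twist_apply]
    · intro P h0 hP
      -- On `y`-degree zero the twists are trivial, so the old variables generate this slice; powers
      -- of `y` then reach all the others.
      have h1 : P.comap (LinearMap.single F (fun _ : Fin N => S) ⟨0, hN0⟩) = ⊤ := by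
        refine W.generated _ h0 fun i s hs => ?_
        have h2 := hP i.castSucc _ hs
        rw [hY₂] at h2
        rw [Submodule.mem_comap]
        convert h2 using 1
        funext b
        by_cases hb : b = ⟨0, hN0⟩
        · subst hb
          simp [twist_apply]
        · simp [twist_apply, hb]
      have h2 : ∀ (a : Fin N) (s : S), Pi.single a s ∈ P := by
        intro a s
        rw [← shiftUp_pow_single (F := F) hN0]
        have h3 : Pi.single ⟨0, hN0⟩ s ∈ P := by
          have : s ∈ P.comap (LinearMap.single F (fun _ : Fin N => S) ⟨0, hN0⟩) := by
            rw [h1]; trivial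
          exact this
        generalize a.1 = k
        induction k with
        | zero => exact h3
        | succ k ih =>
          rw [pow_succ', Module.End.mul_apply]
          have := hP (Fin.last n) _ ih
          rwa [hY₁] at this
      refine eq_top_iff.2 fun f _ => ?_
      rw [← Finset.univ_sum_single f]
      exact P.sum_mem fun a _ => h2 a _
    · rw [Module.finrank_pi_fintype, Finset.sum_const, Finset.card_univ, Fintype.card_fin, hfr,
        Fin.prod_univ_castSucc, ← hθ, ← hN, smul_eq_mul, mul_comm]

end Weyl

/-! ### Brackets of the induced operators with the lowering elements. -/

section Step

variable {F : Type*} {Γ : Type*} [Field F] [AddCommGroup Γ] {T : Type*} [Ring T] [Algebra F T]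
  {n : ℕ}

theorem cbr_single {m : ℕ} (c : F) (i j k l : Fin m) :
    cbr c (Matrix.single i j (1 : F)) (Matrix.single k l 1) =
      (if j = k then Matrix.single i l 1 else 0) -
        c • (if l = i then Matrix.single k j 1 else 0) := by
  rw [cbr]
  congr 1
  · split_ifs with h
    · subst h; simp
    · simp [h]
  · congr 1
    split_ifs with h
    · subst h; simp
    · simp [h]

/-- The operators of the module induced from `gl(n) ⊕ gl(1)` to `gl(n+1)`, written in terms of
multiplications `Y`, derivations `D`, twists `τ` and the operators `e` of `gl(n)`. -/
def inducedOp (ε : Bicharacter Γ F) (d : Fin (n + 1) → Γ) (r : F) (Y D : Fin n → T) (τ : Γ → T)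
    (e : Fin n → Fin n → T) (i j : Fin (n + 1)) : T :=
  Fin.lastCases (motive := fun _ => T)
    (Fin.lastCases (motive := fun _ => T) (algebraMap F T r + ∑ l, Y l * D l) Y j)
    (fun i => Fin.lastCases (motive := fun _ => T)
      (∑ l, τ (d i.castSucc - d l.castSucc) * D l * e i l -
        (ε.toFun (d i.castSucc - d (Fin.last n)) (d (Fin.last n) - d i.castSucc) : F) •
          ((algebraMap F T r + ∑ l, Y l * D l) * D i))
      (fun j => τ (d i.castSucc - d j.castSucc) * e i j -
        (ε.toFun (d i.castSucc - d j.castSucc) (d (Fin.last n) - d i.castSucc) : F) •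
          (Y j * D i)) j) i

variable {ε : Bicharacter Γ F} {d : Fin (n + 1) → Γ} {r : F} {Y D : Fin n → T} {τ : Γ → T}
    {e : Fin n → Fin n → T}

theorem inducedOp_last_last : inducedOp ε d r Y D τ e (Fin.last n) (Fin.last n) =
    algebraMap F T r + ∑ l, Y l * D l := by simp [inducedOp]

theorem inducedOp_last_cast (q : Fin n) :
    inducedOp ε d r Y D τ e (Fin.last n) q.castSucc = Y q := by simp [inducedOp]

theorem inducedOp_cast_last (i : Fin n) : inducedOp ε d r Y D τ e i.castSucc (Fin.last n) =
    ∑ l, τ (d i.castSucc - d l.castSucc) * D l * e i l -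
        (ε.toFun (d i.castSucc - d (Fin.last n)) (d (Fin.last n) - d i.castSucc) : F) •
          ((algebraMap F T r + ∑ l, Y l * D l) * D i) := by simp [inducedOp]

theorem inducedOp_cast_cast (i j : Fin n) : inducedOp ε d r Y D τ e i.castSucc j.castSucc =
    τ (d i.castSucc - d j.castSucc) * e i j -
        (ε.toFun (d i.castSucc - d j.castSucc) (d (Fin.last n) - d i.castSucc) : F) •
          (Y j * D i) := by simp [inducedOp]

/-- `∑ Y l * D l` is the Euler operator, counting the degree in the variables: the two bicharacter
factors met when `Y q` crosses `Y l` and `D l` are inverse to each other. -/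
theorem euler_mul (hYY : ∀ i j, Y i * Y j =
      (ε.toFun (d (Fin.last n) - d i.castSucc) (d (Fin.last n) - d j.castSucc) : F) • (Y j * Y i))
    (hDY : ∀ i j, D i * Y j =
      (ε.toFun (-(d (Fin.last n) - d i.castSucc)) (d (Fin.last n) - d j.castSucc) : F) •
        (Y j * D i) + if i = j then 1 else 0) (q : Fin n) :
    (∑ l, Y l * D l) * Y q = Y q * (∑ l, Y l * D l) + Y q := by
  have : ∀ l, Y l * D l * Y q = Y q * (Y l * D l) + if l = q then Y l else 0 := by
    intro l
    rw [mul_assoc, hDY, mul_add, mul_smul_comm, ← mul_assoc, hYY, smul_mul_assoc, smul_smul,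
      bichar_neg_left, Units.val_inv_eq_inv_val, inv_mul_cancel₀ (Units.ne_zero _), one_smul,
      mul_assoc]
    congr 1
    split_ifs <;> simp
  rw [Finset.sum_mul, Finset.sum_congr rfl fun l _ => this l, Finset.sum_add_distrib,
    Finset.mul_sum]
  simp

/-- These brackets with `Y q`, which represents `e_{n+1,q}`, are the ones checked by direct
computation on the whole module. The remaining brackets follow from them by the color Jacobi
identity and a check on the generating subspace. -/
theorem inducedOp_mul (hYY : ∀ i j, Y i * Y j =
      (ε.toFun (d (Fin.last n) - d i.castSucc) (d (Fin.last n) - d j.castSucc) : F) • (Y j * Y i))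
    (hDY : ∀ i j, D i * Y j =
      (ε.toFun (-(d (Fin.last n) - d i.castSucc)) (d (Fin.last n) - d j.castSucc) : F) •
        (Y j * D i) + if i = j then 1 else 0)
    (hτY : ∀ γ j, τ γ * Y j = (ε.toFun γ (d (Fin.last n) - d j.castSucc) : F) • (Y j * τ γ))
    (heY : ∀ i j k, e i j * Y k = Y k * e i j) (i j : Fin (n + 1)) (q : Fin n) :
    cbr (ε.toFun (d i - d j) (d (Fin.last n) - d q.castSucc) : F)
        (inducedOp ε d r Y D τ e i j) (Y q) =
      (if j = Fin.last n then inducedOp ε d r Y D τ e i q.castSucc else 0) -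
        (ε.toFun (d i - d j) (d (Fin.last n) - d q.castSucc) : F) •
          (if q.castSucc = i then inducedOp ε d r Y D τ e (Fin.last n) j else 0) := by
  have hN := euler_mul hYY hDY q
  set s := d (Fin.last n) with hs
  have hE : (algebraMap F T r + ∑ l, Y l * D l) * Y q =
      Y q * (algebraMap F T r + ∑ l, Y l * D l) + Y q := by
    rw [add_mul, hN, mul_add, Algebra.commutes, add_assoc]
  induction i using Fin.lastCases with
  | last =>
    induction j using Fin.lastCases with
    | last =>
      rw [inducedOp_last_last, inducedOp_last_cast, if_pos rfl, if_neg (Fin.castSucc_ne_last q),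
        sub_self, bichar_zero_left, smul_zero, cbr, hE, Units.val_one, one_smul]
      abel
    | cast j =>
      rw [inducedOp_last_cast, if_neg (Fin.castSucc_ne_last j), if_neg (Fin.castSucc_ne_last q),
        cbr, hYY, hs]
      simp
  | cast i =>
    induction j using Fin.lastCases with
    | last =>
      rw [if_pos rfl, inducedOp_last_last, inducedOp_cast_last, inducedOp_cast_cast, cbr, ← hs]
      set E := algebraMap F T r + ∑ l, Y l * D l
      have h1 : ∀ l, τ (d i.castSucc - d l.castSucc) * D l * e i l * Y q =
          (ε.toFun (d i.castSucc - s) (s - d q.castSucc) : F) •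
            (Y q * (τ (d i.castSucc - d l.castSucc) * D l * e i l)) +
          if l = q then τ (d i.castSucc - d l.castSucc) * e i l else 0 := by
        intro l
        rw [mul_assoc, heY, ← mul_assoc, mul_assoc (τ _), hDY, mul_add, mul_smul_comm,
          ← mul_assoc, hτY, smul_mul_assoc, smul_smul, ← Units.val_mul, ← ε.add_left,
          show -(s - d l.castSucc) + (d i.castSucc - d l.castSucc) = d i.castSucc - s by abel,
          add_mul, smul_mul_assoc]
        congr 1
        · simp only [mul_assoc]
        · split_ifs <;> simp
      have h2 : E * D i * Y q = (ε.toFun (d i.castSucc - s) (s - d q.castSucc) : F) •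
            (Y q * (E * D i)) + ((ε.toFun (d i.castSucc - s) (s - d q.castSucc) : F) •
            (Y q * D i) + if i = q then E else 0) := by
        rw [mul_assoc, hDY, mul_add, mul_smul_comm, ← mul_assoc, hE, add_mul, smul_add, mul_assoc,
          neg_sub, add_assoc]
        congr 2
        split_ifs <;> simp
      -- This identity matches the coefficient of `Y q * D i` coming from the Euler part with the
      -- coefficient in the formula for `e_{iq}`.
      have h3 : (ε.toFun (d i.castSucc - s) (s - d i.castSucc) : F) *
          ε.toFun (d i.castSucc - s) (s - d q.castSucc) =
          ε.toFun (d i.castSucc - d q.castSucc) (s - d i.castSucc) := by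
        rw [← Units.val_mul, show d i.castSucc - d q.castSucc =
          (d i.castSucc - s) + (s - d q.castSucc) by abel, ε.add_left,
          ← neg_sub (d i.castSucc) s, bichar_neg_right, bichar_neg_right,
          bichar_swap ε (d i.castSucc - s) (s - d q.castSucc), inv_inv]
      rw [sub_mul, Finset.sum_mul, Finset.sum_congr rfl fun l _ => h1 l, Finset.sum_add_distrib,
        smul_mul_assoc, h2, mul_sub, Finset.mul_sum, ← Finset.smul_sum, mul_smul_comm]
      simp only [smul_add, smul_sub, smul_smul]
      rw [mul_comm (ε.toFun (d i.castSucc - s) (s - d q.castSucc) : F), h3]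
      simp only [Finset.sum_ite_eq', Finset.mem_univ, if_true, Fin.castSucc_inj]
      by_cases hiq : i = q
      · subst hiq
        rw [if_pos rfl]
        abel
      · rw [if_neg hiq, if_neg (Ne.symm hiq)]
        simp only [smul_zero]
        abel
    | cast j =>
      rw [inducedOp_cast_cast, inducedOp_last_cast, if_neg (Fin.castSucc_ne_last j), zero_sub, cbr,
        sub_mul, mul_assoc, heY, ← mul_assoc, hτY, smul_mul_assoc, smul_mul_assoc,
        mul_assoc (Y j), hDY, mul_add, mul_smul_comm, ← mul_assoc, hYY, smul_mul_assoc, smul_smul,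
        ← Units.val_mul, ← ε.add_left,
        show -(s - d i.castSucc) + (s - d j.castSucc) = d i.castSucc - d j.castSucc by abel]
      simp only [Fin.castSucc_inj]
      by_cases hiq : i = q
      · subst hiq
        rw [if_pos rfl, if_pos rfl]
        simp only [mul_sub, smul_sub, smul_add, mul_smul_comm, mul_assoc, smul_smul, mul_one]
        abel
      · rw [if_neg hiq, if_neg (Ne.symm hiq)]
        simp only [mul_sub, smul_sub, mul_smul_comm, mul_assoc, smul_smul, mul_zero,
          smul_zero, add_zero]
        rw [mul_comm (ε.toFun (d i.castSucc - d j.castSucc) (s - d q.castSucc) : F)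
          (ε.toFun (d i.castSucc - d j.castSucc) (s - d i.castSucc) : F)]
        abel

end Step

/-! ### Twisted commutation of `p`-th powers. -/

section Twisted

variable {F : Type*} [Field F] {A : Type*} [Ring A] [Algebra F A] (p : ℕ) [Fact p.Prime]
  [CharP F p]

/-- The bracket with `a` is the operator `L_a - c R_a`, a difference of commuting operators, so its
`p`-th power is `L_a^p - c^p R_a^p`. This power kills `y` because already the cube does. -/
theorem pow_char_mul_of_cbr_cbr_cbr (hp : 3 ≤ p) (c : F) (a y : A)
    (h : cbr c a (cbr c a (cbr c a y)) = 0) : a ^ p * y = c ^ p • (y * a ^ p) := by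
  rcases subsingleton_or_nontrivial A with hA | hA
  · exact Subsingleton.elim _ _
  have : CharP (Module.End F A) p :=
    charP_of_injective_algebraMap (algebraMap F (Module.End F A)).injective p
  have hc : Commute (LinearMap.mulLeft F a) (c • LinearMap.mulRight F a) :=
    (LinearMap.commute_mulLeft_right (R := F) a a).smul_right c
  have h1 := sub_pow_char_of_commute p hc
  obtain ⟨k, rfl⟩ : ∃ k, p = k + 3 := ⟨p - 3, by omega⟩
  have h2 := congrArg (fun f : Module.End F A => f y) h1
  rw [pow_add] at h2
  have h3 : ((LinearMap.mulLeft F a - c • LinearMap.mulRight F a) ^ 3) y = 0 := by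
    simpa [pow_succ, cbr] using h
  simp only [Module.End.mul_apply, h3, map_zero, smul_pow, LinearMap.pow_mulLeft,
    LinearMap.pow_mulRight, LinearMap.sub_apply, LinearMap.smul_apply, LinearMap.mulLeft_apply,
    LinearMap.mulRight_apply] at h2
  exact sub_eq_zero.1 h2.symm

/-- Each term is a multiple of `x^i z x^{3-i}`, and one of the two exponents is at least `2`. -/
theorem cbr_cbr_cbr_of_sq_eq_zero {c : F} {x z : A} (hx : x * x = 0) :
    cbr c x (cbr c x (cbr c x z)) = 0 := by
  have h2 : ∀ t : A, x * (x * t) = 0 := fun t => by rw [← mul_assoc, hx, zero_mul]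
  simp only [cbr, mul_sub, sub_mul, mul_assoc, smul_mul_assoc, mul_smul_comm, hx, h2, smul_zero,
    mul_zero, sub_zero, zero_sub, neg_zero, sub_self, mul_neg, neg_mul]

/-- Moving `y` to the left translates `a` by `s`, and `a^p - a` is invariant under translation by an
element of the prime field. -/
theorem artinSchreier_mul {s : F} (hs : s ^ p = s) {a y : A} (h : a * y = y * (a + algebraMap F A s))
    (X : F) : (a ^ p - a - algebraMap F A X) * y = y * (a ^ p - a - algebraMap F A X) := by
  rcases subsingleton_or_nontrivial A with hA | hA
  · exact Subsingleton.elim _ _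
  have : CharP A p := charP_of_injective_algebraMap (algebraMap F A).injective p
  have h1 : ∀ n : ℕ, a ^ n * y = y * (a + algebraMap F A s) ^ n := by
    intro n
    induction n with
    | zero => simp
    | succ n ih => rw [pow_succ, mul_assoc, h, ← mul_assoc, ih, mul_assoc, ← pow_succ]
  rw [sub_mul, sub_mul, h1, add_pow_char_of_commute p (Algebra.commutes s a).symm, h, ← map_pow, hs,
    Algebra.commutes]
  simp only [mul_sub, mul_add]
  abel

end Twisted

/-! ### Extending bracket relations from a generating subspace. -/

section Lowering

variable {F : Type*} {Γ : Type*} [Field F] [AddCommGroup Γ] {T : Type*} [AddCommGroup T]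
  [Module F T] {n : ℕ} {ε : Bicharacter Γ F} {d : Fin (n + 1) → Γ}

/-- The grading of `gl(n+1)` by `-1, 0, 1` given by the last basis vector. -/
def lastLevel (d : Fin (n + 1) → Γ) (i : Fin (n + 1)) : Γ × ℤ :=
  (d i, if i = Fin.last n then -1 else 0)

/-- A linear map on `gl(n+1)` is a color representation if it respects brackets with the lowering
elements `e_{n+1,q}` everywhere, and all other brackets on a subspace which generates. -/
theorem isColorRep_of_lowering {L : Matrix (Fin (n + 1)) (Fin (n + 1)) F →ₗ[F] Module.End F T}
    (hlow : ∀ i j (q : Fin n), cbr (ε.toFun (d i - d j) (d (Fin.last n) - d q.castSucc) : F)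
        (L (Matrix.single i j 1)) (L (Matrix.single (Fin.last n) q.castSucc 1)) =
      L (cbr (ε.toFun (d i - d j) (d (Fin.last n) - d q.castSucc) : F) (Matrix.single i j 1)
        (Matrix.single (Fin.last n) q.castSucc 1)))
    (V : Set T)
    (hgen : ∀ (Z : Module.End F T) (c : Fin n → F),
      (∀ q, Z * L (Matrix.single (Fin.last n) q.castSucc 1) =
        c q • (L (Matrix.single (Fin.last n) q.castSucc 1) * Z)) →
      (∀ v ∈ V, Z v = 0) → Z = 0)
    (hbase : ∀ i j k l, ¬(i = Fin.last n ∧ j ≠ Fin.last n) → ¬(k = Fin.last n ∧ l ≠ Fin.last n) →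
      ∀ v ∈ V, cbr (ε.toFun (d i - d j) (d k - d l) : F) (L (Matrix.single i j 1))
        (L (Matrix.single k l 1)) v =
      L (cbr (ε.toFun (d i - d j) (d k - d l) : F) (Matrix.single i j 1)
        (Matrix.single k l 1)) v) : IsColorRep ε d L := by
  -- `R j k` says that brackets between levels `j` and `k` are respected. Only levels `-1`, `0`, `1`
  -- contain matrix units, and the lowering elements have level `-1`.
  let R : ℤ → ℤ → Prop := fun j k => ∀ α β x y, x ∈ glDegree F (lastLevel d) (α, j) →
    y ∈ glDegree F (lastLevel d) (β, k) →
    cbr (ε.toFun α β : F) (L x) (L y) = L (cbr (ε.toFun α β : F) x y)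
  have hR1 : ∀ k, R k (-1) := by
    intro k α β x y hx hy
    refine cbr_rep_of_single_right (fun a b hab => ?_) hy
    refine cbr_rep_of_single_left (fun i j hij => ?_) hx
    have h1 := congrArg Prod.fst hab
    have h2 := congrArg Prod.snd hab
    have h3 := congrArg Prod.fst hij
    simp only [lastLevel, Prod.snd_sub, Prod.fst_sub] at h1 h2 h3
    have ha : a = Fin.last n := by
      by_contra h
      rw [if_neg h] at h2
      split_ifs at h2 <;> omega
    subst ha
    rw [if_pos rfl] at h2
    induction b using Fin.lastCases with
    | last => simp at h2
    | cast q =>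
      rw [← h1, ← h3]
      exact hlow i j q
  have hsymm : ∀ j k, R j k → R k j := fun j k h α β x y hx hy => cbr_swap_rep (h β α y x hy hx)
  -- By the color Jacobi identity the defect `[L x, L y] - L [x, y]` skew-commutes with every
  -- lowering operator as soon as the brackets with one factor lowered by one level are respected.
  -- It then vanishes because it vanishes on `V`.
  have hstep : ∀ j k : ℤ, j ≠ -1 → k ≠ -1 → R j (k - 1) → R k (j - 1) → R j k := by
    intro j k hj hk h1 h2 α β x y hx hy
    refine cbr_rep_of_single_left (fun a b hab => ?_) hx
    refine cbr_rep_of_single_right (fun u v huv => ?_) hy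
    have hx' : Matrix.single a b (1 : F) ∈ glDegree F (lastLevel d) (α, j) :=
      single_mem_glDegree_of_eq hab 1
    have hy' : Matrix.single u v (1 : F) ∈ glDegree F (lastLevel d) (β, k) :=
      single_mem_glDegree_of_eq huv 1
    have a1 : d a - d b = α := congrArg Prod.fst hab
    have a2 := congrArg Prod.snd hab
    have u1 : d u - d v = β := congrArg Prod.fst huv
    have u2 := congrArg Prod.snd huv
    simp only [lastLevel, Prod.snd_sub] at a2 u2
    have hab' : ¬(a = Fin.last n ∧ b ≠ Fin.last n) := by
      rintro ⟨rfl, hb⟩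
      rw [if_pos rfl, if_neg hb] at a2
      omega
    have huv' : ¬(u = Fin.last n ∧ v ≠ Fin.last n) := by
      rintro ⟨rfl, hb⟩
      rw [if_pos rfl, if_neg hb] at u2
      omega
    set x := Matrix.single a b (1 : F)
    set y := Matrix.single u v (1 : F)
    refine sub_eq_zero.1 (hgen _
      (fun q => (ε.toFun (α + β) (d (Fin.last n) - d q.castSucc) : F)) (fun q => ?_)
      (fun w hw => ?_))
    · set t := d (Fin.last n) - d q.castSucc with ht
      set z := Matrix.single (Fin.last n) q.castSucc (1 : F)
      have hz : z ∈ glDegree F (lastLevel d) (t, -1) := by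
        refine single_mem_glDegree_of_eq ?_ 1
        simp [lastLevel, ht]
      have hJ : ∀ a b y : Module.End F T,
        cbr (ε.toFun (α + β) t : F) (cbr (ε.toFun α β : F) a b) y =
          cbr (ε.toFun α (β + t) : F) a (cbr (ε.toFun β t : F) b y) -
            (ε.toFun α β : F) • cbr (ε.toFun β (α + t) : F) b (cbr (ε.toFun α t : F) a y) := by
        intro a b y
        rw [ε.add_left, ε.add_right, ε.add_right, Units.val_mul, Units.val_mul, Units.val_mul]
        exact cbr_cbr a b y (bichar_mul_swap ε α β)
      have hJ' : cbr (ε.toFun (α + β) t : F) (cbr (ε.toFun α β : F) x y) z =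
          cbr (ε.toFun α (β + t) : F) x (cbr (ε.toFun β t : F) y z) -
            (ε.toFun α β : F) • cbr (ε.toFun β (α + t) : F) y (cbr (ε.toFun α t : F) x z) := by
        rw [ε.add_left, ε.add_right, ε.add_right, Units.val_mul, Units.val_mul, Units.val_mul]
        exact cbr_cbr x y z (bichar_mul_swap ε α β)
      have hz1 := hR1 j α t x z hx' hz
      have hz2 := hR1 k β t y z hy' hz
      have hz3 := hR1 (j + k) (α + β) t _ z (cbr_mem_glDegree (ε.toFun α β : F) hx' hy') hz
      have hz4 := h1 α (β + t) x _ hx' (cbr_mem_glDegree (ε.toFun β t : F) hy' hz)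
      have hz5 := h2 β (α + t) y _ hy' (cbr_mem_glDegree (ε.toFun α t : F) hx' hz)
      have key : cbr (ε.toFun (α + β) t : F) (cbr (ε.toFun α β : F) (L x) (L y)) (L z) =
          cbr (ε.toFun (α + β) t : F) (L (cbr (ε.toFun α β : F) x y)) (L z) := by
        rw [hJ, hz1, hz2, hz3, hz4, hz5, hJ', map_sub, map_smul]
      simp only [cbr] at key ⊢
      rw [sub_mul, mul_sub, smul_sub]
      exact sub_eq_sub_iff_sub_eq_sub.1 key
    · rw [LinearMap.sub_apply, sub_eq_zero, ← a1, ← u1]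
      exact hbase a b u v hab' huv' w hw
  have h00 : R 0 0 := hstep 0 0 (by decide) (by decide) (hR1 0) (hR1 0)
  have h10 : R 1 0 := hstep 1 0 (by decide) (by decide) (hR1 1) h00
  have h11 : R 1 1 := hstep 1 1 (by decide) (by decide) h10 h10
  refine isColorRep_of_single fun i j k l => ?_
  have hall : ∀ a b : ℤ, (a = -1 ∨ a = 0 ∨ a = 1) → (b = -1 ∨ b = 0 ∨ b = 1) → R a b := by
    rintro a b (rfl | rfl | rfl) (rfl | rfl | rfl)
    exacts [hR1 _, hsymm _ _ (hR1 _), hsymm _ _ (hR1 _), hR1 _, h00, hsymm _ _ h10, hR1 _, h10,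
      h11]
  have hlev : ∀ i j : Fin (n + 1), ((if i = Fin.last n then -1 else 0 : ℤ) -
      (if j = Fin.last n then -1 else 0) = -1) ∨ ((if i = Fin.last n then -1 else 0 : ℤ) -
      (if j = Fin.last n then -1 else 0) = 0) ∨ ((if i = Fin.last n then -1 else 0 : ℤ) -
      (if j = Fin.last n then -1 else 0) = 1) := by
    intro i j
    split_ifs <;> simp
  exact hall _ _ (hlev i j) (hlev k l) _ _ _ _ (single_mem_glDegree i j 1)
    (single_mem_glDegree k l 1)

end Lowering

/-! ### Highest weight representations built by induction on the rank. -/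

section Model

/-- The linear map on matrices with given values on matrix units. -/
def matrixLift {F A : Type*} [Field F] [AddCommGroup A] [Module F A] {m : ℕ}
    (E : Fin m → Fin m → A) : Matrix (Fin m) (Fin m) F →ₗ[F] A where
  toFun x := ∑ i, ∑ j, x i j • E i j
  map_add' x y := by simp [add_smul, Finset.sum_add_distrib]
  map_smul' c x := by simp [mul_smul, Finset.smul_sum]

theorem matrixLift_single {F A : Type*} [Field F] [AddCommGroup A] [Module F A] {m : ℕ}
    (E : Fin m → Fin m → A) (i j : Fin m) :
    matrixLift E (Matrix.single i j (1 : F)) = E i j := by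
  change ∑ a, ∑ b, (Matrix.single i j (1 : F)) a b • E a b = _
  rw [Finset.sum_eq_single i, Finset.sum_eq_single j]
  · simp
  · intro b _ hb
    simp [hb.symm]
  · simp
  · intro a _ ha
    refine Finset.sum_eq_zero fun b _ => ?_
    simp [ha.symm]
  · simp

variable {F : Type u} {Γ : Type*} [Field F] [AddCommGroup Γ] {n : ℕ}

/-- A representation of `gl(n,Γ)` with the `p`-character determined by `X`, generated by a highest
weight vector of weight `r`. -/
structure HighestWeightRep (p : ℕ) (ε : Bicharacter Γ F) (d : Fin n → Γ) (r X : Fin n → F)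
    (W : Type*) [AddCommGroup W] [Module F W] where
  L : Matrix (Fin n) (Fin n) F →ₗ[F] Module.End F W
  w : W
  rep : IsColorRep ε d L
  pow_off : ∀ i j, i ≠ j → ε.toFun (d i - d j) (d i - d j) = 1 → L (Matrix.single i j 1) ^ p = 0
  pow_diag : ∀ i, L (Matrix.single i i 1) ^ p - L (Matrix.single i i 1) = algebraMap F _ (X i)
  upper : ∀ i j, i < j → L (Matrix.single i j 1) w = 0
  diag : ∀ i, L (Matrix.single i i 1) w = r i • w
  generated : ∀ P : Submodule F W, w ∈ P →
    (∀ i j, ∀ s ∈ P, L (Matrix.single i j 1) s ∈ P) → P = ⊤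

/-- Induction from `gl(n) ⊕ gl(1)` to `gl(n+1)`. -/
def HighestWeightRep.induce {p : ℕ} [Fact p.Prime] [CharP F p] (hp : 3 ≤ p)
    {ε : Bicharacter Γ F} {d : Fin (n + 1) → Γ} {r X : Fin (n + 1) → F}
    {M : Type*} [AddCommGroup M] [Module F M]
    (V : HighestWeightRep p ε (fun i => d i.castSucc) (fun i => r i.castSucc)
      (fun i => X i.castSucc) M)
    {S : Type*} [AddCommGroup S] [Module F S]
    (C : ColorWeyl p ε (fun q : Fin n => d (Fin.last n) - d q.castSucc) S)
    (hr : r (Fin.last n) ^ p - r (Fin.last n) = X (Fin.last n)) :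
    HighestWeightRep p ε d r X (S ⊗[F] M) := by
  let Y : Fin n → Module.End F (S ⊗[F] M) := fun q => LinearMap.rTensor M (C.Y q)
  let D : Fin n → Module.End F (S ⊗[F] M) := fun q => LinearMap.rTensor M (C.D q)
  let τ : Γ → Module.End F (S ⊗[F] M) := fun γ => LinearMap.rTensor M (C.τ γ)
  let e : Fin n → Fin n → Module.End F (S ⊗[F] M) := fun i j =>
    LinearMap.lTensor S (V.L (Matrix.single i j 1))
  let s : M →ₗ[F] S ⊗[F] M := TensorProduct.mk F S M C.s₀
  have hYY : ∀ i j, Y i * Y j = (ε.toFun (d (Fin.last n) - d i.castSucc)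
      (d (Fin.last n) - d j.castSucc) : F) • (Y j * Y i) := by
    intro i j
    simp only [Y]
    rw [← LinearMap.rTensor_mul, C.Y_Y, LinearMap.rTensor_smul, LinearMap.rTensor_mul]
  have hDY : ∀ i j, D i * Y j = (ε.toFun (-(d (Fin.last n) - d i.castSucc))
      (d (Fin.last n) - d j.castSucc) : F) • (Y j * D i) + if i = j then 1 else 0 := by
    intro i j
    simp only [Y, D]
    rw [← LinearMap.rTensor_mul, C.D_Y, LinearMap.rTensor_add, LinearMap.rTensor_smul,
      LinearMap.rTensor_mul]
    congr 1
    split_ifs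
    · exact LinearMap.rTensor_id M S
    · exact LinearMap.rTensor_zero M
  have hτY : ∀ γ j, τ γ * Y j =
      (ε.toFun γ (d (Fin.last n) - d j.castSucc) : F) • (Y j * τ γ) := by
    intro γ j
    simp only [Y, τ]
    rw [← LinearMap.rTensor_mul, C.τ_Y, LinearMap.rTensor_smul, LinearMap.rTensor_mul]
  have heY : ∀ i j k, e i j * Y k = Y k * e i j := by
    intro i j k
    simp only [Y, e, Module.End.mul_eq_comp]
    rw [LinearMap.lTensor_comp_rTensor, LinearMap.rTensor_comp_lTensor]
  have hDs : ∀ i m, D i (s m) = 0 := by intro i m; simp [D, s, C.D_s₀]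
  have hτs : ∀ γ m, τ γ (s m) = s m := by intro i m; simp [τ, s, C.τ_s₀]
  have hes : ∀ i j m, e i j (s m) = s (V.L (Matrix.single i j 1) m) := by
    intro i j m; simp [e, s]
  let E := inducedOp ε d (r (Fin.last n)) Y D τ e
  -- On `s₀ ⊗ M` derivations vanish and twists are trivial, so every operator other than the
  -- lowering ones acts there by the same formula with `Y = D = 0` and `τ = 1`. This is the inflated
  -- action of `gl(n) ⊕ gl(1)`, with `e_{i,n+1}` acting by zero.
  let E₀ : Fin (n + 1) → Fin (n + 1) → Module.End F M :=
    inducedOp ε d (r (Fin.last n)) 0 0 1 (fun i j => V.L (Matrix.single i j 1))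
  have hbase : ∀ i j, ¬(i = Fin.last n ∧ j ≠ Fin.last n) → ∀ m, E i j (s m) = s (E₀ i j m) := by
    intro i j hij m
    simp only [E, E₀]
    induction i using Fin.lastCases with
    | last =>
      induction j using Fin.lastCases with
      | last =>
        rw [inducedOp_last_last, inducedOp_last_last]
        simp [hDs]
      | cast j => exact absurd ⟨rfl, Fin.castSucc_ne_last j⟩ hij
    | cast i =>
      induction j using Fin.lastCases with
      | last =>
        rw [inducedOp_cast_last, inducedOp_cast_last]
        simp [hDs, hes]
      | cast j =>
        rw [inducedOp_cast_cast, inducedOp_cast_cast]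
        simp [hDs, hes, hτs]
  let L : Matrix (Fin (n + 1)) (Fin (n + 1)) F →ₗ[F] Module.End F (S ⊗[F] M) := matrixLift E
  have hL : ∀ i j, L (Matrix.single i j 1) = E i j := matrixLift_single E
  have hLY : ∀ q : Fin n, L (Matrix.single (Fin.last n) q.castSucc 1) = Y q := fun q => by
    rw [hL]; exact inducedOp_last_cast q
  have hlow : ∀ i j (q : Fin n), cbr (ε.toFun (d i - d j) (d (Fin.last n) - d q.castSucc) : F)
        (L (Matrix.single i j 1)) (L (Matrix.single (Fin.last n) q.castSucc 1)) =
      L (cbr (ε.toFun (d i - d j) (d (Fin.last n) - d q.castSucc) : F) (Matrix.single i j 1)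
        (Matrix.single (Fin.last n) q.castSucc 1)) := by
    intro i j q
    rw [cbr_single, hLY, hL, map_sub, map_smul]
    refine (inducedOp_mul hYY hDY hτY heY i j q).trans ?_
    split_ifs <;> simp [hL, E]
  have hgenP : ∀ P : Submodule F (S ⊗[F] M), (∀ m, s m ∈ P) →
      (∀ q, ∀ t ∈ P, Y q t ∈ P) → P = ⊤ := by
    intro P h1 h2
    have h3 : ∀ m t, t ⊗ₜ[F] m ∈ P := by
      intro m
      have h4 : P.comap ((TensorProduct.mk F S M).flip m) = ⊤ :=
        C.generated _ (h1 m) fun q t ht => h2 q _ ht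
      intro t
      have : t ∈ P.comap ((TensorProduct.mk F S M).flip m) := by rw [h4]; trivial
      exact this
    refine eq_top_iff.2 fun t _ => ?_
    induction t using TensorProduct.induction_on with
    | zero => exact P.zero_mem
    | tmul x y => exact h3 y x
    | add x y hx hy => exact P.add_mem (hx trivial) (hy trivial)
  -- The principle behind all remaining operator identities: skew-commuting with the variables makes
  -- the kernel stable under them, and `s₀ ⊗ M` generates.
  have hgen : ∀ (Z : Module.End F (S ⊗[F] M)) (c : Fin n → F),
      (∀ q, Z * Y q = c q • (Y q * Z)) → (∀ m, Z (s m) = 0) → Z = 0 := by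
    intro Z c h1 h2
    refine LinearMap.ker_eq_top.1 (hgenP _ h2 fun q t ht => ?_)
    have := congrArg (fun f : Module.End F (S ⊗[F] M) => f t) (h1 q)
    simp only [Module.End.mul_apply, LinearMap.smul_apply] at this
    rw [LinearMap.mem_ker] at ht ⊢
    rw [this, ht, map_zero, smul_zero]
  have hE₀ : ∀ i j k l, ¬(i = Fin.last n ∧ j ≠ Fin.last n) → ¬(k = Fin.last n ∧ l ≠ Fin.last n) →
      cbr (ε.toFun (d i - d j) (d k - d l) : F) (E₀ i j) (E₀ k l) =
        (if j = k then E₀ i l else 0) -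
        (ε.toFun (d i - d j) (d k - d l) : F) • (if l = i then E₀ k j else 0) := by
    have h1 : E₀ (Fin.last n) (Fin.last n) = algebraMap F _ (r (Fin.last n)) := by
      simp only [E₀]; rw [inducedOp_last_last]; simp
    have h2 : ∀ i : Fin n, E₀ i.castSucc (Fin.last n) = 0 := by
      intro i; simp only [E₀]; rw [inducedOp_cast_last]; simp
    have h3 : ∀ i j : Fin n, E₀ i.castSucc j.castSucc = V.L (Matrix.single i j 1) := by
      intro i j; simp only [E₀]; rw [inducedOp_cast_cast]; simp
    have h4 : ∀ (x : Module.End F M), cbr (1 : F) (algebraMap F _ (r (Fin.last n))) x = 0 := by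
      intro x; simp [cbr, Algebra.commutes]
    have h5 : ∀ (x : Module.End F M), cbr (1 : F) x (algebraMap F _ (r (Fin.last n))) = 0 := by
      intro x; simp [cbr, Algebra.commutes]
    intro i j k l hij hkl
    induction i using Fin.lastCases with
    | last =>
      induction j using Fin.lastCases with
      | last =>
        rw [h1, sub_self, bichar_zero_left, Units.val_one, h4]
        induction k using Fin.lastCases with
        | last =>
          induction l using Fin.lastCases with
          | last => simp
          | cast l => exact absurd ⟨rfl, Fin.castSucc_ne_last l⟩ hkl
        | cast k =>
          induction l using Fin.lastCases with
          | last => simp [h2, (Fin.castSucc_ne_last k).symm]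
          | cast l => simp [(Fin.castSucc_ne_last k).symm]
      | cast j => exact absurd ⟨rfl, Fin.castSucc_ne_last j⟩ hij
    | cast i =>
      induction k using Fin.lastCases with
      | last =>
        induction l using Fin.lastCases with
        | last =>
          rw [h1, sub_self, bichar_zero_right, Units.val_one, h5]
          induction j using Fin.lastCases with
          | last => simp [h2, (Fin.castSucc_ne_last i).symm]
          | cast j => simp [(Fin.castSucc_ne_last i).symm]
        | cast l => exact absurd ⟨rfl, Fin.castSucc_ne_last l⟩ hkl
      | cast k =>
        induction j using Fin.lastCases with
        | last =>
          simp [h2, (Fin.castSucc_ne_last k).symm]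
        | cast j =>
          induction l using Fin.lastCases with
          | last => simp [h2, (Fin.castSucc_ne_last i).symm]
          | cast l =>
            rw [h3, h3, V.rep _ _ _ _ (single_mem_glDegree i j 1) (single_mem_glDegree k l 1),
              cbr_single, map_sub, map_smul]
            simp only [Fin.castSucc_inj, h3]
            split_ifs <;> simp
  have hpow : ∀ i j, ¬(i = Fin.last n ∧ j ≠ Fin.last n) → ∀ (k : ℕ) (m : M),
      (E i j ^ k) (s m) = s ((E₀ i j ^ k) m) := by
    intro i j hij k m
    induction k with
    | zero => simp
    | succ k ih => rw [pow_succ', Module.End.mul_apply, ih, hbase i j hij, pow_succ',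
        Module.End.mul_apply]
  have hrep : IsColorRep ε d L := by
    refine isColorRep_of_lowering hlow (Set.range s) (fun Z c h1 h2 => ?_) ?_
    · refine hgen Z c (fun q => ?_) fun m => h2 _ ⟨m, rfl⟩
      rw [← hLY]
      exact h1 q
    · rintro i j k l hij hkl _ ⟨m, rfl⟩
      have hil : ¬ (i = Fin.last n ∧ l ≠ Fin.last n ∧ j = k) := by
        rintro ⟨h1, h2, rfl⟩
        exact hij ⟨h1, fun h => hkl ⟨h, h2⟩⟩
      have hkj : ¬ (k = Fin.last n ∧ j ≠ Fin.last n ∧ l = i) := by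
        rintro ⟨h1, h2, rfl⟩
        exact hkl ⟨h1, fun h => hij ⟨h, h2⟩⟩
      rw [cbr_single, hL, hL, map_sub, map_smul]
      have h1 := congrArg (fun f : Module.End F M => s (f m)) (hE₀ i j k l hij hkl)
      simp only [cbr, LinearMap.sub_apply, LinearMap.smul_apply, Module.End.mul_apply, map_sub,
        map_smul] at h1 ⊢
      rw [hbase k l hkl, hbase i j hij, hbase i j hij, hbase k l hkl, h1]
      congr 1
      · split_ifs with h
        · rw [hL, hbase _ _ fun h' => hil ⟨h'.1, h'.2, h⟩]
        · simp
      · congr 1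
        split_ifs with h
        · rw [hL, hbase _ _ fun h' => hkj ⟨h'.1, h'.2, h⟩]
        · simp
  refine
    { L := L, w := s V.w, rep := hrep, pow_off := ?_, pow_diag := ?_, upper := ?_, diag := ?_,
      generated := ?_ }
  · intro i j hij hd
    by_cases hl : i = Fin.last n ∧ j ≠ Fin.last n
    · obtain ⟨rfl, hj⟩ := hl
      induction j using Fin.lastCases with
      | last => exact absurd rfl hj
      | cast q =>
        rw [hLY]
        simp only [Y]
        rw [LinearMap.rTensor_pow, C.Y_pow q hd, LinearMap.rTensor_zero]
    · have hx : Matrix.single i j (1 : F) * Matrix.single i j 1 = 0 := by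
        simp [Ne.symm hij]
      -- Since `e_{ij}^2 = 0` as a matrix, the triple bracket of `e_{ij}` with any lowering element
      -- is zero, so its `p`-th power skew-commutes with the variables.
      refine hgen _ (fun q => (ε.toFun (d i - d j) (d (Fin.last n) - d q.castSucc) : F) ^ p)
        (fun q => ?_) fun m => ?_
      · rw [← hLY]
        refine pow_char_mul_of_cbr_cbr_cbr p hp _ _ _ ?_
        set c := ε.toFun (d i - d j) (d (Fin.last n) - d q.castSucc) with hc
        set z := Matrix.single (Fin.last n) q.castSucc (1 : F)
        have hz : z ∈ glDegree F d (d (Fin.last n) - d q.castSucc) := single_mem_glDegree _ _ _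
        have hxd : Matrix.single i j (1 : F) ∈ glDegree F d (d i - d j) := single_mem_glDegree _ _ _
        have h1 := hrep _ _ _ _ hxd hz
        have hz' := cbr_mem_glDegree (c : F) hxd hz
        have h2 := hrep _ _ _ _ hxd hz'
        have hz'' := cbr_mem_glDegree (c : F) hxd hz'
        have h3 := hrep _ _ _ _ hxd hz''
        rw [ε.add_right, hd, one_mul] at h2
        rw [ε.add_right, ε.add_right, hd, one_mul, one_mul] at h3
        rw [← hc] at h1 h2 h3
        rw [h1, h2, h3, cbr_cbr_cbr_of_sq_eq_zero hx, map_zero]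
      · rw [hL, hpow i j hl]
        have : E₀ i j ^ p = 0 := by
          simp only [E₀]
          induction i using Fin.lastCases with
          | last => exact absurd ⟨rfl, hij.symm⟩ hl
          | cast i =>
            induction j using Fin.lastCases with
            | last =>
              rw [inducedOp_cast_last]
              simp only [Pi.zero_apply, zero_mul, mul_zero, smul_zero, sub_zero,
                Finset.sum_const_zero]
              rw [zero_pow (by omega)]
            | cast j =>
              rw [inducedOp_cast_cast]
              simpa using V.pow_off i j (by simpa using hij) hd
        rw [this]
        simp
  · intro i
    rw [← sub_eq_zero]
    refine hgen _ (fun q => 1) (fun q => ?_) fun m => ?_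
    · obtain ⟨c, hc, h⟩ : ∃ c : F, c ^ p = c ∧ cbr (1 : F) (E i i) (Y q) = c • Y q := by
        have h1 := inducedOp_mul (r := r (Fin.last n)) hYY hDY hτY heY i i q
        rw [sub_self, bichar_zero_left, Units.val_one] at h1
        have hp0 : p ≠ 0 := by omega
        by_cases hi : i = Fin.last n
        · refine ⟨1, one_pow _, h1.trans ?_⟩
          subst hi
          rw [if_pos rfl, inducedOp_last_cast, if_neg (Fin.castSucc_ne_last q)]
          simp
        · by_cases hq : q.castSucc = i
          · refine ⟨-1, ?_, h1.trans ?_⟩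
            · have h2 : Odd p := (Fact.out : p.Prime).odd_of_ne_two (by omega)
              rw [h2.neg_pow, one_pow]
            · subst hq
              rw [if_neg hi, if_pos rfl, inducedOp_last_cast, zero_sub]
              exact (neg_smul (1 : F) (Y q)).symm
          · refine ⟨0, zero_pow hp0, h1.trans ?_⟩
            rw [if_neg hi, if_neg hq]
            simp
      rw [hL, one_smul]
      refine artinSchreier_mul p hc ?_ _
      rw [mul_add, ← Algebra.commutes, ← Algebra.smul_def, ← h, cbr, one_smul]
      abel
    · have hl : ¬(i = Fin.last n ∧ i ≠ Fin.last n) := fun h => h.2 h.1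
      have h2 : E₀ i i ^ p - E₀ i i = algebraMap F _ (X i) := by
        simp only [E₀]
        induction i using Fin.lastCases with
        | last =>
          rw [inducedOp_last_last, ← hr]
          simp
        | cast i =>
          rw [inducedOp_cast_cast]
          simpa using V.pow_diag i
      rw [hL, LinearMap.sub_apply, LinearMap.sub_apply, hpow i i hl, hbase i i hl, ← map_sub,
        ← LinearMap.sub_apply, h2]
      simp
  · intro i j hij
    have hl : ¬(i = Fin.last n ∧ j ≠ Fin.last n) := by
      rintro ⟨rfl, -⟩
      exact absurd hij (not_lt.2 (Fin.le_last j))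
    rw [hL, hbase i j hl]
    simp only [E₀]
    induction i using Fin.lastCases with
    | last => exact absurd hij (not_lt.2 (Fin.le_last j))
    | cast i =>
      induction j using Fin.lastCases with
      | last =>
        rw [inducedOp_cast_last]
        simp
      | cast j =>
        rw [inducedOp_cast_cast]
        simp [V.upper i j (by simpa using hij)]
  · intro i
    rw [hL, hbase i i fun h => h.2 h.1, ← map_smul]
    simp only [E₀]
    induction i using Fin.lastCases with
    | last =>
      rw [inducedOp_last_last]
      simp
    | cast i =>
      rw [inducedOp_cast_cast]
      simp [V.diag i]
  · intro P h1 h2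
    refine hgenP P (fun m => ?_) fun q t ht => ?_
    · have h3 : P.comap s = ⊤ := by
        refine V.generated _ h1 fun i j m hm => ?_
        have h4 := h2 i.castSucc j.castSucc _ hm
        rw [hL, hbase _ _ fun h => Fin.castSucc_ne_last i h.1] at h4
        simp only [E₀] at h4
        rw [inducedOp_cast_cast] at h4
        simpa using h4
      have : m ∈ P.comap s := by rw [h3]; trivial
      exact this
    · rw [← hLY]
      exact h2 _ _ t ht

/-- The product of the truncation exponents of the positive roots. -/
def truncProd (p : ℕ) (ε : Bicharacter Γ F) (d : Fin n → Γ) : ℕ :=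
  ∏ j, ∏ i, if i < j then trunc p ε (d i - d j) else 1

/-- Its dimension is the product of all truncation exponents of positive roots. As a quotient of the
baby Verma module, it supplies the lower bound for the dimension of the latter. -/
theorem exists_highestWeightRep (p : ℕ) [Fact p.Prime] [CharP F p] (hp : 3 ≤ p)
    (ε : Bicharacter Γ F) (n : ℕ) (d : Fin n → Γ) (r X : Fin n → F)
    (hr : ∀ i, r i ^ p - r i = X i) :
    ∃ (W : Type u) (_ : AddCommGroup W) (_ : Module F W) (_ : HighestWeightRep p ε d r X W),
      FiniteDimensional F W ∧ Module.finrank F W = truncProd p ε d := by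
  induction n with
  | zero =>
    refine ⟨F, inferInstance, inferInstance,
      { L := 0, w := 1, rep := ?_, pow_off := fun i => i.elim0, pow_diag := fun i => i.elim0,
        upper := fun i => i.elim0, diag := fun i => i.elim0, generated := ?_ },
      inferInstance, by simp [truncProd]⟩
    · intro α β x y _ _
      simp
    · intro P hP _
      exact (Ideal.eq_top_iff_one P).2 hP
  | succ n ih =>
    obtain ⟨M, _, _, V, hM, hMr⟩ := ih (fun i => d i.castSucc) (fun i => r i.castSucc)
      (fun i => X i.castSucc) fun i => hr _
    obtain ⟨S, _, _, C, hS, hSr⟩ := exists_colorWeyl p ε n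
      (fun q => d (Fin.last n) - d q.castSucc)
    refine ⟨S ⊗[F] M, inferInstance, inferInstance, V.induce hp C (hr _), inferInstance, ?_⟩
    rw [Module.finrank_tensorProduct, hMr, hSr, truncProd, truncProd, Fin.prod_univ_castSucc,
      mul_comm]
    congr 1
    · refine Finset.prod_congr rfl fun j _ => ?_
      rw [Fin.prod_univ_castSucc, if_neg (not_lt.2 (Fin.le_last _)), mul_one]
      simp
    · rw [Fin.prod_univ_castSucc, if_neg (lt_irrefl _), mul_one]
      refine Finset.prod_congr rfl fun i _ => ?_
      rw [if_pos (Fin.castSucc_lt_last i), trunc, trunc, ← neg_sub, bichar_neg_neg]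

end Model

/-! ### Ordered monomials in a nilpotent skew-commuting family. -/

section Ore

variable {F : Type*} [Field F] {A : Type*} [Ring A] [Algebra F A]

/-- Elements `x_0, …, x_{N-1}` of degrees `h`, nilpotent of exponents `b`, where each `x_k`
skew-commutes with the earlier ones up to a combination of earlier ones of the right degree. -/
structure IsOreFamily (F : Type*) [Field F] {A : Type*} [Ring A] [Algebra F A] {N : ℕ}
    (x : Fin N → A) (h b : Fin N → ℕ) : Prop where
  comm : ∀ j k, j < k → ∃ c : F, c ≠ 0 ∧
    x j * x k - c • (x k * x j) ∈ Submodule.span F {t | ∃ l < k, h l = h j + h k ∧ t = x l}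
  pow : ∀ k, x k ^ b k = 0

theorem IsOreFamily.castSucc {N : ℕ} {x : Fin (N + 1) → A} {h b : Fin (N + 1) → ℕ}
    (H : IsOreFamily F x h b) :
    IsOreFamily F (fun i => x (Fin.castSucc i)) (fun i => h (Fin.castSucc i))
      (fun i => b (Fin.castSucc i)) where
  comm j k hjk := by
    obtain ⟨c, hc, h1⟩ := H.comm j.castSucc k.castSucc (by simpa using hjk)
    refine ⟨c, hc, ?_⟩
    convert h1 using 3
    ext t
    constructor
    · rintro ⟨l, hl, h2, rfl⟩
      exact ⟨l.castSucc, by simpa using hl, h2, rfl⟩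
    · rintro ⟨l, hl, h2, rfl⟩
      induction l using Fin.lastCases with
      | last => exact absurd hl (not_lt.2 (Fin.le_last _))
      | cast l => exact ⟨l, by simpa using hl, h2, rfl⟩
  pow k := H.pow _

/-- The span of the ordered monomials of degree `D`. -/
def orderedSpan (F : Type*) [Field F] {A : Type*} [Ring A] [Algebra F A] {N : ℕ} (x : Fin N → A)
    (h b : Fin N → ℕ) (D : ℕ) : Submodule F A :=
  Submodule.span F {t | ∃ a : Fin N → ℕ, (∀ i, a i < b i) ∧ ∑ i, a i * h i = D ∧
    t = (List.ofFn fun i => x i ^ a i).prod}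

theorem mul_pow_last_mem {N : ℕ} {x : Fin (N + 1) → A} {h b : Fin (N + 1) → ℕ}
    (H : IsOreFamily F x h b) {D : ℕ} {m : A}
    (hm : m ∈ orderedSpan F (fun i => x (Fin.castSucc i)) (fun i => h (Fin.castSucc i))
      (fun i => b (Fin.castSucc i)) D) (a : ℕ) :
    m * x (Fin.last N) ^ a ∈ orderedSpan F x h b (D + a * h (Fin.last N)) := by
  by_cases ha : a < b (Fin.last N)
  · induction hm using Submodule.span_induction with
    | mem t ht =>
      obtain ⟨u, hu, hD, rfl⟩ := ht
      refine Submodule.subset_span ⟨Fin.snoc u a, ?_, ?_, ?_⟩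
      · intro i
        induction i using Fin.lastCases with
        | last => simpa using ha
        | cast i => simpa using hu i
      · rw [Fin.sum_univ_castSucc]
        simp [hD]
      · rw [List.ofFn_succ', List.concat_eq_append, List.prod_append]
        simp
    | zero => simp
    | add x y _ _ hx hy => rw [add_mul]; exact Submodule.add_mem _ hx hy
    | smul c x _ hx => rw [smul_mul_assoc]; exact Submodule.smul_mem _ _ hx
  · rw [← Nat.sub_add_cancel (not_lt.1 ha), pow_add, H.pow, mul_zero, mul_zero]
    exact Submodule.zero_mem _

theorem orderedSpan_mul_last {N : ℕ} {x : Fin (N + 1) → A} {h b : Fin (N + 1) → ℕ}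
    (H : IsOreFamily F x h b) {D : ℕ} {m : A} (hm : m ∈ orderedSpan F x h b D) :
    m * x (Fin.last N) ∈ orderedSpan F x h b (D + h (Fin.last N)) := by
  induction hm using Submodule.span_induction with
  | mem t ht =>
    obtain ⟨u, hu, hD, rfl⟩ := ht
    rw [List.ofFn_succ', List.concat_eq_append, List.prod_append, List.prod_singleton, mul_assoc,
      ← pow_succ]
    have h1 := mul_pow_last_mem H (D := ∑ i : Fin N, u i.castSucc * h i.castSucc)
      (m := (List.ofFn fun i : Fin N => x i.castSucc ^ u i.castSucc).prod)
      (Submodule.subset_span ⟨fun i => u i.castSucc, fun i => hu _, rfl, rfl⟩)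
      (u (Fin.last N) + 1)
    convert h1 using 2
    rw [← hD, Fin.sum_univ_castSucc]
    ring
  | zero => simp
  | add x y _ _ hx hy => rw [add_mul]; exact Submodule.add_mem _ hx hy
  | smul c x _ hx => rw [smul_mul_assoc]; exact Submodule.smul_mem _ _ hx

/-- Straightening. To insert an earlier generator, move it left through the power of the last one;
each crossing costs a nonzero scalar and a combination of earlier generators of the same total
degree, with one factor of the last generator fewer. -/
theorem orderedSpan_mul {N : ℕ} {x : Fin N → A} {h b : Fin N → ℕ}
    (H : IsOreFamily F x h b) {D : ℕ} {m : A} (hm : m ∈ orderedSpan F x h b D) (j : Fin N) :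
    m * x j ∈ orderedSpan F x h b (D + h j) := by
  induction N generalizing D m with
  | zero => exact j.elim0
  | succ N ih =>
    induction j using Fin.lastCases with
    | last => exact orderedSpan_mul_last H hm
    | cast j =>
      have key : ∀ (a : ℕ) (D : ℕ) (m : A), m ∈ orderedSpan F (fun i => x (Fin.castSucc i))
          (fun i => h (Fin.castSucc i)) (fun i => b (Fin.castSucc i)) D → ∀ j : Fin N,
          m * x (Fin.last N) ^ a * x j.castSucc ∈
            orderedSpan F x h b (D + a * h (Fin.last N) + h j.castSucc) := by
        intro a
        induction a with
        | zero =>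
          intro D m hm j
          have := mul_pow_last_mem H (ih H.castSucc hm j) 0
          simpa using this
        | succ a iha =>
          intro D m hm j
          obtain ⟨c, hc, h1⟩ := H.comm j.castSucc (Fin.last N) (Fin.castSucc_lt_last j)
          set s := x j.castSucc * x (Fin.last N) - c • (x (Fin.last N) * x j.castSucc) with hs
          have h2 : x (Fin.last N) * x j.castSucc =
              c⁻¹ • (x j.castSucc * x (Fin.last N)) - c⁻¹ • s := by
            rw [hs, smul_sub, smul_smul, inv_mul_cancel₀ hc, one_smul]
            abel
          have h3 : ∀ t ∈ Submodule.span F {t | ∃ l < Fin.last N,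
              h l = h j.castSucc + h (Fin.last N) ∧ t = x l}, m * x (Fin.last N) ^ a * t ∈
              orderedSpan F x h b (D + (a + 1) * h (Fin.last N) + h j.castSucc) := by
            intro t ht
            induction ht using Submodule.span_induction with
            | mem t ht =>
              obtain ⟨l, hl, h4, rfl⟩ := ht
              induction l using Fin.lastCases with
              | last => exact absurd hl (lt_irrefl _)
              | cast l =>
                have := iha D m hm l
                rw [h4] at this
                convert this using 2
                ring
            | zero => simp
            | add x y _ _ hx hy => rw [mul_add]; exact Submodule.add_mem _ hx hy
            | smul c x _ hx => rw [mul_smul_comm]; exact Submodule.smul_mem _ _ hx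
          rw [pow_succ, ← mul_assoc, mul_assoc _ (x (Fin.last N)), h2, mul_sub, mul_smul_comm,
            mul_smul_comm]
          refine Submodule.sub_mem _ (Submodule.smul_mem _ _ ?_)
            (Submodule.smul_mem _ _ (h3 s h1))
          rw [← mul_assoc]
          have := orderedSpan_mul_last H (iha D m hm j)
          convert this using 2
          ring
      induction hm using Submodule.span_induction with
      | mem t ht =>
        obtain ⟨u, hu, hD, rfl⟩ := ht
        rw [List.ofFn_succ', List.concat_eq_append, List.prod_append, List.prod_singleton]
        have h1 := key (u (Fin.last N)) (∑ i : Fin N, u i.castSucc * h i.castSucc)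
          (List.ofFn fun i : Fin N => x i.castSucc ^ u i.castSucc).prod
          (Submodule.subset_span ⟨fun i => u i.castSucc, fun i => hu _, rfl, rfl⟩) j
        rw [Fin.sum_univ_castSucc] at hD
        rw [← hD]
        exact h1
      | zero => simp
      | add x y _ _ hx hy => rw [add_mul]; exact Submodule.add_mem _ hx hy
      | smul c x _ hx => rw [smul_mul_assoc]; exact Submodule.smul_mem _ _ hx

theorem one_mem_orderedSpan {N : ℕ} (x : Fin N → A) (h : Fin N → ℕ) {b : Fin N → ℕ}
    (hb : ∀ i, 0 < b i) : (1 : A) ∈ orderedSpan F x h b 0 := by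
  refine Submodule.subset_span ⟨fun _ => 0, hb, by simp, ?_⟩
  rw [List.prod_eq_one]
  simp

theorem orderedSpan_mul_pow {N : ℕ} {x : Fin N → A} {h b : Fin N → ℕ}
    (H : IsOreFamily F x h b) {D : ℕ} {m : A} (hm : m ∈ orderedSpan F x h b D) (j : Fin N)
    (k : ℕ) : m * x j ^ k ∈ orderedSpan F x h b (D + k * h j) := by
  induction k with
  | zero => simpa using hm
  | succ k ih =>
    rw [pow_succ, ← mul_assoc]
    convert orderedSpan_mul H ih j using 2
    ring

/-- Any product of powers of the `x_i` is a combination of ordered monomials. -/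
theorem prod_pow_mem_orderedSpan {N : ℕ} {x : Fin N → A} {h b : Fin N → ℕ}
    (H : IsOreFamily F x h b) (hb : ∀ i, 0 < b i) (l : List (Fin N)) (k : Fin N → ℕ) :
    (l.map fun i => x i ^ k i).prod ∈ orderedSpan F x h b (l.map fun i => k i * h i).sum := by
  induction l using List.reverseRecOn with
  | nil => simpa using one_mem_orderedSpan x h hb
  | append_singleton l i ih =>
    simp only [List.map_append, List.prod_append, List.sum_append, List.map_cons, List.map_nil,
      List.prod_singleton, List.sum_singleton]
    exact orderedSpan_mul_pow H ih i _

/-- The ordered monomial with all exponents maximal, and the one in the opposite order, are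
proportional. -/
theorem exists_smul_top_eq {N : ℕ} {x : Fin N → A} {h b : Fin N → ℕ}
    (H : IsOreFamily F x h b) (hb : ∀ i, 0 < b i) (hh : ∀ i, 0 < h i) :
    ∃ c : F, (List.ofFn fun i => x i ^ (b i - 1)).reverse.prod =
      c • (List.ofFn fun i => x i ^ (b i - 1)).prod := by
  have h1 := prod_pow_mem_orderedSpan H hb (List.finRange N).reverse fun i => b i - 1
  have h2 : ((List.finRange N).reverse.map fun i => (b i - 1) * h i).sum =
      ∑ i, (b i - 1) * h i := by
    rw [List.map_reverse, List.sum_reverse, ← List.ofFn_eq_map, List.sum_ofFn]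
  rw [h2, List.map_reverse, ← List.ofFn_eq_map] at h1
  -- This degree is the largest an ordered monomial can have. As all `h i` are positive, only the
  -- monomial with every exponent maximal attains it.
  have h3 : orderedSpan F x h b (∑ i, (b i - 1) * h i) ≤
      Submodule.span F {(List.ofFn fun i => x i ^ (b i - 1)).prod} := by
    refine Submodule.span_mono ?_
    rintro _ ⟨a, ha, hsum, rfl⟩
    have : a = fun i => b i - 1 := by
      have h4 : ∀ i ∈ Finset.univ, a i * h i ≤ (b i - 1) * h i := fun i _ =>
        Nat.mul_le_mul_right _ (Nat.le_sub_one_of_lt (ha i))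
      funext i
      exact Nat.eq_of_mul_eq_mul_right (hh i)
        ((Finset.sum_eq_sum_iff_of_le h4).1 hsum i (Finset.mem_univ i))
    rw [this]
    rfl
  obtain ⟨c, hc⟩ := Submodule.mem_span_singleton.1 (h3 h1)
  exact ⟨c, hc.symm⟩

end Ore

/-! ### Cyclic spans and joint kernels for Ore families of operators. -/

section OreModule

variable {F : Type*} [Field F] {V : Type*} [AddCommGroup V] [Module F V]

/-- The map `(z_i) ↦ ∑ y^i z_i`. -/
def powSum (y : Module.End F V) (M : Submodule F V) (b : ℕ) : (Fin b → M) →ₗ[F] V :=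
  ∑ i : Fin b, (y ^ i.1) ∘ₗ M.subtype ∘ₗ LinearMap.proj i

theorem powSum_apply (y : Module.End F V) (M : Submodule F V) (b : ℕ) (z : Fin b → M) :
    powSum y M b z = ∑ i : Fin b, (y ^ i.1) (z i : V) := by
  simp [powSum]

theorem powSum_single (y : Module.End F V) (M : Submodule F V) (b : ℕ) (i : Fin b) (z : M) :
    powSum y M b (Pi.single i z) = (y ^ i.1) (z : V) := by
  rw [powSum_apply, Finset.sum_eq_single i]
  · simp
  · intro j _ hj
    rw [Pi.single_eq_of_ne hj]
    simp
  · simp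

/-- Nilpotency of `y` makes `∑ y^i z_i` behave like a truncated polynomial in `y`: the coefficient
pushed off the top contributes `y^b = 0`. -/
theorem powSum_shiftUp {y : Module.End F V} {M : Submodule F V} {b : ℕ} (hy : y ^ b = 0)
    (z : Fin b → M) : powSum y M b (shiftUp (F := F) b z) = y (powSum y M b z) := by
  have h : powSum y M b ∘ₗ shiftUp (F := F) b = y ∘ₗ powSum y M b := by
    refine LinearMap.pi_ext fun i s => ?_
    rw [LinearMap.comp_apply, LinearMap.comp_apply, powSum_single]
    have hb : 0 < b := by have := i.2; omega
    have h1 := shiftUp_pow_single (F := F) hb i s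
    rw [← h1, ← Module.End.mul_apply, ← pow_succ', ← Module.End.mul_apply, ← pow_succ']
    by_cases hi : i.1 + 1 < b
    · have h2 := shiftUp_pow_single (F := F) hb ⟨i.1 + 1, hi⟩ s
      simp only at h2
      rw [h2, powSum_single]
    · have h2 : i.1 + 1 = b := by have := i.2; omega
      rw [h2, shiftUp_pow_self, hy]
      simp
  exact congrArg (fun f => f z) h

/-- The span of the vectors `x_{N-1}^{a_{N-1}} ⋯ x_0^{a_0} v`. -/
def oreSpan : {N : ℕ} → (Fin N → Module.End F V) → (Fin N → ℕ) → V → Submodule F V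
  | 0, _, _, v => Submodule.span F {v}
  | N + 1, x, b, v => LinearMap.range (powSum (x (Fin.last N))
      (oreSpan (fun i => x (Fin.castSucc i)) (fun i => b (Fin.castSucc i)) v) (b (Fin.last N)))

theorem oreSpan_succ {N : ℕ} (x : Fin (N + 1) → Module.End F V) (b : Fin (N + 1) → ℕ) (v : V) :
    oreSpan x b v = LinearMap.range (powSum (x (Fin.last N))
      (oreSpan (fun i => x (Fin.castSucc i)) (fun i => b (Fin.castSucc i)) v)
        (b (Fin.last N))) := rfl

instance finiteDimensional_oreSpan {N : ℕ} (x : Fin N → Module.End F V) (b : Fin N → ℕ) (v : V) :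
    FiniteDimensional F (oreSpan x b v) := by
  induction N with
  | zero => rw [oreSpan]; infer_instance
  | succ N ih =>
    have := ih (fun i => x (Fin.castSucc i)) (fun i => b (Fin.castSucc i))
    rw [oreSpan_succ]
    infer_instance

theorem finrank_oreSpan_le {N : ℕ} (x : Fin N → Module.End F V) (b : Fin N → ℕ) (v : V) :
    Module.finrank F (oreSpan x b v) ≤ ∏ i, b i := by
  induction N with
  | zero =>
    rw [oreSpan]
    simpa using finrank_span_le_card (R := F) ({v} : Set V)
  | succ N ih =>
    rw [oreSpan_succ, Fin.prod_univ_castSucc]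
    refine (LinearMap.finrank_range_le _).trans ?_
    rw [Module.finrank_pi_fintype, Finset.sum_const, Finset.card_univ, Fintype.card_fin,
      smul_eq_mul, mul_comm]
    exact Nat.mul_le_mul_right _ (ih _ _)

theorem mem_oreSpan {N : ℕ} (x : Fin N → Module.End F V) {b : Fin N → ℕ} (hb : ∀ i, 0 < b i)
    (v : V) : v ∈ oreSpan x b v := by
  induction N with
  | zero => exact Submodule.subset_span rfl
  | succ N ih =>
    refine ⟨Pi.single ⟨0, hb _⟩ ⟨v, ih _ fun i => hb _⟩, ?_⟩
    rw [powSum_single]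
    simp

/-- The part of `∑ y^i M` with `i < k`. -/
def lowerSpan (y : Module.End F V) (M : Submodule F V) (b k : ℕ) : Submodule F V :=
  Submodule.map (powSum y M b)
    { carrier := {u | ∀ t : Fin b, k ≤ t.1 → u t = 0}
      zero_mem' := by intro t _; rfl
      add_mem' := by intro u w hu hw t ht; simp [hu t ht, hw t ht]
      smul_mem' := by intro c u hu t ht; simp [hu t ht] }

theorem pow_mem_lowerSpan {y : Module.End F V} {M : Submodule F V} {b : ℕ} (hy : y ^ b = 0) {k : ℕ}
    {z : V} (hz : z ∈ M) : (y ^ k) z ∈ lowerSpan y M b (k + 1) := by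
  by_cases hk : k < b
  · refine ⟨Pi.single ⟨k, hk⟩ ⟨z, hz⟩, ?_, ?_⟩
    · intro t ht
      refine Pi.single_eq_of_ne (fun h => ?_) _
      rw [h] at ht
      simp at ht
    · rw [powSum_single]
  · rw [← Nat.sub_add_cancel (not_lt.1 hk), pow_add, hy, mul_zero]
    exact Submodule.zero_mem _

theorem apply_mem_lowerSpan {y : Module.End F V} {M : Submodule F V} {b : ℕ} (hy : y ^ b = 0)
    {k : ℕ} {z : V} (hz : z ∈ lowerSpan y M b k) : y z ∈ lowerSpan y M b (k + 1) := by
  obtain ⟨u, hu, rfl⟩ := hz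
  refine ⟨shiftUp b u, fun t ht => ?_, powSum_shiftUp hy u⟩
  rw [shiftUp_apply, dif_pos (by omega)]
  exact hu _ (by simp; omega)

theorem lowerSpan_mono (y : Module.End F V) (M : Submodule F V) (b : ℕ) {k l : ℕ} (h : k ≤ l) :
    lowerSpan y M b k ≤ lowerSpan y M b l := by
  rintro _ ⟨u, hu, rfl⟩
  exact ⟨u, fun t ht => hu t (h.trans ht), rfl⟩

variable {N : ℕ} {h : Fin N → ℕ} {b : Fin N → ℕ} {x : Fin N → Module.End F V}

/-- Leading-term control: an earlier `x_j` passes `y^k` up to a nonzero scalar and terms with fewer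
factors `y`. The scalar does not depend on `z`, and its being nonzero lets a vanishing leading term
give `x_j z = 0`. -/
theorem apply_pow_mem_lowerSpan {h b : Fin (N + 1) → ℕ} {x : Fin (N + 1) → Module.End F V}
    (H : IsOreFamily F x h b) {M : Submodule F V} (hM : ∀ j : Fin N, ∀ z ∈ M, x j.castSucc z ∈ M)
    (k : ℕ) (j : Fin N) : ∃ c : F, c ≠ 0 ∧ ∀ z ∈ M, x j.castSucc ((x (Fin.last N) ^ k) z) -
      c • (x (Fin.last N) ^ k) (x j.castSucc z) ∈
        lowerSpan (x (Fin.last N)) M (b (Fin.last N)) k := by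
  induction k generalizing j with
  | zero => exact ⟨1, one_ne_zero, fun z _ => by simp⟩
  | succ k ih =>
    obtain ⟨c, hc, h1⟩ := H.comm j.castSucc (Fin.last N) (Fin.castSucc_lt_last j)
    obtain ⟨c', hc', h2⟩ := ih j
    refine ⟨c * c', mul_ne_zero hc hc', fun z hz => ?_⟩
    have hy := H.pow (Fin.last N)
    set y := x (Fin.last N)
    have h3 : ∀ s ∈ Submodule.span F {t | ∃ l < Fin.last N, h l = h j.castSucc + h (Fin.last N) ∧
        t = x l}, s ((y ^ k) z) ∈ lowerSpan y M (b (Fin.last N)) (k + 1) := by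
      intro s hs
      induction hs using Submodule.span_induction with
      | mem t ht =>
        obtain ⟨l, hl, -, rfl⟩ := ht
        induction l using Fin.lastCases with
        | last => exact absurd hl (lt_irrefl _)
        | cast l =>
          obtain ⟨c'', -, h4⟩ := ih l
          have h5 := lowerSpan_mono _ _ _ (Nat.le_succ k) (h4 z hz)
          have h6 := Submodule.add_mem _ h5 (Submodule.smul_mem _ c''
            (pow_mem_lowerSpan hy (k := k) (hM l z hz)))
          simpa using h6
      | zero => simp
      | add x y _ _ hx hy => rw [LinearMap.add_apply]; exact Submodule.add_mem _ hx hy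
      | smul c x _ hx => rw [LinearMap.smul_apply]; exact Submodule.smul_mem _ _ hx
    have h7 := Submodule.add_mem _ (h3 _ h1) (Submodule.smul_mem _ c
      (apply_mem_lowerSpan hy (h2 z hz)))
    convert h7 using 1
    rw [LinearMap.sub_apply, LinearMap.smul_apply, Module.End.mul_apply, Module.End.mul_apply,
      pow_succ', Module.End.mul_apply, Module.End.mul_apply, map_sub, map_smul, smul_sub, smul_smul]
    abel

/-- Truncated monomials suffice: the last operator shifts coefficients, and an earlier one crosses
the powers of the last and then acts on the smaller span. -/
theorem oreSpan_stable (H : IsOreFamily F x h b) (v : V) :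
    ∀ j, ∀ z ∈ oreSpan x b v, x j z ∈ oreSpan x b v := by
  induction N with
  | zero => exact fun j => j.elim0
  | succ N ih =>
    intro j z hz
    have hy := H.pow (Fin.last N)
    rw [oreSpan_succ] at hz ⊢
    obtain ⟨u, rfl⟩ := hz
    induction j using Fin.lastCases with
    | last => exact ⟨_, powSum_shiftUp hy u⟩
    | cast j =>
      rw [powSum_apply, map_sum]
      refine Submodule.sum_mem _ fun i _ => ?_
      have hM := ih H.castSucc
      obtain ⟨c, -, h1⟩ := apply_pow_mem_lowerSpan H hM i.1 j
      have h2 := h1 (u i) (u i).2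
      have hle : ∀ k, lowerSpan (x (Fin.last N)) (oreSpan (fun i => x (Fin.castSucc i))
          (fun i => b (Fin.castSucc i)) v) (b (Fin.last N)) k ≤ LinearMap.range
          (powSum (x (Fin.last N)) (oreSpan (fun i => x (Fin.castSucc i))
          (fun i => b (Fin.castSucc i)) v) (b (Fin.last N))) := by
        rintro k _ ⟨w, -, rfl⟩
        exact ⟨w, rfl⟩
      have h3 := Submodule.add_mem _ (hle _ h2) (Submodule.smul_mem _ c
        (hle _ (pow_mem_lowerSpan hy (k := i.1) (hM j _ (u i).2))))
      simpa using h3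

/-- If the ordered monomials in `x` applied to `v` are linearly independent, then the vectors of
their span killed by all `x_i` are the multiples of the top monomial vector. -/
theorem mem_span_top_of_killed (H : IsOreFamily F x h b) (hb : ∀ i, 0 < b i) (v : V)
    (hfr : Module.finrank F (oreSpan x b v) = ∏ i, b i) (z : V) (hz : z ∈ oreSpan x b v)
    (hk : ∀ j, x j z = 0) :
    z ∈ Submodule.span F {(List.ofFn fun i => x i ^ (b i - 1)).reverse.prod v} := by
  induction N generalizing z with
  | zero => simpa [oreSpan] using hz
  | succ N ih =>
    have hy := H.pow (Fin.last N)
    have hM := oreSpan_stable H.castSucc v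
    have hle := finrank_oreSpan_le (fun i => x (Fin.castSucc i)) (fun i => b (Fin.castSucc i)) v
    rw [oreSpan_succ] at hz hfr
    set M := oreSpan (fun i => x (Fin.castSucc i)) (fun i => b (Fin.castSucc i)) v
    set y := x (Fin.last N)
    set B := b (Fin.last N)
    have hB : 0 < B := hb _
    have hrk := LinearMap.finrank_range_add_finrank_ker (powSum y M B)
    rw [hfr, Module.finrank_pi_fintype, Finset.sum_const, Finset.card_univ, Fintype.card_fin,
      smul_eq_mul, Fin.prod_univ_castSucc, mul_comm] at hrk
    change B * _ + _ = _ at hrk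
    -- The maximal possible dimension leaves no slack in rank–nullity: the smaller span has maximal
    -- dimension as well, and the map `powSum` is injective.
    have h1 : Module.finrank F M = ∏ i : Fin N, b i.castSucc := by
      refine le_antisymm hle ?_
      refine Nat.le_of_mul_le_mul_left ?_ hB
      omega
    have hinj : Function.Injective (powSum y M B) := by
      rw [← LinearMap.ker_eq_bot, ← Submodule.finrank_eq_zero (R := F)]
      rw [h1] at hrk
      exact Nat.add_eq_left.1 hrk
    obtain ⟨u, rfl⟩ := hz
    -- Being killed by `y` leaves only the coefficient of `y^{B-1}`. The leading terms then show
    -- that this coefficient is killed by the earlier operators.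
    have h2 : shiftUp (F := F) B u = 0 := by
      refine hinj ?_
      rw [powSum_shiftUp hy, map_zero]
      exact hk _
    have h3 : u = Pi.single ⟨B - 1, by omega⟩ (u ⟨B - 1, by omega⟩) := by
      funext t
      by_cases ht : t = ⟨B - 1, by omega⟩
      · subst ht
        simp
      · rw [Pi.single_eq_of_ne ht]
        have ht' : t.1 + 1 < B := by
          have := t.2
          by_contra h
          exact ht (Fin.ext (by simp; omega))
        have := congrFun h2 ⟨t.1 + 1, ht'⟩
        rw [shiftUp_apply] at this
        simpa using this
    set w := u ⟨B - 1, by omega⟩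
    have hzw : powSum y M B u = (y ^ (B - 1)) (w : V) := by rw [h3, powSum_single]
    have h4 := ih H.castSucc (fun i => hb _) h1 w w.2 fun j => by
      obtain ⟨c, hc, h5⟩ := apply_pow_mem_lowerSpan H hM (B - 1) j
      have h6 := h5 w w.2
      rw [← hzw, hk, zero_sub] at h6
      obtain ⟨t, ht, h7⟩ := h6
      have h8 : t + c • (Pi.single (⟨B - 1, by omega⟩ : Fin B)
          (⟨x j.castSucc w, hM j w w.2⟩ : M) : Fin B → M) = 0 := by
        refine hinj ?_
        rw [map_add, h7, map_smul, powSum_single, map_zero]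
        exact neg_add_cancel _
      have h9 := congrFun h8 ⟨B - 1, by omega⟩
      rw [Pi.add_apply, ht _ (by simp), Pi.smul_apply, Pi.single_eq_same, Pi.zero_apply, zero_add,
        smul_eq_zero] at h9
      exact congrArg Subtype.val (h9.resolve_left hc)
    rw [hzw, List.ofFn_succ', List.concat_eq_append, List.reverse_append, List.prod_append]
    obtain ⟨a, ha⟩ := Submodule.mem_span_singleton.1 h4
    rw [← ha, map_smul]
    exact Submodule.smul_mem _ _ (Submodule.subset_span (by simp; rfl))

/-- A nonzero subspace stable under an Ore family of nilpotent operators has a nonzero vector killed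
by all of them. -/
theorem exists_killed (H : IsOreFamily F x h b) (P : Submodule F V) (hP : P ≠ ⊥)
    (hs : ∀ j, ∀ z ∈ P, x j z ∈ P) : ∃ z ∈ P, z ≠ 0 ∧ ∀ j, x j z = 0 := by
  induction N with
  | zero =>
    obtain ⟨z, hz, hz0⟩ := P.ne_bot_iff.1 hP
    exact ⟨z, hz, hz0, fun j => j.elim0⟩
  | succ N ih =>
    obtain ⟨z, hz, hz0, hk⟩ := ih H.castSucc fun j => hs _
    set y := x (Fin.last N)
    -- The joint kernel of the earlier operators is stable under `y`, since the commutation relation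
    -- produces only earlier operators besides `y x_j`.
    have hkill : ∀ k : ℕ, (y ^ k) z ∈ P ∧ ∀ j : Fin N, x j.castSucc ((y ^ k) z) = 0 := by
      intro k
      induction k with
      | zero => exact ⟨hz, hk⟩
      | succ k ihk =>
        rw [pow_succ', Module.End.mul_apply]
        refine ⟨hs _ _ ihk.1, fun j => ?_⟩
        obtain ⟨c, -, h1⟩ := H.comm j.castSucc (Fin.last N) (Fin.castSucc_lt_last j)
        have h2 : ∀ s ∈ Submodule.span F {t | ∃ l < Fin.last N,
            h l = h j.castSucc + h (Fin.last N) ∧ t = x l}, s ((y ^ k) z) = 0 := by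
          intro s hs
          induction hs using Submodule.span_induction with
          | mem t ht =>
            obtain ⟨l, hl, -, rfl⟩ := ht
            induction l using Fin.lastCases with
            | last => exact absurd hl (lt_irrefl _)
            | cast l => exact ihk.2 l
          | zero => simp
          | add x y _ _ hx hy => rw [LinearMap.add_apply, hx, hy, add_zero]
          | smul c x _ hx => rw [LinearMap.smul_apply, hx, smul_zero]
        have h3 := h2 _ h1
        rw [LinearMap.sub_apply, LinearMap.smul_apply, Module.End.mul_apply, Module.End.mul_apply,
          ihk.2 j, map_zero, smul_zero, sub_zero] at h3
        exact h3
    classical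
    have hex : ∃ k, (y ^ k) z = 0 := ⟨b (Fin.last N), by rw [H.pow]; rfl⟩
    -- `q` is the exponent just before the first vanishing power, so `y^q z` is nonzero and killed
    -- by `y` too.
    obtain ⟨q, hq⟩ : ∃ q, Nat.find hex = q + 1 := by
      refine Nat.exists_eq_succ_of_ne_zero fun h0 => hz0 ?_
      have := Nat.find_spec hex
      rw [h0] at this
      simpa using this
    refine ⟨(y ^ q) z, (hkill q).1, Nat.find_min hex (by omega), fun j => ?_⟩
    induction j using Fin.lastCases with
    | last =>
      have := Nat.find_spec hex
      rw [hq, pow_succ', Module.End.mul_apply] at this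
      exact this
    | cast j => exact (hkill q).2 j

end OreModule

/-! ### Products over the prime field. -/

section ArtinSchreier

theorem natCast_injOn_range {F : Type*} [Field F] (p : ℕ) [CharP F p] :
    Set.InjOn (fun t : ℕ => (t : F)) (Finset.range p) := by
  intro a ha b hb hab
  have ha := Finset.mem_range.1 ha
  have hb := Finset.mem_range.1 hb
  have := (CharP.natCast_eq_natCast F p).1 hab
  rwa [Nat.ModEq, Nat.mod_eq_of_lt ha, Nat.mod_eq_of_lt hb] at this

variable {F : Type*} [Field F] (p : ℕ) [Fact p.Prime] [CharP F p]

open Polynomial in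
theorem prod_X_sub_natCast : ∏ t ∈ Finset.range p, (X - C (t : F)) = X ^ p - X := by
  classical
  have hp := (Fact.out : p.Prime).one_lt
  have hm1 : (∏ t ∈ Finset.range p, (X - C (t : F))).Monic :=
    monic_prod_of_monic _ _ fun t _ => monic_X_sub_C _
  have hd1 : (∏ t ∈ Finset.range p, (X - C (t : F))).degree = (p : WithBot ℕ) := by
    rw [degree_prod]
    simp only [degree_X_sub_C, Finset.sum_const, Finset.card_range, nsmul_one]
  have hd2 : (X ^ p - X : F[X]).degree = (p : WithBot ℕ) := by
    rw [degree_sub_eq_left_of_degree_lt]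
    · simp
    · rw [degree_X_pow, degree_X]
      exact_mod_cast hp
  have hm2 : (X ^ p - X : F[X]).Monic := by
    refine monic_X_pow_sub ?_
    rw [degree_X]
    exact_mod_cast hp
  refine eq_of_degree_sub_lt_of_eval_finset_eq ((Finset.range p).image fun t : ℕ => (t : F)) ?_ ?_
  · rw [Finset.card_image_of_injOn (natCast_injOn_range p), Finset.card_range]
    have := degree_sub_lt_left (hd1.trans hd2.symm) hm1.ne_zero
      (hm1.leadingCoeff.trans hm2.leadingCoeff.symm)
    rwa [hd1] at this
  · intro x hx
    obtain ⟨t, ht, rfl⟩ := Finset.mem_image.1 hx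
    rw [eval_prod, Finset.prod_eq_zero ht (by simp)]
    have h1 : (t : F) ^ p = t := by
      rw [← frobenius_def, map_natCast]
    simp [h1]

-- `X^p - X` is invariant under `X ↦ X + 1`; dividing its factorization by the last factor `X -
-- (p-1) = X + 1` leaves `(X+1)^{p-1} - 1`. This is the source of the factors in the formula for
-- `f`.
open Polynomial in
theorem prod_sub_natCast_pred (x : F) :
    ∏ t ∈ Finset.range (p - 1), (x - (t : F)) = (x + 1) ^ (p - 1) - 1 := by
  have hp := (Fact.out : p.Prime).pos
  have h1 : (X + C 1 : F[X]) ≠ 0 := X_add_C_ne_zero 1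
  have h2 : ∏ t ∈ Finset.range (p - 1), (X - C (t : F)) = (X + C 1) ^ (p - 1) - 1 := by
    refine mul_right_cancel₀ h1 ?_
    have h3 : (X : F[X]) + C 1 = X - C ((p - 1 : ℕ) : F) := by
      rw [Nat.cast_pred hp, CharP.cast_eq_zero F p]
      simp
    have h4 := prod_X_sub_natCast (F := F) p
    obtain ⟨q, rfl⟩ : ∃ q, p = q + 1 := ⟨p - 1, by omega⟩
    simp only [Nat.add_sub_cancel] at h3 ⊢
    rw [Finset.prod_range_succ, ← h3] at h4
    rw [h4, sub_mul, ← pow_succ, add_pow_char]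
    simp
  have h5 := congrArg (eval x) h2
  rw [eval_prod] at h5
  simpa using h5

end ArtinSchreier

/-! ### Abstract families of matrix units. -/

section Family

variable {F : Type*} {Γ : Type*} [Field F] [AddCommGroup Γ] {m : ℕ}
  {A : Type*} [Ring A] [Algebra F A]

/-- Elements satisfying the commutation relations of matrix units of `gl(m,Γ)` and the truncation
relations for root vectors. -/
structure IsGLFamily (p : ℕ) (ε : Bicharacter Γ F) (d : Fin m → Γ) {A : Type*} [Ring A]
    [Algebra F A] (E : Fin m → Fin m → A) : Prop where
  rel : ∀ i j k l, cbr (ε.toFun (d i - d j) (d k - d l) : F) (E i j) (E k l) =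
    (if j = k then E i l else 0) -
      (ε.toFun (d i - d j) (d k - d l) : F) • (if l = i then E k j else 0)
  pow : ∀ i j, i ≠ j → E i j ^ trunc p ε (d i - d j) = 0

variable {p : ℕ} {ε : Bicharacter Γ F} {d : Fin m → Γ}

theorem IsGLFamily.map {E : Fin m → Fin m → A} (H : IsGLFamily p ε d E)
    {B : Type*} [Ring B] [Algebra F B] (φ : A →ₐ[F] B) :
    IsGLFamily p ε d (fun i j => φ (E i j)) where
  rel i j k l := by
    have h := congrArg φ (H.rel i j k l)
    simp only [cbr, map_sub, map_smul, map_mul] at h ⊢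
    rw [h]
    congr 1
    · split_ifs <;> simp
    · congr 1
      split_ifs <;> simp
  pow i j hij := by rw [← map_pow, H.pow i j hij, map_zero]

theorem IsGLFamily.mul_eq {E : Fin m → Fin m → A} (H : IsGLFamily p ε d E) (i j k l : Fin m) :
    E i j * E k l = (ε.toFun (d i - d j) (d k - d l) : F) • (E k l * E i j) +
      ((if j = k then E i l else 0) -
        (ε.toFun (d i - d j) (d k - d l) : F) • (if l = i then E k j else 0)) := by
  rw [← H.rel, cbr]
  abel

theorem IsGLFamily.diag_mul {E : Fin m → Fin m → A} (H : IsGLFamily p ε d E) (t i j : Fin m) :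
    E t t * E i j = E i j * E t t + (((if t = i then 1 else 0) - if t = j then 1 else 0 : ℤ) : F) •
      E i j := by
  rw [H.mul_eq, sub_self, bichar_zero_left, Units.val_one, one_smul, one_smul]
  congr 1
  by_cases h1 : t = i
  · subst h1
    by_cases h2 : t = j
    · subst h2
      simp
    · rw [if_pos rfl, if_neg (Ne.symm h2), if_neg h2, if_pos rfl]
      simp
  · rw [if_neg h1, if_neg h1]
    by_cases h2 : t = j
    · subst h2
      simp
    · rw [if_neg h2, if_neg (Ne.symm h2)]
      simp

end Family

/-! ### Words in the lowering operators, graded by height. -/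

section Words

variable {F : Type*} {Γ : Type*} [Field F] [AddCommGroup Γ] {m : ℕ} {V : Type*} [AddCommGroup V]
  [Module F V] {p : ℕ} {ε : Bicharacter Γ F} {d : Fin m → Γ}

/-- The span of the vectors `E_{i_1 j_1} ⋯ E_{i_k j_k} v` with `v ∈ V₀`, where all letters lower the
height `η`, by `D` in total. -/
def wordSpan (E : Fin m → Fin m → Module.End F V) (η : Fin m → ℤ) (V₀ : Submodule F V) (D : ℤ) :
    Submodule F V :=
  Submodule.span F {t | ∃ l : List (Fin m × Fin m), (∀ q ∈ l, η q.2 < η q.1) ∧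
    (l.map fun q => η q.1 - η q.2).sum = D ∧ ∃ v ∈ V₀, t = (l.map fun q => E q.1 q.2).prod v}

theorem apply_lower_mem_wordSpan (E : Fin m → Fin m → Module.End F V) {η : Fin m → ℤ}
    {V₀ : Submodule F V} {D : ℤ} {t : V} (ht : t ∈ wordSpan E η V₀ D) {i j : Fin m}
    (hij : η j < η i) : E i j t ∈ wordSpan E η V₀ (D + (η i - η j)) := by
  induction ht using Submodule.span_induction with
  | mem t ht =>
    obtain ⟨l, hl, hD, v, hv, rfl⟩ := ht
    refine Submodule.subset_span ⟨(i, j) :: l, ?_, ?_, v, hv, ?_⟩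
    · intro q hq
      rcases List.mem_cons.1 hq with rfl | hq
      exacts [hij, hl q hq]
    · rw [List.map_cons, List.sum_cons, hD, add_comm]
    · simp
  | zero => simp
  | add x y _ _ hx hy => rw [map_add]; exact Submodule.add_mem _ hx hy
  | smul c x _ hx => rw [map_smul]; exact Submodule.smul_mem _ _ hx

/-- A weak triangular decomposition: a letter is commuted through the word until it reaches `V₀`,
and each bracket preserves the total height. The height `η` is arbitrary so that the argument serves
both the standard and the opposite positive system. -/
theorem apply_mem_wordSpan {E : Fin m → Fin m → Module.End F V} (H : IsGLFamily p ε d E)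
    {η : Fin m → ℤ} (hη : Function.Injective η) {V₀ : Submodule F V}
    (hup : ∀ i j, η i < η j → ∀ v ∈ V₀, E i j v = 0) (hdiag : ∀ i, ∀ v ∈ V₀, E i i v ∈ V₀)
    {D : ℤ} {t : V} (ht : t ∈ wordSpan E η V₀ D) (i j : Fin m) :
    E i j t ∈ wordSpan E η V₀ (D + (η i - η j)) := by
  have key : ∀ (l : List (Fin m × Fin m)), (∀ q ∈ l, η q.2 < η q.1) → ∀ v ∈ V₀, ∀ i j,
      E i j ((l.map fun q => E q.1 q.2).prod v) ∈
        wordSpan E η V₀ ((l.map fun q => η q.1 - η q.2).sum + (η i - η j)) := by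
    intro l
    induction l with
    | nil =>
      intro _ v hv i j
      rcases lt_trichotomy (η i) (η j) with h | h | h
      · simp [hup i j h v hv]
      · obtain rfl := hη h
        exact Submodule.subset_span ⟨[], by simp, by simp, _, hdiag i v hv, by simp⟩
      · exact apply_lower_mem_wordSpan E
          (Submodule.subset_span ⟨[], by simp, by simp, v, hv, by simp⟩) h
    | cons q l ih =>
      intro hl v hv i j
      have hl' : ∀ q ∈ l, η q.2 < η q.1 := fun r hr => hl r (List.mem_cons_of_mem _ hr)
      have ih' := ih hl' v hv
      simp only [List.map_cons, List.prod_cons, List.sum_cons, Module.End.mul_apply]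
      set w := (l.map fun q => E q.1 q.2).prod v
      set D := (l.map fun q => η q.1 - η q.2).sum
      have h1 := congrArg (fun f : Module.End F V => f w) (H.mul_eq i j q.1 q.2)
      simp only [Module.End.mul_apply, LinearMap.add_apply, LinearMap.sub_apply,
        LinearMap.smul_apply] at h1
      rw [h1]
      refine Submodule.add_mem _ (Submodule.smul_mem _ _ ?_) (Submodule.sub_mem _ ?_
        (Submodule.smul_mem _ _ ?_))
      · convert apply_lower_mem_wordSpan E (ih' i j) (hl q (List.mem_cons_self ..)) using 2
        ring
      · split_ifs with h
        · convert ih' i q.2 using 2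
          rw [h]
          ring
        · simp
      · split_ifs with h
        · convert ih' q.1 j using 2
          rw [h]
          ring
        · simp
  induction ht using Submodule.span_induction with
  | mem t ht =>
    obtain ⟨l, hl, hD, v, hv, rfl⟩ := ht
    rw [← hD]
    exact key l hl v hv i j
  | zero => simp
  | add x y _ _ hx hy => rw [map_add]; exact Submodule.add_mem _ hx hy
  | smul c x _ hx => rw [map_smul]; exact Submodule.smul_mem _ _ hx

/-- Every letter lowers strictly, so a total drop of zero leaves only the empty word. -/
theorem wordSpan_zero_le (E : Fin m → Fin m → Module.End F V) (η : Fin m → ℤ)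
    (V₀ : Submodule F V) : wordSpan E η V₀ 0 ≤ V₀ := by
  refine Submodule.span_le.2 ?_
  rintro _ ⟨l, hl, hD, v, hv, rfl⟩
  cases l with
  | nil => simpa using hv
  | cons q l =>
    exfalso
    have h1 : ∀ l : List (Fin m × Fin m), (∀ q ∈ l, η q.2 < η q.1) →
        0 ≤ (l.map fun q => η q.1 - η q.2).sum := by
      intro l hl
      refine List.sum_nonneg fun x hx => ?_
      obtain ⟨q, hq, rfl⟩ := List.mem_map.1 hx
      have := hl q hq
      omega
    have h2 := h1 l fun r hr => hl r (List.mem_cons_of_mem _ hr)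
    have h3 := hl q (List.mem_cons_self ..)
    rw [List.map_cons, List.sum_cons] at hD
    omega

theorem mem_wordSpan_zero (E : Fin m → Fin m → Module.End F V) (η : Fin m → ℤ)
    {V₀ : Submodule F V} {v : V} (hv : v ∈ V₀) : v ∈ wordSpan E η V₀ 0 :=
  Submodule.subset_span ⟨[], by simp, by simp, v, hv, by simp⟩

theorem apply_pow_mem_wordSpan {E : Fin m → Fin m → Module.End F V} (H : IsGLFamily p ε d E)
    {η : Fin m → ℤ} (hη : Function.Injective η) {V₀ : Submodule F V}
    (hup : ∀ i j, η i < η j → ∀ v ∈ V₀, E i j v = 0) (hdiag : ∀ i, ∀ v ∈ V₀, E i i v ∈ V₀)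
    {N : ℕ} (q : Fin N → Fin m × Fin m) (k : Fin N → ℕ) {D : ℤ} {t : V}
    (ht : t ∈ wordSpan E η V₀ D) :
    (List.ofFn fun i => E (q i).1 (q i).2 ^ k i).prod t ∈
      wordSpan E η V₀ (D + ∑ i, k i * (η (q i).1 - η (q i).2)) := by
  have hpow : ∀ (i j : Fin m) (n : ℕ) {D : ℤ} {t : V}, t ∈ wordSpan E η V₀ D →
      (E i j ^ n) t ∈ wordSpan E η V₀ (D + n * (η i - η j)) := by
    intro i j n
    induction n with
    | zero => intro D t ht; simpa using ht
    | succ n ih =>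
      intro D t ht
      rw [pow_succ', Module.End.mul_apply]
      convert apply_mem_wordSpan H hη hup hdiag (ih ht) i j using 2
      push_cast
      ring
  induction N generalizing D t with
  | zero => simpa using ht
  | succ N ih =>
    rw [List.ofFn_succ', List.concat_eq_append, List.prod_append, List.prod_singleton,
      Module.End.mul_apply]
    convert ih (fun i => q i.castSucc) (fun i => k i.castSucc)
      (hpow (q (Fin.last N)).1 (q (Fin.last N)).2 (k (Fin.last N)) ht) using 2
    rw [Fin.sum_univ_castSucc]
    ring

/-- A subspace stable under all `E_{ij}` and meeting the highest weight vectors is spanned by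
words. -/
theorem iSup_wordSpan_eq_top {E : Fin m → Fin m → Module.End F V} (H : IsGLFamily p ε d E)
    {η : Fin m → ℤ} (hη : Function.Injective η) {V₀ : Submodule F V}
    (hup : ∀ i j, η i < η j → ∀ v ∈ V₀, E i j v = 0) (hdiag : ∀ i, ∀ v ∈ V₀, E i i v ∈ V₀)
    (hgen : ∀ P : Submodule F V, V₀ ≤ P → (∀ i j, ∀ t ∈ P, E i j t ∈ P) → P = ⊤)
    (P : Submodule F V) (hV : V₀ ≤ P)
    (hP : ∀ i j, η j < η i → ∀ t ∈ P, E i j t ∈ P) : P = ⊤ := by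
  have h1 : ⨆ D, wordSpan E η V₀ D = ⊤ := by
    refine hgen _ (fun v hv => Submodule.mem_iSup_of_mem 0 (mem_wordSpan_zero E η hv))
      fun i j t ht => ?_
    induction ht using Submodule.iSup_induction' with
    | mem D t ht => exact Submodule.mem_iSup_of_mem _ (apply_mem_wordSpan H hη hup hdiag ht i j)
    | zero => simp
    | add x y _ _ hx hy => rw [map_add]; exact Submodule.add_mem _ hx hy
  rw [eq_top_iff, ← h1]
  refine iSup_le fun D => Submodule.span_le.2 ?_
  rintro _ ⟨l, hl, -, v, hv, rfl⟩
  induction l with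
  | nil => simpa using hV hv
  | cons q l ih =>
    rw [List.map_cons, List.prod_cons, Module.End.mul_apply]
    exact hP _ _ (hl q (List.mem_cons_self ..)) _
      (ih fun r hr => hl r (List.mem_cons_of_mem _ hr))

end Words

/-! ### Combinatorics of Friedlander–Parshall orderings. -/

section Roots

variable {m N : ℕ}

theorem rootVec_apply (q : Fin m × Fin m) (t : Fin m) :
    rootVec q t = (if t = q.1 then 1 else 0) - if t = q.2 then 1 else 0 := by
  simp [rootVec, Pi.single_apply]

theorem eq_of_rootVec_eq {q q' : Fin m × Fin m} (hq : q.1 ≠ q.2) (h : rootVec q = rootVec q') :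
    q = q' := by
  have h1 := congrFun h q.1
  have h2 := congrFun h q.2
  rw [rootVec_apply, rootVec_apply] at h1 h2
  rw [if_pos rfl, if_neg hq] at h1
  rw [if_pos rfl, if_neg hq.symm] at h2
  refine Prod.ext ?_ ?_
  · by_contra h3
    rw [if_neg h3] at h1
    split_ifs at h1 <;> omega
  · by_contra h3
    rw [if_neg h3] at h2
    split_ifs at h2 <;> omega

theorem neg_rootVec (q : Fin m × Fin m) : -rootVec q = rootVec q.swap := by
  simp [rootVec]

theorem rootVec_add (i j k : Fin m) : rootVec (i, j) + rootVec (j, k) = rootVec (i, k) := by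
  simp [rootVec]

variable {δ : Fin N ≃ PosRoot m}

theorem IsFPOrder.exists_add (hδ : IsFPOrder δ) {a c k : Fin N} (ha : a ≤ k) (hc : c ≤ k)
    (h : (δ a).1.2 = (δ c).1.1) : ∃ l ≤ k, (δ l).1 = ((δ a).1.1, (δ c).1.2) := by
  have hlt : (δ a).1.1 < (δ c).1.2 := (δ a).2.trans (h ▸ (δ c).2)
  have hsum : -rootVec (δ a).1 + -rootVec (δ c).1 = -rootVec ((δ a).1.1, (δ c).1.2) := by
    have h1 : ((δ a).1.2, (δ c).1.2) = (δ c).1 := Prod.ext h rfl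
    have h2 := rootVec_add (δ a).1.1 (δ a).1.2 (δ c).1.2
    rw [h1] at h2
    rw [← h2, neg_add]
  obtain ⟨l, hl, h2⟩ := (hδ k).2.2.2 _ ⟨a, ha, rfl⟩ _ ⟨c, hc, rfl⟩ (by
    rw [hsum, neg_rootVec]
    exact ⟨_, hlt.ne', rfl⟩)
  rw [hsum, neg_inj] at h2
  exact ⟨l, hl, (eq_of_rootVec_eq hlt.ne h2).symm⟩

/-- Additivity places the sum at an index at most `k`; the index `k` itself would force `δ_j` to
vanish. So brackets of root vectors involve strictly earlier ones only. -/
theorem IsFPOrder.exists_add_lt (hδ : IsFPOrder δ) {j k : Fin N} (hjk : j < k) :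
    ((δ j).1.2 = (δ k).1.1 → ∃ l < k, (δ l).1 = ((δ j).1.1, (δ k).1.2)) ∧
    ((δ k).1.2 = (δ j).1.1 → ∃ l < k, (δ l).1 = ((δ k).1.1, (δ j).1.2)) := by
  refine ⟨fun h => ?_, fun h => ?_⟩
  · obtain ⟨l, hl, h1⟩ := hδ.exists_add hjk.le le_rfl h
    refine ⟨l, lt_of_le_of_ne hl ?_, h1⟩
    rintro rfl
    have h2 := congrArg Prod.fst h1
    have := (δ j).2
    simp only at h2
    rw [h, h2] at this
    exact lt_irrefl _ this
  · obtain ⟨l, hl, h1⟩ := hδ.exists_add le_rfl hjk.le h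
    refine ⟨l, lt_of_le_of_ne hl ?_, h1⟩
    rintro rfl
    have h2 := congrArg Prod.snd h1
    have := (δ j).2
    simp only at h2
    rw [← h, h2] at this
    exact lt_irrefl _ this

/-- The pair `q` represents a root of the `n`-th positive system. -/
def IsStagePos (δ : Fin N ≃ PosRoot m) (n : ℕ) (q : Fin m × Fin m) : Prop :=
  (∃ i : Fin N, i.1 < n ∧ q = (δ i).1.swap) ∨ ∃ i : Fin N, n ≤ i.1 ∧ q = (δ i).1

theorem IsStagePos.ne {n : ℕ} {q : Fin m × Fin m} (h : IsStagePos δ n q) : q.1 ≠ q.2 := by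
  rcases h with ⟨i, -, rfl⟩ | ⟨i, -, rfl⟩
  exacts [(δ i).2.ne', (δ i).2.ne]

theorem isStagePos_iff (k : Fin N) {q : Fin m × Fin m} (hq : q.1 ≠ q.2) :
    rootVec q ∈ ({a | ∃ i < k, a = -rootVec (δ i).1} ∪ {a | ∃ i ≥ k, a = rootVec (δ i).1} :
      Set (Fin m → ℤ)) ↔ IsStagePos δ k q := by
  constructor
  · rintro (⟨i, hi, h⟩ | ⟨i, hi, h⟩)
    · rw [neg_rootVec] at h
      exact Or.inl ⟨i, hi, eq_of_rootVec_eq hq h⟩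
    · exact Or.inr ⟨i, hi, eq_of_rootVec_eq hq h⟩
  · rintro (⟨i, hi, rfl⟩ | ⟨i, hi, rfl⟩)
    · exact Or.inl ⟨i, hi, (neg_rootVec _).symm⟩
    · exact Or.inr ⟨i, hi, rfl⟩

/-- Otherwise `-s` would be positive, and `δ_k = q + (-s)` would contradict simplicity of `δ_k`. -/
theorem IsFPOrder.isStagePos_sub (hδ : IsFPOrder δ) (k : Fin N) {q s : Fin m × Fin m}
    (hq : IsStagePos δ k q) (hs : s.1 ≠ s.2) (h : rootVec q = rootVec s + rootVec (δ k).1) :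
    IsStagePos δ k s := by
  obtain ⟨h1, h2, -⟩ := hδ k
  rw [← isStagePos_iff k hs]
  refine (h1.2.1 (rootVec s) ⟨s, hs, rfl⟩).resolve_right fun h3 => ?_
  refine h2.2 _ ((isStagePos_iff k hq.ne).2 hq) _ h3 ?_
  rw [h]
  abel

theorem IsFPOrder.isStagePos_left (hδ : IsFPOrder δ) (k : Fin N) {q : Fin m × Fin m}
    (hq : IsStagePos δ k q) (hne : q ≠ (δ k).1) (h : q.2 = (δ k).1.2) :
    IsStagePos δ k (q.1, (δ k).1.1) := by
  refine hδ.isStagePos_sub k hq (fun h1 => hne (Prod.ext h1 h)) ?_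
  rw [show (δ k).1 = ((δ k).1.1, (δ k).1.2) from rfl, rootVec_add, ← h]

theorem IsFPOrder.isStagePos_right (hδ : IsFPOrder δ) (k : Fin N) {q : Fin m × Fin m}
    (hq : IsStagePos δ k q) (hne : q ≠ (δ k).1) (h : q.1 = (δ k).1.1) :
    IsStagePos δ k ((δ k).1.2, q.2) := by
  refine hδ.isStagePos_sub k hq (fun h1 => hne (Prod.ext h h1.symm)) ?_
  rw [show (δ k).1 = ((δ k).1.1, (δ k).1.2) from rfl, add_comm, rootVec_add, ← h]

theorem isStagePos_zero {i j : Fin m} : IsStagePos δ 0 (i, j) ↔ i < j := by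
  constructor
  · rintro (⟨k, hk, -⟩ | ⟨k, -, h⟩)
    · omega
    · have := (δ k).2
      rw [← h] at this
      exact this
  · intro h
    exact Or.inr ⟨δ.symm ⟨(i, j), h⟩, Nat.zero_le _, by simp⟩

theorem isStagePos_last {i j : Fin m} (h : j < i) : IsStagePos δ N (i, j) :=
  Or.inl ⟨δ.symm ⟨(j, i), h⟩, Fin.is_lt _, by simp⟩

/-- Consecutive positive systems differ by the reflection in a simple root, which only exchanges
`δ_k` with `-δ_k`. -/
theorem IsStagePos.of_succ (k : Fin N) {q : Fin m × Fin m} (h : IsStagePos δ (k + 1) q) :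
    q = (δ k).1.swap ∨ IsStagePos δ k q ∧ q ≠ (δ k).1 := by
  rcases h with ⟨i, hi, rfl⟩ | ⟨i, hi, rfl⟩
  · rcases Nat.lt_succ_iff_lt_or_eq.1 hi with h | h
    · refine Or.inr ⟨Or.inl ⟨i, h, rfl⟩, fun h1 => ?_⟩
      have h2 := (δ i).2
      have h3 := (δ k).2
      rw [← h1] at h3
      exact lt_asymm h2 h3
    · exact Or.inl (by rw [Fin.ext h])
  · refine Or.inr ⟨Or.inr ⟨i, by omega, rfl⟩, fun h1 => ?_⟩
    have := δ.injective (Subtype.ext h1)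
    rw [this] at hi
    omega

end Roots

/-! ### Root vectors as Ore families. -/

section OreRoots

variable {F : Type*} {Γ : Type*} [Field F] [AddCommGroup Γ] {m N : ℕ}
  {A : Type*} [Ring A] [Algebra F A] {p : ℕ} {ε : Bicharacter Γ F} {d : Fin m → Γ}
  {δ : Fin N ≃ PosRoot m}

theorem trunc_neg (p : ℕ) (ε : Bicharacter Γ F) (α : Γ) : trunc p ε (-α) = trunc p ε α := by
  rw [trunc, trunc, bichar_neg_neg]

theorem trunc_sub_comm (p : ℕ) (ε : Bicharacter Γ F) (α β : Γ) :
    trunc p ε (α - β) = trunc p ε (β - α) := by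
  rw [← neg_sub, trunc_neg]

theorem pbar_eq_trunc (q : Fin m × Fin m) : pbar p ε d q = trunc p ε (d q.1 - d q.2) := rfl

theorem pbar_pos (hp : 0 < p) (ε : Bicharacter Γ F) (d : Fin m → Γ) (q : Fin m × Fin m) :
    0 < pbar p ε d q := by
  rw [pbar]
  split_ifs
  exacts [hp, two_pos]

/-- The height of the `k`-th positive root. -/
def rootHeight (δ : Fin N ≃ PosRoot m) (k : Fin N) : ℕ := (δ k).1.2.1 - (δ k).1.1.1

theorem rootHeight_pos (δ : Fin N ≃ PosRoot m) (k : Fin N) : 0 < rootHeight δ k := by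
  have : (δ k).1.1.1 < (δ k).1.2.1 := (δ k).2
  rw [rootHeight]
  omega

theorem rootHeight_add {j k l : Fin N} (h : (δ j).1.2 = (δ k).1.1)
    (hl : (δ l).1 = ((δ j).1.1, (δ k).1.2)) :
    rootHeight δ l = rootHeight δ j + rootHeight δ k := by
  have h1 : (δ j).1.1.1 < (δ j).1.2.1 := (δ j).2
  have h2 : (δ k).1.1.1 < (δ k).1.2.1 := (δ k).2
  have h3 : (δ j).1.2.1 = (δ k).1.1.1 := congrArg Fin.val h
  rw [rootHeight, rootHeight, rootHeight, hl]
  simp only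
  omega

/-- The bracket of two lowering root vectors is a combination of root vectors for sums of the roots.
Those come earlier in the ordering, and root height is additive, which supplies the degree
condition. -/
theorem IsGLFamily.ore_lower {E : Fin m → Fin m → A} (H : IsGLFamily p ε d E)
    (hδ : IsFPOrder δ) : IsOreFamily F (fun k => E (δ k).1.2 (δ k).1.1) (rootHeight δ)
      (fun k => pbar p ε d (δ k).1) where
  comm j k hjk := by
    refine ⟨_, Units.ne_zero (ε.toFun (d (δ j).1.2 - d (δ j).1.1) (d (δ k).1.2 - d (δ k).1.1)), ?_⟩
    rw [H.mul_eq, add_sub_cancel_left]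
    refine Submodule.sub_mem _ ?_ (Submodule.smul_mem _ _ ?_)
    · split_ifs with h
      · obtain ⟨l, hl, h1⟩ := (hδ.exists_add_lt hjk).2 h.symm
        exact Submodule.subset_span ⟨l, hl, by rw [rootHeight_add h.symm h1, add_comm], by rw [h1]⟩
      · exact Submodule.zero_mem _
    · split_ifs with h
      · obtain ⟨l, hl, h1⟩ := (hδ.exists_add_lt hjk).1 h.symm
        exact Submodule.subset_span ⟨l, hl, rootHeight_add h.symm h1, by rw [h1]⟩
      · exact Submodule.zero_mem _
  pow k := by
    rw [pbar_eq_trunc, trunc_sub_comm]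
    exact H.pow _ _ (δ k).2.ne'

theorem IsGLFamily.ore_upper {E : Fin m → Fin m → A} (H : IsGLFamily p ε d E)
    (hδ : IsFPOrder δ) : IsOreFamily F (fun k => E (δ k).1.1 (δ k).1.2) (rootHeight δ)
      (fun k => pbar p ε d (δ k).1) where
  comm j k hjk := by
    refine ⟨_, Units.ne_zero (ε.toFun (d (δ j).1.1 - d (δ j).1.2) (d (δ k).1.1 - d (δ k).1.2)), ?_⟩
    rw [H.mul_eq, add_sub_cancel_left]
    refine Submodule.sub_mem _ ?_ (Submodule.smul_mem _ _ ?_)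
    · split_ifs with h
      · obtain ⟨l, hl, h1⟩ := (hδ.exists_add_lt hjk).1 h
        exact Submodule.subset_span ⟨l, hl, rootHeight_add h h1, by rw [h1]⟩
      · exact Submodule.zero_mem _
    · split_ifs with h
      · obtain ⟨l, hl, h1⟩ := (hδ.exists_add_lt hjk).2 h
        exact Submodule.subset_span ⟨l, hl, by rw [rootHeight_add h h1, add_comm], by rw [h1]⟩
      · exact Submodule.zero_mem _
  pow k := by
    rw [pbar_eq_trunc]
    exact H.pow _ _ (δ k).2.ne

end OreRoots

/-! ### Rank-one computations and the Friedlander–Parshall chain. -/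

section Chain

variable {F : Type*} {Γ : Type*} [Field F] [AddCommGroup Γ] {m N : ℕ}
  {V : Type*} [AddCommGroup V] [Module F V] {p : ℕ} {ε : Bicharacter Γ F} {d : Fin m → Γ}
  {E : Fin m → Fin m → Module.End F V}

open Classical in
/-- The value at `H_δ` of the weight with values `ρ` at the `e_{ii}`. -/
def corootVal (ε : Bicharacter Γ F) (d : Fin m → Γ) (ρ : Fin m → F) (q : Fin m × Fin m) : F :=
  if ε.toFun (d q.1 - d q.2) (d q.1 - d q.2) = 1 then ρ q.1 - ρ q.2 else ρ q.1 + ρ q.2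

theorem IsGLFamily.diag_pow (H : IsGLFamily p ε d E) (i j : Fin m) {u : V} {ρ : Fin m → F}
    (hu : ∀ t, E t t u = ρ t • u) (n : ℕ) (t : Fin m) :
    E t t ((E j i ^ n) u) = (ρ t - n * (rootVec (i, j) t : F)) • (E j i ^ n) u := by
  induction n with
  | zero => simp [hu]
  | succ n ih =>
    have h1 := congrArg (fun f : Module.End F V => f ((E j i ^ n) u)) (H.diag_mul t j i)
    simp only [Module.End.mul_apply, LinearMap.add_apply, LinearMap.smul_apply] at h1
    rw [pow_succ', Module.End.mul_apply, h1, ih, map_smul, ← add_smul, rootVec_apply]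
    congr 1
    push_cast
    ring

/-- The `sl_2` computation: `e f^{n+1} u = (n+1)(ρ_i - ρ_j - n) f^n u`, iterated. -/
theorem IsGLFamily.even_rankOne (H : IsGLFamily p ε d E) {i j : Fin m} (hij : i ≠ j) {u : V}
    {ρ : Fin m → F} (hα : ε.toFun (d i - d j) (d i - d j) = 1)
    (hu : ∀ t, E t t u = ρ t • u) (he : E i j u = 0) (n : ℕ) :
    (E i j ^ n) ((E j i ^ n) u) =
      (∏ t ∈ Finset.range n, (((t : F) + 1) * (ρ i - ρ j - t))) • u := by
  have h1 : ∀ w, E i j (E j i w) = E j i (E i j w) + (E i i w - E j j w) := by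
    intro w
    have h2 := congrArg (fun f : Module.End F V => f w) (H.mul_eq i j j i)
    rw [← neg_sub (d i) (d j), bichar_neg_right, hα] at h2
    simpa using h2
  have h3 : ∀ n : ℕ, E i j ((E j i ^ (n + 1)) u) =
      (((n : F) + 1) * (ρ i - ρ j - n)) • (E j i ^ n) u := by
    intro n
    induction n with
    | zero => simp [h1, he, hu, sub_smul]
    | succ n ih =>
      rw [pow_succ', Module.End.mul_apply, h1, ih, map_smul, ← Module.End.mul_apply, ← pow_succ',
        H.diag_pow i j hu, H.diag_pow i j hu, ← sub_smul, ← add_smul, rootVec_apply, rootVec_apply]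
      congr 1
      simp only [if_true, if_neg hij, if_neg hij.symm]
      push_cast
      ring
  induction n with
  | zero => simp
  | succ n ih =>
    rw [pow_succ, Module.End.mul_apply, h3, map_smul, ih, smul_smul, Finset.prod_range_succ,
      mul_comm]

theorem IsGLFamily.odd_rankOne (H : IsGLFamily p ε d E) {i j : Fin m} {u : V}
    {ρ : Fin m → F} (hα : (ε.toFun (d i - d j) (d i - d j) : F) = -1)
    (hu : ∀ t, E t t u = ρ t • u) (he : E i j u = 0) :
    E i j (E j i u) = (ρ i + ρ j) • u := by
  have h2 := congrArg (fun f : Module.End F V => f u) (H.mul_eq i j j i)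
  rw [← neg_sub (d i) (d j), bichar_neg_right, Units.val_inv_eq_inv_val, hα] at h2
  simpa [he, hu, add_smul, inv_neg] using h2

/-- In the even case the product of `λ - t` over `t < p - 1` collapses by `prod_sub_natCast_pred`.
In the odd case `p̄ - 1 = 1`, and the formula is just the scalar `(λ + 1) - 1`. -/
theorem IsGLFamily.rankOne [Fact p.Prime] [CharP F p] (hp : p ≠ 2) (H : IsGLFamily p ε d E)
    {i j : Fin m} (hij : i ≠ j) {u : V}
    {ρ : Fin m → F} (hu : ∀ t, E t t u = ρ t • u) (he : E i j u = 0) :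
    (E i j ^ (pbar p ε d (i, j) - 1)) ((E j i ^ (pbar p ε d (i, j) - 1)) u) =
      (((pbar p ε d (i, j) - 1).factorial : F) *
        ((corootVal ε d ρ (i, j) + 1) ^ (pbar p ε d (i, j) - 1) - 1)) • u := by
  rw [pbar_eq_trunc]
  simp only
  rcases trunc_cases p ε (d i - d j) with ⟨h, h'⟩ | ⟨h, h'⟩
  · rw [h', H.even_rankOne hij h hu he, Finset.prod_mul_distrib, prod_sub_natCast_pred, corootVal,
      if_pos h]
    congr 2
    rw [← Finset.prod_range_add_one_eq_factorial]
    push_cast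
    rfl
  · have h1 : ε.toFun (d i - d j) (d i - d j) ≠ 1 := by
      intro h1
      rw [trunc, if_pos h1] at h'
      exact hp h'
    rw [h', corootVal, if_neg h1]
    simp [H.odd_rankOne h hu he]

/-- The weight of the `n`-th vector of the Friedlander-Parshall chain. -/
def stageWeight (p : ℕ) (ε : Bicharacter Γ F) (d : Fin m → Γ) (δ : Fin N ≃ PosRoot m)
    (r : Fin m → F) (n : ℕ) (t : Fin m) : F :=
  r t - ∑ k ∈ Finset.univ.filter (fun k : Fin N => k.1 < n),
    ((pbar p ε d (δ k).1 - 1 : ℕ) : F) * (rootVec (δ k).1 t : F)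

theorem stageWeight_succ (δ : Fin N ≃ PosRoot m) (r : Fin m → F) (k : Fin N) (t : Fin m) :
    stageWeight p ε d δ r (k + 1) t = stageWeight p ε d δ r k t -
      ((pbar p ε d (δ k).1 - 1 : ℕ) : F) * (rootVec (δ k).1 t : F) := by
  have h : Finset.univ.filter (fun i : Fin N => i.1 < k.1 + 1) =
      insert k (Finset.univ.filter (fun i : Fin N => i.1 < k.1)) := by
    ext i
    simp only [Finset.mem_filter, Finset.mem_univ, true_and, Finset.mem_insert, Fin.ext_iff]
    omega
  rw [stageWeight, stageWeight, h, Finset.sum_insert (by simp)]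
  ring

/-- Commuting a raising operator of root `q` past `f_{δ_k}` creates at most root vectors of root `q
- δ_k`. By simplicity of `δ_k` this root is again positive at stage `k`, and it is not `δ_k`, so the
induction applies to it. -/
theorem IsGLFamily.killed_pow (H : IsGLFamily p ε d E) {δ : Fin N ≃ PosRoot m} (hδ : IsFPOrder δ)
    (k : Fin N) {u : V} (hk : ∀ q, IsStagePos δ k q → E q.1 q.2 u = 0) (n : ℕ) :
    ∀ q, IsStagePos δ k q → q ≠ (δ k).1 →
      E q.1 q.2 ((E (δ k).1.2 (δ k).1.1 ^ n) u) = 0 := by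
  induction n with
  | zero => exact fun q hq _ => hk q hq
  | succ n ih =>
    intro q hq hne
    rw [pow_succ', Module.End.mul_apply]
    set w := (E (δ k).1.2 (δ k).1.1 ^ n) u
    have h1 := congrArg (fun f : Module.End F V => f w)
      (H.mul_eq q.1 q.2 (δ k).1.2 (δ k).1.1)
    simp only [Module.End.mul_apply, LinearMap.add_apply, LinearMap.sub_apply,
      LinearMap.smul_apply] at h1
    have hkk := (δ k).2
    rw [h1, ih q hq hne, map_zero, smul_zero, zero_add]
    have h2 : (if q.2 = (δ k).1.2 then E q.1 (δ k).1.1 else 0) w = 0 := by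
      split_ifs with h
      · refine ih _ (hδ.isStagePos_left k hq hne h) fun h3 => ?_
        have := congrArg Prod.snd h3
        simp only at this
        rw [← this] at hkk
        exact lt_irrefl _ hkk
      · simp
    have h3 : (if (δ k).1.1 = q.1 then E (δ k).1.2 q.2 else 0) w = 0 := by
      split_ifs with h
      · refine ih _ (hδ.isStagePos_right k hq hne h.symm) fun h3 => ?_
        have := congrArg Prod.fst h3
        simp only at this
        rw [this] at hkk
        exact lt_irrefl _ hkk
      · simp
    rw [h2, h3, smul_zero, sub_zero]

theorem reverse_prod_ofFn_apply {n : ℕ} (g : Fin n → Module.End F V) (w : ℕ → V)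
    (h : ∀ k : Fin n, w (k + 1) = g k (w k)) : (List.ofFn g).reverse.prod (w 0) = w n := by
  induction n with
  | zero => simp
  | succ n ih =>
    rw [List.ofFn_succ', List.concat_eq_append, List.reverse_append, List.prod_append,
      Module.End.mul_apply, ih (fun i => g i.castSucc) fun k => h k.castSucc]
    simpa using (h (Fin.last n)).symm

theorem prod_ofFn_apply {n : ℕ} (g : Fin n → Module.End F V) (w : ℕ → V) (s : Fin n → F)
    (h : ∀ k : Fin n, g k (w (k + 1)) = s k • w k) :
    (List.ofFn g).prod (w n) = (∏ k, s k) • w 0 := by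
  induction n with
  | zero => simp
  | succ n ih =>
    have h1 := h (Fin.last n)
    rw [Fin.val_last] at h1
    rw [List.ofFn_succ', List.concat_eq_append, List.prod_append, List.prod_singleton,
      Module.End.mul_apply, h1, map_smul, ih _ (fun i => s i.castSucc) fun k => h k.castSucc,
      Fin.prod_univ_castSucc, smul_smul, mul_comm]

/-- The Friedlander-Parshall chain: applying `f_{δ_1}^{p̄-1}`, …, `f_{δ_N}^{p̄-1}` in this order to a
highest weight vector gives a lowest weight vector, and the `e_{δ_i}^{p̄-1}` bring it back. -/
theorem IsGLFamily.chain [Fact p.Prime] [CharP F p] (hp : p ≠ 2) (H : IsGLFamily p ε d E)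
    {δ : Fin N ≃ PosRoot m}
    (hδ : IsFPOrder δ) {v : V} {r : Fin m → F} (hup : ∀ i j, i < j → E i j v = 0)
    (hdiag : ∀ t, E t t v = r t • v) :
    ∃ w : V, w = (List.ofFn fun k =>
        E (δ k).1.2 (δ k).1.1 ^ (pbar p ε d (δ k).1 - 1)).reverse.prod v ∧
      (∀ i j, j < i → E i j w = 0) ∧ (∀ t, E t t w = stageWeight p ε d δ r N t • w) ∧
      (List.ofFn fun k => E (δ k).1.1 (δ k).1.2 ^ (pbar p ε d (δ k).1 - 1)).prod w =
        (∏ k : Fin N, (((pbar p ε d (δ k).1 - 1).factorial : F) *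
          ((corootVal ε d (stageWeight p ε d δ r k) (δ k).1 + 1) ^ (pbar p ε d (δ k).1 - 1) - 1)))
            • v := by
  let w : ℕ → V := fun n => Nat.rec v (fun k u => if h : k < N then
    (E (δ ⟨k, h⟩).1.2 (δ ⟨k, h⟩).1.1 ^ (pbar p ε d (δ ⟨k, h⟩).1 - 1)) u else u) n
  have hw : ∀ k : Fin N, w (k + 1) =
      (E (δ k).1.2 (δ k).1.1 ^ (pbar p ε d (δ k).1 - 1)) (w k) := by
    intro k
    have : w (k + 1) = if h : k.1 < N then
      (E (δ ⟨k, h⟩).1.2 (δ ⟨k, h⟩).1.1 ^ (pbar p ε d (δ ⟨k, h⟩).1 - 1)) (w k) else w k := rfl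
    rw [this, dif_pos k.2]
  have hb : ∀ k, pbar p ε d (δ k).1 = pbar p ε d (δ k).1 - 1 + 1 := by
    intro k
    have h1 := pbar_pos (Fact.out : p.Prime).pos ε d (δ k).1
    omega
  -- `w n` is a highest weight vector for the `n`-th positive system: stage `0` is the standard one,
  -- stage `N` its opposite.
  have main : ∀ n ≤ N, (∀ q, IsStagePos δ n q → E q.1 q.2 (w n) = 0) ∧
      ∀ t, E t t (w n) = stageWeight p ε d δ r n t • w n := by
    intro n
    induction n with
    | zero =>
      refine fun _ => ⟨fun q hq => hup _ _ (isStagePos_zero.1 hq), fun t => ?_⟩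
      change E t t v = _ • v
      rw [hdiag, stageWeight]
      simp
    | succ n ih =>
      intro hn
      obtain ⟨h1, h2⟩ := ih (Nat.le_of_succ_le hn)
      obtain ⟨k, rfl⟩ : ∃ k : Fin N, n = k.1 := ⟨⟨n, hn⟩, rfl⟩
      rw [hw k]
      constructor
      · intro q hq
        rcases IsStagePos.of_succ k hq with rfl | ⟨h3, h4⟩
        -- The new positive root `-δ_k` acts by one more factor `f_{δ_k}`, completing the vanishing
        -- power of exponent `p̄`.
        · rw [← Module.End.mul_apply, Prod.fst_swap, Prod.snd_swap, ← pow_succ', ← hb,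
            pbar_eq_trunc, trunc_sub_comm, H.pow _ _ (δ k).2.ne']
          rfl
        · exact H.killed_pow hδ k h1 _ q h3 h4
      · intro t
        rw [H.diag_pow (δ k).1.1 (δ k).1.2 h2, stageWeight_succ]
  refine ⟨w N, (reverse_prod_ofFn_apply _ w hw).symm,
    fun i j hij => (main N le_rfl).1 (i, j) (isStagePos_last hij), (main N le_rfl).2, ?_⟩
  refine prod_ofFn_apply _ w _ fun k => ?_
  obtain ⟨h1, h2⟩ := main k k.2.le
  rw [hw]
  exact H.rankOne hp (δ k).2.ne h2 (h1 _ (Or.inr ⟨k, le_rfl, rfl⟩))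

end Chain

/-! ### Cyclic modules of maximal dimension. -/

section Cyclic

variable {F : Type*} {Γ : Type*} [Field F] [AddCommGroup Γ] {m N : ℕ}
  {V : Type*} [AddCommGroup V] [Module F V] {p : ℕ} {ε : Bicharacter Γ F} {d : Fin m → Γ}
  {E : Fin m → Fin m → Module.End F V} {δ : Fin N ≃ PosRoot m}

theorem truncProd_eq_prod_pbar (p : ℕ) (ε : Bicharacter Γ F) (d : Fin m → Γ)
    (δ : Fin N ≃ PosRoot m) : truncProd p ε d = ∏ k, pbar p ε d (δ k).1 := by
  rw [truncProd, Finset.prod_comm, δ.prod_comp fun q : PosRoot m => pbar p ε d q.1,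
    ← Fintype.prod_prod_type' fun i j : Fin m => if i < j then trunc p ε (d i - d j) else 1,
    ← Finset.prod_filter]
  exact Finset.prod_subtype _ (by simp) _

/-- A cyclic vector generating `V` under the `E i j`. -/
def IsCyclicVec (E : Fin m → Fin m → Module.End F V) (v : V) : Prop :=
  ∀ P : Submodule F V, v ∈ P → (∀ i j, ∀ s ∈ P, E i j s ∈ P) → P = ⊤

theorem IsGLFamily.oreSpan_eq_top (hp : 0 < p) (H : IsGLFamily p ε d E) (hδ : IsFPOrder δ) {v : V}
    {r : Fin m → F} (hup : ∀ i j, i < j → E i j v = 0) (hdiag : ∀ t, E t t v = r t • v)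
    (hgen : IsCyclicVec E v) :
    oreSpan (fun k => E (δ k).1.2 (δ k).1.1) (fun k => pbar p ε d (δ k).1) v = ⊤ := by
  refine iSup_wordSpan_eq_top H (η := fun i => (i.1 : ℤ)) (V₀ := Submodule.span F {v})
    (fun i j h => Fin.ext (by simpa using h)) ?_ ?_ ?_ _ ?_ ?_
  · intro i j hij w hw
    obtain ⟨c, rfl⟩ := Submodule.mem_span_singleton.1 hw
    rw [map_smul, hup i j (Fin.lt_def.2 (by exact_mod_cast hij)), smul_zero]
  · intro i w hw
    obtain ⟨c, rfl⟩ := Submodule.mem_span_singleton.1 hw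
    rw [map_smul, hdiag]
    exact Submodule.smul_mem _ _ (Submodule.smul_mem _ _ (Submodule.mem_span_singleton_self v))
  · exact fun P hP => hgen P (hP (Submodule.mem_span_singleton_self v))
  · rw [Submodule.span_singleton_le_iff_mem]
    exact mem_oreSpan _ (fun k => pbar_pos hp ε d _) v
  · intro i j hij t ht
    have hij' : j < i := Fin.lt_def.2 (by exact_mod_cast hij)
    have := oreSpan_stable (H.ore_lower hδ) v (δ.symm ⟨(j, i), hij'⟩) t ht
    simpa using this

theorem IsGLFamily.finrank_le (hp : 0 < p) (H : IsGLFamily p ε d E) (hδ : IsFPOrder δ) {v : V}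
    {r : Fin m → F} (hup : ∀ i j, i < j → E i j v = 0) (hdiag : ∀ t, E t t v = r t • v)
    (hgen : IsCyclicVec E v) :
    FiniteDimensional F V ∧ Module.finrank F V ≤ ∏ k, pbar p ε d (δ k).1 := by
  have h := H.oreSpan_eq_top hp hδ hup hdiag hgen
  have h1 := finrank_oreSpan_le (fun k => E (δ k).1.2 (δ k).1.1) (fun k => pbar p ε d (δ k).1) v
  have h2 := finiteDimensional_oreSpan (fun k => E (δ k).1.2 (δ k).1.1)
    (fun k => pbar p ε d (δ k).1) v
  rw [h] at h1 h2
  rw [finrank_top] at h1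
  exact ⟨Module.Finite.of_surjective (⊤ : Submodule F V).subtype fun x => ⟨⟨x, trivial⟩, rfl⟩, h1⟩

theorem IsGLFamily.mem_span_of_killed (hp : 0 < p) (H : IsGLFamily p ε d E) (hδ : IsFPOrder δ)
    {v : V} {r : Fin m → F} (hup : ∀ i j, i < j → E i j v = 0) (hdiag : ∀ t, E t t v = r t • v)
    (hgen : IsCyclicVec E v) (hfr : Module.finrank F V = ∏ k, pbar p ε d (δ k).1) {z : V}
    (hz : ∀ k, E (δ k).1.2 (δ k).1.1 z = 0) :
    z ∈ Submodule.span F {(List.ofFn fun k =>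
      E (δ k).1.2 (δ k).1.1 ^ (pbar p ε d (δ k).1 - 1)).reverse.prod v} := by
  have h := H.oreSpan_eq_top hp hδ hup hdiag hgen
  refine mem_span_top_of_killed (H.ore_lower hδ) (fun k => pbar_pos hp ε d _) v ?_ z ?_ hz
  · rw [h, finrank_top, hfr]
  · rw [h]
    trivial

/-- A nonzero stable subspace contains a nonzero vector killed by all lowering operators, and
maximality of the dimension makes such a vector a multiple of the end of the chain. -/
theorem IsGLFamily.exists_lowest_mem (hp : 0 < p) (H : IsGLFamily p ε d E) (hδ : IsFPOrder δ)
    {v : V} {r : Fin m → F} (hup : ∀ i j, i < j → E i j v = 0) (hdiag : ∀ t, E t t v = r t • v)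
    (hgen : IsCyclicVec E v) (hfr : Module.finrank F V = ∏ k, pbar p ε d (δ k).1)
    {P : Submodule F V} (hP : P ≠ ⊥) (hs : ∀ i j, ∀ z ∈ P, E i j z ∈ P) :
    (List.ofFn fun k => E (δ k).1.2 (δ k).1.1 ^ (pbar p ε d (δ k).1 - 1)).reverse.prod v ∈ P ∧
    (List.ofFn fun k => E (δ k).1.2 (δ k).1.1 ^ (pbar p ε d (δ k).1 - 1)).reverse.prod v ≠ 0 := by
  obtain ⟨z, hz, hz0, hk⟩ := exists_killed (H.ore_lower hδ) P hP fun j => hs _ _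
  obtain ⟨c, rfl⟩ := Submodule.mem_span_singleton.1
    (H.mem_span_of_killed hp hδ hup hdiag hgen hfr hk)
  have hc : c ≠ 0 := fun h => hz0 (by rw [h, zero_smul])
  exact ⟨(Submodule.smul_mem_iff _ hc).1 hz, fun h => hz0 (by rw [h, smul_zero])⟩

/-- When a lowest weight vector generates, the ordered raising monomials applied to it span. There
are exactly `dim V` of them, so they form a basis and the top one cannot vanish. -/
theorem IsGLFamily.top_apply_ne_zero (hp : 0 < p) (H : IsGLFamily p ε d E) (hδ : IsFPOrder δ)
    {u : V} {r : Fin m → F} (hlow : ∀ i j, j < i → E i j u = 0) (hdiag : ∀ t, E t t u = r t • u)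
    (hgen : IsCyclicVec E u) (hfr : Module.finrank F V = ∏ k, pbar p ε d (δ k).1)
    [FiniteDimensional F V] :
    (List.ofFn fun k => E (δ k).1.1 (δ k).1.2 ^ (pbar p ε d (δ k).1 - 1)).prod u ≠ 0 := by
  have h := H.ore_upper hδ
  have hpos : ∀ k, 0 < pbar p ε d (δ k).1 := fun k => pbar_pos hp ε d _
  have hw : Submodule.span F {t | ∃ l : List (Fin N),
      t = (l.map fun k => E (δ k).1.1 (δ k).1.2).prod u} = ⊤ := by
    -- The height is negated because the roles of raising and lowering are exchanged.
    refine iSup_wordSpan_eq_top H (η := fun i => -(i.1 : ℤ)) (V₀ := Submodule.span F {u})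
      (fun i j h => Fin.ext (by simpa using h)) ?_ ?_ ?_ _ ?_ ?_
    · intro i j hij w hw
      obtain ⟨c, rfl⟩ := Submodule.mem_span_singleton.1 hw
      rw [map_smul, hlow i j (Fin.lt_def.2 (by simpa using hij)), smul_zero]
    · intro i w hw
      obtain ⟨c, rfl⟩ := Submodule.mem_span_singleton.1 hw
      rw [map_smul, hdiag]
      exact Submodule.smul_mem _ _ (Submodule.smul_mem _ _ (Submodule.mem_span_singleton_self u))
    · exact fun P hP => hgen P (hP (Submodule.mem_span_singleton_self u))
    · rw [Submodule.span_singleton_le_iff_mem]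
      exact Submodule.subset_span ⟨[], by simp⟩
    · intro i j hij t ht
      have hij' : i < j := Fin.lt_def.2 (by simpa using hij)
      induction ht using Submodule.span_induction with
      | mem t ht =>
        obtain ⟨l, rfl⟩ := ht
        exact Submodule.subset_span ⟨δ.symm ⟨(i, j), hij'⟩ :: l, by simp⟩
      | zero => simp
      | add s t _ _ hs ht => rw [map_add]; exact Submodule.add_mem _ hs ht
      | smul c t _ ht => rw [map_smul]; exact Submodule.smul_mem _ _ ht
  let B : (∀ k, Fin (pbar p ε d (δ k).1)) → V := fun a =>
    (List.ofFn fun k => E (δ k).1.1 (δ k).1.2 ^ (a k : ℕ)).prod u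
  have hB : ⊤ ≤ Submodule.span F (Set.range B) := by
    rw [← hw, Submodule.span_le]
    rintro _ ⟨l, rfl⟩
    have h1 := prod_pow_mem_orderedSpan h hpos l fun _ => 1
    simp only [pow_one] at h1
    generalize (l.map fun k => E (δ k).1.1 (δ k).1.2).prod = y at h1 ⊢
    induction h1 using Submodule.span_induction with
    | mem t ht =>
      obtain ⟨a, ha, -, rfl⟩ := ht
      exact Submodule.subset_span ⟨fun k => ⟨a k, ha k⟩, rfl⟩
    | zero => simp
    | add s t _ _ hs ht => rw [LinearMap.add_apply]; exact Submodule.add_mem _ hs ht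
    | smul c t _ ht => rw [LinearMap.smul_apply]; exact Submodule.smul_mem _ _ ht
  have hli := linearIndependent_of_top_le_span_of_card_eq_finrank hB (by simp [hfr])
  exact hli.ne_zero fun k => ⟨pbar p ε d (δ k).1 - 1, Nat.sub_lt (hpos k) one_pos⟩

end Cyclic

/-! ### Generators, relations and modules of the reduced enveloping algebra. -/

section Env

variable {F Γ : Type*} [Field F] [AddCommGroup Γ] {m : ℕ} {p : ℕ} {ε : Bicharacter Γ F}
  {deg : Fin m → Γ} {χ : Module.Dual F (Matrix (Fin m) (Fin m) F)}

theorem adjoin_range_sigma (χ : Module.Dual F (Matrix (Fin m) (Fin m) F))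
    (S : RestrictedSubalgebra p ε deg) : Algebra.adjoin F (Set.range (sigma χ S)) = ⊤ := by
  let φ : TensorAlgebra F S.carrier →ₐ[F] ReducedEnv p ε deg χ S :=
    RingQuot.mkAlgHom F (ReducedRel p ε deg χ S)
  have h1 : Set.range (sigma χ S) = φ '' Set.range (TensorAlgebra.ι F) := by
    rw [← Set.range_comp]
    rfl
  rw [h1, ← AlgHom.map_adjoin, TensorAlgebra.adjoin_range_ι, Algebra.map_top,
    AlgHom.range_eq_top]
  exact RingQuot.mkAlgHom_surjective F (ReducedRel p ε deg χ S)

theorem reducedLift_sigma {A : Type*} [Ring A] [Algebra F A] (S : RestrictedSubalgebra p ε deg)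
    (g : S.carrier →ₗ[F] A) (hb) (hp) (x : S.carrier) :
    reducedLift χ S g hb hp (sigma χ S x) = g x := by
  change RingQuot.liftAlgHom F _ (RingQuot.mkAlgHom F _ (TensorAlgebra.ι F x)) = _
  rw [RingQuot.liftAlgHom_mkAlgHom_apply, TensorAlgebra.lift_ι_apply]

theorem envIncl_sigma (S S' : RestrictedSubalgebra p ε deg) (h : S.carrier ≤ S'.carrier)
    (x : S.carrier) :
    envIncl χ S S' h (sigma χ S x) = sigma χ S' (Submodule.inclusion h x) :=
  reducedLift_sigma ..

theorem single_mem_carrier_sum (S : RestrictedSubalgebra p ε deg) (x : S.carrier) :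
    sigma χ (glSub p ε deg) ⟨x.1, trivial⟩ = ∑ i, ∑ j, x.1 i j • envE p ε deg χ i j := by
  have h : (⟨x.1, trivial⟩ : (glSub p ε deg).carrier) =
      ∑ i, ∑ j, x.1 i j • ⟨Matrix.single i j 1, trivial⟩ := by
    apply Subtype.ext
    simp only [AddSubmonoidClass.coe_finsetSum, SetLike.val_smul, Matrix.smul_single, smul_eq_mul,
      mul_one]
    exact Matrix.matrix_eq_sum_single x.1
  rw [h]
  simp only [map_sum, map_smul]
  rfl

theorem sigma_glSub (x : (glSub p ε deg).carrier) :
    sigma χ (glSub p ε deg) x = ∑ i, ∑ j, x.1 i j • envE p ε deg χ i j :=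
  single_mem_carrier_sum (glSub p ε deg) x

theorem mem_of_envE_stable {M : Type*} [AddCommGroup M] [Module F M]
    [Module (ReducedEnv p ε deg χ (glSub p ε deg)) M]
    [IsScalarTower F (ReducedEnv p ε deg χ (glSub p ε deg)) M] (P : Submodule F M)
    (hP : ∀ i j, ∀ s ∈ P, envE p ε deg χ i j • s ∈ P)
    (u : ReducedEnv p ε deg χ (glSub p ε deg)) : ∀ s ∈ P, u • s ∈ P := by
  have hu : u ∈ Algebra.adjoin F (Set.range (sigma χ (glSub p ε deg))) := by
    rw [adjoin_range_sigma]
    trivial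
  induction hu using Algebra.adjoin_induction with
  | mem u hu =>
    obtain ⟨x, rfl⟩ := hu
    intro s hs
    rw [sigma_glSub, Finset.sum_smul]
    refine Submodule.sum_mem _ fun i _ => ?_
    rw [Finset.sum_smul]
    refine Submodule.sum_mem _ fun j _ => ?_
    rw [smul_assoc]
    exact Submodule.smul_mem _ _ (hP i j s hs)
  | algebraMap c => intro s hs; rw [algebraMap_smul]; exact Submodule.smul_mem _ _ hs
  | add a b _ _ ha hb => intro s hs; rw [add_smul]; exact Submodule.add_mem _ (ha s hs) (hb s hs)
  | mul a b _ _ ha hb => intro s hs; rw [mul_smul]; exact ha _ (hb s hs)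

/-- The action of the matrix units on a `u_χ(g)`-module. -/
def envRep (p : ℕ) (ε : Bicharacter Γ F) (deg : Fin m → Γ)
    (χ : Module.Dual F (Matrix (Fin m) (Fin m) F)) (M : Type*) [AddCommGroup M] [Module F M]
    [Module (ReducedEnv p ε deg χ (glSub p ε deg)) M]
    [IsScalarTower F (ReducedEnv p ε deg χ (glSub p ε deg)) M] (i j : Fin m) : Module.End F M :=
  Algebra.lsmul F F M (envE p ε deg χ i j)

theorem isCyclicVec_envRep {M : Type*} [AddCommGroup M] [Module F M]
    [Module (ReducedEnv p ε deg χ (glSub p ε deg)) M]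
    [IsScalarTower F (ReducedEnv p ε deg χ (glSub p ε deg)) M] {v : M}
    (hv : ∀ z : M, ∃ u : ReducedEnv p ε deg χ (glSub p ε deg), z = u • v) :
    IsCyclicVec (envRep p ε deg χ M) v := by
  intro P hP hs
  refine eq_top_iff.2 fun z _ => ?_
  obtain ⟨u, rfl⟩ := hv z
  exact mem_of_envE_stable P hs u v hP

theorem single_pow_of_ne {i j : Fin m} (hij : i ≠ j) {k : ℕ} (hk : 2 ≤ k) :
    (Matrix.single i j (1 : F)) ^ k = 0 := by
  obtain ⟨k, rfl⟩ := Nat.exists_eq_add_of_le hk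
  rw [pow_add, pow_two, Matrix.single_mul_single_of_ne _ _ _ _ hij.symm, zero_mul]

theorem IsStandardSemisimple.apply_single (hχ : IsStandardSemisimple deg χ) {i j : Fin m}
    (hij : i ≠ j) : χ (Matrix.single i j 1) = 0 := by
  rcases lt_or_gt_of_ne hij with h | h
  exacts [hχ.upper i j h, hχ.lower i j h]

theorem IsStandardSemisimple.apply_eq (hχ : IsStandardSemisimple deg χ)
    (x : Matrix (Fin m) (Fin m) F) : χ x = ∑ i, x i i * χ (Matrix.single i i 1) := by
  conv_lhs => rw [Matrix.matrix_eq_sum_single x]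
  simp only [map_sum]
  refine Finset.sum_congr rfl fun i _ => ?_
  have h1 : ∀ j, Matrix.single i j (x i j) = x i j • Matrix.single i j (1 : F) := by simp
  rw [Finset.sum_eq_single i]
  · rw [h1, map_smul, smul_eq_mul]
  · intro j _ hj
    rw [h1, map_smul, hχ.apply_single hj.symm, smul_zero]
  · simp

theorem single_self_pow (i : Fin m) {k : ℕ} (hk : k ≠ 0) :
    (Matrix.single i i (1 : F)) ^ k = Matrix.single i i 1 := by
  have h : IsIdempotentElem (Matrix.single i i (1 : F)) := by
    rw [IsIdempotentElem, Matrix.single_mul_single_same, mul_one]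
  obtain ⟨n, rfl⟩ := Nat.exists_eq_succ_of_ne_zero hk
  exact h.pow_succ_eq n

/-- Even root vectors are nilpotent because `χ` and the matrix `p`-th power both vanish on them. For
odd ones the color bracket of `e_{ij}` with itself is `2 e_{ij}^2` and equals `0`, which suffices
since `p ≠ 2`. -/
theorem isGLFamily_envE [Fact p.Prime] [CharP F p] (hp : p ≠ 2) (ε : Bicharacter Γ F)
    (hχ : IsStandardSemisimple deg χ) : IsGLFamily p ε deg (envE p ε deg χ) := by
  have hrel : ∀ i j k l, cbr (ε.toFun (deg i - deg j) (deg k - deg l) : F)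
      (envE p ε deg χ i j) (envE p ε deg χ k l) =
        (if j = k then envE p ε deg χ i l else 0) -
      (ε.toFun (deg i - deg j) (deg k - deg l) : F) • (if l = i then envE p ε deg χ k j else 0) := by
    intro i j k l
    refine (sigma_bracket χ (glSub p ε deg) (deg i - deg j) (deg k - deg l)
      ⟨Matrix.single i j 1, trivial⟩ ⟨Matrix.single k l 1, trivial⟩
      ((if j = k then ⟨Matrix.single i l 1, trivial⟩ else 0) -
        (ε.toFun (deg i - deg j) (deg k - deg l) : F) •
          (if l = i then ⟨Matrix.single k j 1, trivial⟩ else 0))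
      (single_mem_glDegree_of_eq rfl 1) (single_mem_glDegree_of_eq rfl 1) ?_).trans ?_
    · refine Eq.trans ?_ (cbr_single _ i j k l).symm
      split_ifs <;> simp
    · rw [map_sub, map_smul]
      split_ifs <;> simp [envE]
  refine ⟨hrel, fun i j hij => ?_⟩
  have hp0 := (Fact.out : p.Prime)
  rcases trunc_cases p ε (deg i - deg j) with ⟨h, h'⟩ | ⟨h, h'⟩
  · rw [h']
    have h1 := sigma_pow χ (glSub p ε deg) (deg i - deg j) ⟨Matrix.single i j 1, trivial⟩ 0 h
      (single_mem_glDegree_of_eq rfl 1) (single_pow_of_ne hij hp0.two_le).symm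
    rw [map_zero, sub_zero, hχ.apply_single hij, zero_pow hp0.ne_zero, map_zero] at h1
    exact h1
  · rw [h', pow_two]
    have h1 := hrel i j i j
    rw [h, if_neg hij.symm, cbr, neg_smul, one_smul, sub_neg_eq_add, smul_zero,
      sub_zero, ← two_smul F] at h1
    refine (smul_eq_zero.1 h1).resolve_left ?_
    have := Ring.two_ne_zero (R := F) (by rwa [ringChar.eq F p])
    exact this

theorem isGLFamily_envRep [Fact p.Prime] [CharP F p] (hp : p ≠ 2) (ε : Bicharacter Γ F)
    (hχ : IsStandardSemisimple deg χ) (M : Type*) [AddCommGroup M] [Module F M]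
    [Module (ReducedEnv p ε deg χ (glSub p ε deg)) M]
    [IsScalarTower F (ReducedEnv p ε deg χ (glSub p ε deg)) M] :
    IsGLFamily p ε deg (envRep p ε deg χ M) :=
  (isGLFamily_envE hp ε hχ).map (Algebra.lsmul F F M)

/-- The action of `u_χ(g)` on a highest weight representation with `p`-character `χ`. -/
def HighestWeightRep.envHom [Fact p.Prime] [CharP F p] (hχ : IsStandardSemisimple deg χ)
    {r : Fin m → F} {W : Type*} [AddCommGroup W] [Module F W]
    (R : HighestWeightRep p ε deg r (fun i => χ (Matrix.single i i 1) ^ p) W) :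
    ReducedEnv p ε deg χ (glSub p ε deg) →ₐ[F] Module.End F W :=
  reducedLift χ (glSub p ε deg) (R.L ∘ₗ (glSub p ε deg).carrier.subtype)
    (fun α β x y z hx hy hz => (R.rep α β x.1 y.1 hx hy).trans (by
      change _ = R.L z.1
      rw [hz]
      rfl))
    (fun α x z hα hx hz => by
      change R.L x.1 ^ p - R.L z.1 = _
      rw [hz, R.rep.pow _ _ R.pow_off R.pow_diag hα hx, hχ.apply_eq x.1, sum_pow_char]
      simp only [mul_pow])

theorem HighestWeightRep.envHom_envE [Fact p.Prime] [CharP F p] (hχ : IsStandardSemisimple deg χ)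
    {r : Fin m → F} {W : Type*} [AddCommGroup W] [Module F W]
    (R : HighestWeightRep p ε deg r (fun i => χ (Matrix.single i i 1) ^ p) W) (i j : Fin m) :
    R.envHom hχ (envE p ε deg χ i j) = R.L (Matrix.single i j 1) :=
  reducedLift_sigma ..

end Env

/-! ### Baby Verma modules and their dimension. -/

section Verma

variable {F : Type u} {Γ : Type*} [Field F] [AddCommGroup Γ] {m : ℕ} {p : ℕ} {ε : Bicharacter Γ F}
  {deg : Fin m → Γ} {χ : Module.Dual F (Matrix (Fin m) (Fin m) F)}

/-- `e_{ii}` as an element of `H`. -/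
def diagUnit (F : Type*) [Field F] {m : ℕ} (i : Fin m) : diagMat F m :=
  ⟨Matrix.single i i 1, fun a b hab => by
    rw [Matrix.single_apply, if_neg]
    rintro ⟨rfl, rfl⟩
    exact hab rfl⟩

theorem diagMat_eq_sum (h : diagMat F m) : h = ∑ i, h.1 i i • diagUnit F i := by
  apply Subtype.ext
  simp only [AddSubmonoidClass.coe_finsetSum, SetLike.val_smul, diagUnit, Matrix.smul_single,
    smul_eq_mul, mul_one]
  conv_lhs => rw [Matrix.matrix_eq_sum_single h.1]
  refine Finset.sum_congr rfl fun i _ => Finset.sum_eq_single i (fun j _ hj => ?_) (by simp)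
  rw [h.2 i j hj.symm, Matrix.single_zero]

theorem dual_diagMat_apply (l : Module.Dual F (diagMat F m)) (h : diagMat F m) :
    l h = ∑ i, h.1 i i * l (diagUnit F i) := by
  conv_lhs => rw [diagMat_eq_sum h]
  simp only [map_sum, map_smul, smul_eq_mul]

theorem IsWeight.apply_diagUnit (hp : p ≠ 0) {l : Module.Dual F (diagMat F m)}
    (hl : IsWeight p χ l) (i : Fin m) :
    l (diagUnit F i) ^ p - l (diagUnit F i) = χ (Matrix.single i i 1) ^ p :=
  hl _ _ (single_self_pow i hp).symm

/-- The weight with values `r i` at `e_{ii}`. -/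
def weightOf (r : Fin m → F) : Module.Dual F (diagMat F m) where
  toFun h := ∑ i, h.1 i i * r i
  map_add' x y := by simp [add_mul, Finset.sum_add_distrib]
  map_smul' c x := by simp [mul_assoc, Finset.mul_sum]

theorem weightOf_diagUnit (r : Fin m → F) (i : Fin m) : weightOf r (diagUnit F i) = r i := by
  change ∑ j, Matrix.single i i (1 : F) j j * r j = r i
  rw [Finset.sum_eq_single i]
  · simp
  · intro j _ hj
    rw [Matrix.single_apply, if_neg fun h => hj h.1.symm, zero_mul]
  · simp

theorem isWeight_weightOf [Fact p.Prime] [CharP F p] (hχ : IsStandardSemisimple deg χ)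
    {r : Fin m → F} (hr : ∀ i, r i ^ p - r i = χ (Matrix.single i i 1) ^ p) :
    IsWeight p χ (weightOf r) := by
  intro h h' hh
  have h1 : ∀ i, h'.1 i i = h.1 i i ^ p := fun i => by
    rw [hh, upperTri_pow_diag (fun a b hab => h.2 a b hab.ne')]
  change (∑ i, h.1 i i * r i) ^ p - ∑ i, h'.1 i i * r i = _
  rw [hχ.apply_eq h.1, sum_pow_char, sum_pow_char, ← Finset.sum_sub_distrib]
  refine Finset.sum_congr rfl fun i _ => ?_
  rw [h1, mul_pow, mul_pow, ← hr]
  ring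

/-- The values at the `e_{ii}` are chosen as roots of the Artin–Schreier equations `a^p - a =
χ(e_{ii})^p`. -/
theorem exists_isWeight [IsAlgClosed F] [Fact p.Prime] [CharP F p]
    (hχ : IsStandardSemisimple deg χ) :
    ∃ l : Module.Dual F (diagMat F m), IsWeight p χ l := by
  have h : ∀ i : Fin m, ∃ a : F, a ^ p - a = χ (Matrix.single i i 1) ^ p := by
    intro i
    have hp := (Fact.out : p.Prime).one_lt
    have h1 : (Polynomial.X ^ p - Polynomial.X - Polynomial.C (χ (Matrix.single i i 1) ^ p) :
        Polynomial F).degree = (p : WithBot ℕ) := by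
      rw [sub_sub, Polynomial.degree_sub_eq_left_of_degree_lt, Polynomial.degree_X_pow]
      rw [Polynomial.degree_X_pow, Polynomial.degree_X_add_C]
      exact_mod_cast hp
    obtain ⟨a, ha⟩ := IsAlgClosed.exists_root _ (by
      rw [h1]
      exact_mod_cast (zero_lt_one.trans hp).ne' : (Polynomial.X ^ p - Polynomial.X -
        Polynomial.C (χ (Matrix.single i i 1) ^ p) : Polynomial F).degree ≠ 0)
    refine ⟨a, sub_eq_zero.1 ?_⟩
    simpa using ha
  choose r hr using h
  exact ⟨_, isWeight_weightOf hχ hr⟩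

theorem diagPart_single_of_ne {i j : Fin m} (hij : i ≠ j) (h : Matrix.single i j 1 ∈ upperTri F m) :
    diagPart F m ⟨Matrix.single i j 1, h⟩ = 0 := by
  apply Subtype.ext
  have : (fun a => Matrix.single i j (1 : F) a a) = 0 := by
    funext a
    rw [Matrix.single_apply, if_neg]
    · rfl
    · rintro ⟨rfl, rfl⟩
      exact hij rfl
  change Matrix.diagonal (fun a => Matrix.single i j (1 : F) a a) = 0
  rw [this, Matrix.diagonal_zero']

theorem diagPart_of_mem (x : upperTri F m) (hx : x.1 ∈ diagMat F m) :
    diagPart F m x = ⟨x.1, hx⟩ := by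
  apply Subtype.ext
  ext i j
  by_cases h : i = j
  · subst h
    simp [diagPart]
  · simp [diagPart, h, hx i j h]

variable (hχ : IsStandardSemisimple deg χ) {l : Module.Dual F (diagMat F m)} (hl : IsWeight p χ l)

theorem borelChar_sigma (x : (borel p ε deg).carrier) :
    borelChar (ε := ε) hχ hl (sigma χ (borel p ε deg) x) = l (diagPart F m x) :=
  reducedLift_sigma ..

theorem evalWeight_sigma (x : (torus p ε deg).carrier) :
    evalWeight ε hχ hl (sigma χ (torus p ε deg) x) = l x := by
  rw [evalWeight, AlgHom.comp_apply, envIncl_sigma, borelChar_sigma]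
  exact congrArg l (diagPart_of_mem _ x.2)

/-- The generator of the baby Verma module. -/
def vermaVec (ε : Bicharacter Γ F) : BabyVerma ε hχ hl := Submodule.Quotient.mk (1 ⊗ₜ 1)

theorem exists_smul_vermaVec (z : BabyVerma ε hχ hl) :
    ∃ u : ReducedEnv p ε deg χ (glSub p ε deg), z = u • vermaVec hχ hl ε := by
  obtain ⟨t, rfl⟩ := Submodule.Quotient.mk_surjective _ z
  induction t using TensorProduct.induction_on with
  | zero => exact ⟨0, by simp⟩
  | tmul u c =>
    refine ⟨c • u, ?_⟩
    rw [vermaVec, ← Submodule.Quotient.mk_smul, TensorProduct.smul_tmul', smul_eq_mul, mul_one,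
      TensorProduct.smul_tmul, smul_eq_mul, mul_one]
  | add s t hs ht =>
    obtain ⟨a, ha⟩ := hs
    obtain ⟨b, hb⟩ := ht
    exact ⟨a + b, by rw [add_smul, ← ha, ← hb, Submodule.Quotient.mk_add]⟩

theorem envIncl_borel_smul_vermaVec (b : ReducedEnv p ε deg χ (borel p ε deg)) :
    envIncl χ (borel p ε deg) (glSub p ε deg) le_top b • vermaVec hχ hl ε =
      borelChar hχ hl b • vermaVec hχ hl ε := by
  refine (Submodule.Quotient.eq _).2 (Submodule.subset_span ⟨1, b, 1, ?_⟩)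
  rw [one_mul]
  refine congrArg₂ (· - ·) ?_ (TensorProduct.tmul_smul (borelChar hχ hl b) 1 1).symm
  beta_reduce
  rw [TensorProduct.smul_tmul', smul_eq_mul, mul_one]

theorem envIncl_torus_smul_vermaVec (w : ReducedEnv p ε deg χ (torus p ε deg)) :
    envIncl χ (torus p ε deg) (glSub p ε deg) le_top w • vermaVec hχ hl ε =
      evalWeight ε hχ hl w • vermaVec hχ hl ε := by
  have h : envIncl χ (torus p ε deg) (glSub p ε deg) le_top =
      (envIncl χ (borel p ε deg) (glSub p ε deg) le_top).comp
        (envIncl χ (torus p ε deg) (borel p ε deg) (torus_le_borel p ε deg)) := by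
    have h1 := adjoin_range_sigma χ (torus p ε deg)
    refine AlgHom.ext_of_adjoin_eq_top h1 ?_
    rintro _ ⟨x, rfl⟩
    rw [AlgHom.comp_apply, envIncl_sigma, envIncl_sigma, envIncl_sigma]
    rfl
  rw [h, AlgHom.comp_apply, envIncl_borel_smul_vermaVec]
  rfl

theorem single_mem_upperTri {i j : Fin m} (h : i ≤ j) (c : F) :
    Matrix.single i j c ∈ upperTri F m := by
  intro a b hab
  rw [Matrix.single_apply, if_neg]
  rintro ⟨rfl, rfl⟩
  exact absurd hab (not_lt.2 h)

theorem envE_smul_vermaVec {i j : Fin m} (hij : i < j) :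
    envE p ε deg χ i j • vermaVec hχ hl ε = 0 := by
  have h := envIncl_borel_smul_vermaVec (ε := ε) hχ hl
    (sigma χ (borel p ε deg) ⟨Matrix.single i j 1, single_mem_upperTri hij.le 1⟩)
  rw [envIncl_sigma, borelChar_sigma, diagPart_single_of_ne hij.ne, map_zero, zero_smul] at h
  exact h

theorem envE_diag_smul_vermaVec (i : Fin m) :
    envE p ε deg χ i i • vermaVec hχ hl ε = l (diagUnit F i) • vermaVec hχ hl ε := by
  have h := envIncl_torus_smul_vermaVec (ε := ε) hχ hl (sigma χ (torus p ε deg) (diagUnit F i))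
  rw [envIncl_sigma, evalWeight_sigma] at h
  exact h

theorem envHom_borel [Fact p.Prime] [CharP F p] {W : Type*} [AddCommGroup W] [Module F W]
    (R : HighestWeightRep p ε deg (fun i => l (diagUnit F i))
      (fun i => χ (Matrix.single i i 1) ^ p) W) (b : ReducedEnv p ε deg χ (borel p ε deg)) :
    R.envHom hχ (envIncl χ (borel p ε deg) (glSub p ε deg) le_top b) R.w =
      borelChar hχ hl b • R.w := by
  have hb : b ∈ Algebra.adjoin F (Set.range (sigma χ (borel p ε deg))) := by
    rw [adjoin_range_sigma]
    trivial
  induction hb using Algebra.adjoin_induction with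
  | mem b hb =>
    obtain ⟨x, rfl⟩ := hb
    rw [envIncl_sigma, borelChar_sigma, dual_diagMat_apply]
    change R.envHom hχ (sigma χ (glSub p ε deg) ⟨x.1, trivial⟩) R.w = _
    rw [single_mem_carrier_sum]
    simp only [map_sum, map_smul, LinearMap.sum_apply, LinearMap.smul_apply, R.envHom_envE,
      Finset.sum_smul]
    refine Finset.sum_congr rfl fun i _ => ?_
    rw [Finset.sum_eq_single i, R.diag, smul_smul]
    · simp [diagPart]
    · intro j _ hj
      rcases lt_or_gt_of_ne hj with h | h
      · rw [x.2 i j h, zero_smul]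
      · rw [R.upper i j h, smul_zero]
    · simp
  | algebraMap c => simp [Algebra.algebraMap_eq_smul_one]
  | add a b _ _ ha hb => simp only [map_add, LinearMap.add_apply, ha, hb, add_smul]
  | mul a b _ _ ha hb =>
    rw [map_mul, map_mul, map_mul, Module.End.mul_apply, hb, map_smul, ha, smul_smul, mul_comm]

/-- The universal property of induction: `u ⊗ c ↦ c u w` respects the balancing relations because
`u_χ(B)` acts on the highest weight vector through its character, and it is onto because that vector
generates. -/
theorem exists_surjective_babyVerma [Fact p.Prime] [CharP F p] {W : Type*} [AddCommGroup W]
    [Module F W] (R : HighestWeightRep p ε deg (fun i => l (diagUnit F i))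
      (fun i => χ (Matrix.single i i 1) ^ p) W) :
    ∃ g : BabyVerma ε hχ hl →ₗ[F] W, Function.Surjective g := by
  let f : (ReducedEnv p ε deg χ (glSub p ε deg) ⊗[F] F) →ₗ[F] W :=
    TensorProduct.lift ((LinearMap.lsmul F W).flip ∘ₗ LinearMap.applyₗ R.w ∘ₗ
      (R.envHom hχ).toLinearMap)
  have hf : ∀ u c, f (u ⊗ₜ c) = c • R.envHom hχ u R.w := fun u c => rfl
  have hfu : ∀ u t, f (u • t) = R.envHom hχ u (f t) := by
    intro u t
    induction t using TensorProduct.induction_on with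
    | zero => simp
    | tmul a c =>
      rw [TensorProduct.smul_tmul', hf, hf, smul_eq_mul, map_mul, map_smul, Module.End.mul_apply]
    | add s t hs ht => rw [smul_add, map_add, map_add, map_add, hs, ht]
  have hk : ∀ t ∈ balanced (envIncl χ (borel p ε deg) (glSub p ε deg) le_top)
      ((Algebra.lmul F F).comp (borelChar (ε := ε) hχ hl)), f t = 0 := by
    intro t ht
    induction ht using Submodule.span_induction with
    | mem t ht =>
      obtain ⟨u, a, x, rfl⟩ := ht
      rw [map_sub, hf, hf, map_mul, Module.End.mul_apply, envHom_borel hχ hl, map_smul, smul_smul,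
        sub_eq_zero, mul_comm]
      rfl
    | zero => simp
    | add s t _ _ hs ht => rw [map_add, hs, ht, add_zero]
    | smul u t _ ht => rw [hfu, ht, map_zero]
  let g : BabyVerma ε hχ hl →ₗ[F] W :=
    ((balanced (envIncl χ (borel p ε deg) (glSub p ε deg) le_top)
      ((Algebra.lmul F F).comp (borelChar (ε := ε) hχ hl))).restrictScalars F).liftQ f hk ∘ₗ
      (Submodule.Quotient.restrictScalarsEquiv F _).symm.toLinearMap
  have hg : ∀ t, g (Submodule.Quotient.mk t) = f t := fun t => rfl
  have hgu : ∀ u z, g (u • z) = R.envHom hχ u (g z) := by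
    intro u z
    obtain ⟨t, rfl⟩ := Submodule.Quotient.mk_surjective _ z
    rw [← Submodule.Quotient.mk_smul, hg, hg, hfu]
  refine ⟨g, LinearMap.range_eq_top.1 (R.generated _ ⟨vermaVec hχ hl ε, ?_⟩ ?_)⟩
  · rw [vermaVec, hg, hf, one_smul, map_one]
    rfl
  · rintro i j _ ⟨z, rfl⟩
    exact ⟨envE p ε deg χ i j • z, by rw [hgu, R.envHom_envE]⟩

variable {N : ℕ} {δ : Fin N ≃ PosRoot m}

/-- Straightening bounds the dimension from above; the surjection onto the explicit model bounds it
from below. -/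
theorem finrank_babyVerma [Fact p.Prime] [CharP F p] (hp : 3 ≤ p) (ε : Bicharacter Γ F)
    (hδ : IsFPOrder δ) : FiniteDimensional F (BabyVerma ε hχ hl) ∧
      Module.finrank F (BabyVerma ε hχ hl) = ∏ k, pbar p ε deg (δ k).1 := by
  obtain ⟨h1, h2⟩ := (isGLFamily_envRep (by omega) ε hχ (BabyVerma ε hχ hl)).finrank_le
    (by omega) hδ (fun i j hij => envE_smul_vermaVec hχ hl hij)
    (envE_diag_smul_vermaVec (ε := ε) hχ hl) (isCyclicVec_envRep (exists_smul_vermaVec hχ hl))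
  obtain ⟨W, _, _, R, hfd, hfr⟩ := exists_highestWeightRep p hp ε m deg
    (fun i => l (diagUnit F i)) (fun i => χ (Matrix.single i i 1) ^ p)
    (hl.apply_diagUnit (by omega))
  obtain ⟨g, hg⟩ := exists_surjective_babyVerma hχ hl R
  refine ⟨h1, le_antisymm h2 ?_⟩
  rw [← truncProd_eq_prod_pbar, ← hfr]
  exact LinearMap.finrank_le_finrank_of_surjective hg

end Verma

/-! ### Characters separate a commutative algebra generated by elements with simple spectrum. -/

section Separation

variable {F : Type*} [Field F]

open Polynomial in
theorem X_sub_C_mul_lagrange_basis {s : Finset ℕ} (v : ℕ → F) {t : ℕ} (ht : t ∈ s) :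
    ∃ c : F, (X - C (v t)) * Lagrange.basis s v t = C c * ∏ j ∈ s, (X - C (v j)) := by
  refine ⟨∏ j ∈ s.erase t, (v t - v j)⁻¹, ?_⟩
  have h : Lagrange.basis s v t =
      C (∏ j ∈ s.erase t, (v t - v j)⁻¹) * ∏ j ∈ s.erase t, (X - C (v j)) := by
    rw [map_prod, ← Finset.prod_mul_distrib]
    rfl
  rw [h, mul_left_comm, Finset.mul_prod_erase s (fun j => X - C (v j)) ht]

/-- A commutative algebra generated by elements with simple spectrum is separated by its characters
with values in the spectra. -/
theorem eq_zero_of_forall_character {R : Type*} [CommRing R] [Algebra F R] {ι : Type*} [Fintype ι]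
    {h : ι → R} (hgen : Algebra.adjoin F (Set.range h) = ⊤) {s : Finset ℕ} (hs : s.Nonempty)
    {v : ι → ℕ → F} (hv : ∀ i, Set.InjOn (v i) s)
    (hh : ∀ i, ∏ t ∈ s, (h i - algebraMap F R (v i t)) = 0) {w : R}
    (hw : ∀ r : ι → F, (∀ i, ∃ t ∈ s, r i = v i t) → ∃ φ : R →ₐ[F] F,
      (∀ i, φ (h i) = r i) ∧ φ w = 0) : w = 0 := by
  classical
  -- Lagrange polynomials in `h i` give its spectral projections: they sum to `1`, and `h i` acts on
  -- each by the corresponding eigenvalue.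
  let P : ι → ℕ → R := fun i t => Polynomial.aeval (h i) (Lagrange.basis s (v i) t)
  have hP1 : ∀ i, ∑ t ∈ s, P i t = 1 := fun i => by
    rw [← map_sum, Lagrange.sum_basis (hv i) hs, map_one]
  have hP2 : ∀ i, ∀ t ∈ s, h i * P i t = algebraMap F R (v i t) * P i t := by
    intro i t ht
    obtain ⟨c, hc⟩ := X_sub_C_mul_lagrange_basis (v i) ht
    have h1 := congrArg (Polynomial.aeval (h i)) hc
    rw [map_mul, map_mul, map_prod] at h1
    simp only [map_sub, Polynomial.aeval_X, Polynomial.aeval_C] at h1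
    rw [hh, mul_zero, sub_mul, sub_eq_zero] at h1
    exact h1
  have h1 : w = ∑ a ∈ Fintype.piFinset fun _ : ι => s, w * ∏ i, P i (a i) := by
    rw [← Finset.mul_sum, ← Finset.prod_univ_sum]
    simp only [hP1, Finset.prod_const_one, mul_one]
  rw [h1]
  refine Finset.sum_eq_zero fun a ha => ?_
  rw [Fintype.mem_piFinset] at ha
  obtain ⟨φ, hφ, hφw⟩ := hw (fun i => v i (a i)) fun i => ⟨a i, ha i, rfl⟩
  -- On a joint projection every generator acts by its value under `φ`, hence so does the whole
  -- algebra.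
  have h2 : ∀ x : R, x * ∏ i, P i (a i) = algebraMap F R (φ x) * ∏ i, P i (a i) := by
    intro x
    have hx : x ∈ Algebra.adjoin F (Set.range h) := by
      rw [hgen]
      trivial
    induction hx using Algebra.adjoin_induction with
    | mem x hx =>
      obtain ⟨i, rfl⟩ := hx
      rw [hφ, ← Finset.mul_prod_erase _ _ (Finset.mem_univ i), ← mul_assoc, ← mul_assoc,
        hP2 i _ (ha i)]
    | algebraMap c => simp
    | add x y _ _ hx hy => rw [add_mul, hx, hy, map_add, map_add, add_mul]
    | mul x y _ _ hx hy => rw [mul_assoc, hy, mul_left_comm, hx, map_mul, map_mul]; ring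
  rw [h2, hφw, map_zero, zero_mul]

end Separation

/-! ### The commutative algebra `u_χ(H)` and its weights. -/

section Torus

variable {F : Type u} {Γ : Type*} [Field F] [AddCommGroup Γ] {m : ℕ} {p : ℕ} {ε : Bicharacter Γ F}
  {deg : Fin m → Γ} {χ : Module.Dual F (Matrix (Fin m) (Fin m) F)}

theorem diagMat_comm {x y : Matrix (Fin m) (Fin m) F} (hx : x ∈ diagMat F m)
    (hy : y ∈ diagMat F m) : x * y = y * x := by
  have h : ∀ z ∈ diagMat F m, z = Matrix.diagonal fun i => z i i := by
    intro z hz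
    ext i j
    by_cases hij : i = j
    · subst hij
      simp
    · rw [hz i j hij, Matrix.diagonal_apply_ne _ hij]
  rw [h x hx, h y hy, Matrix.diagonal_mul_diagonal, Matrix.diagonal_mul_diagonal]
  congr 1
  funext i
  exact mul_comm _ _

theorem diagMat_le_glDegree (deg : Fin m → Γ) : diagMat F m ≤ glDegree F deg 0 := by
  intro x hx i j hij
  refine hx i j ?_
  rintro rfl
  exact hij (sub_self _)

theorem sigma_torus_comm (x y : (torus p ε deg).carrier) :
    sigma χ (torus p ε deg) x * sigma χ (torus p ε deg) y =
      sigma χ (torus p ε deg) y * sigma χ (torus p ε deg) x := by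
  have h := sigma_bracket χ (torus p ε deg) 0 0 x y 0 (diagMat_le_glDegree deg x.2)
    (diagMat_le_glDegree deg y.2) (by
      rw [bichar_zero_left, Units.val_one, one_smul, diagMat_comm x.2 y.2, sub_self]
      rfl)
  rw [bichar_zero_left, Units.val_one, one_smul, map_zero] at h
  exact sub_eq_zero.1 h

theorem torus_mul_comm (a b : ReducedEnv p ε deg χ (torus p ε deg)) : a * b = b * a := by
  have h : ∀ x : ReducedEnv p ε deg χ (torus p ε deg),
      x ∈ Algebra.adjoin F (Set.range (sigma χ (torus p ε deg))) := fun x => by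
    rw [adjoin_range_sigma]
    trivial
  refine Algebra.commute_of_mem_adjoin_of_forall_mem_commute (h b) ?_
  rintro _ ⟨y, rfl⟩
  refine (Algebra.commute_of_mem_adjoin_of_forall_mem_commute (h a) ?_).symm
  rintro _ ⟨x, rfl⟩
  exact sigma_torus_comm y x

instance : CommRing (ReducedEnv p ε deg χ (torus p ε deg)) where
  mul_comm := torus_mul_comm

theorem sigma_torus_eq_sum (x : (torus p ε deg).carrier) :
    sigma χ (torus p ε deg) x = ∑ i, x.1 i i • sigma χ (torus p ε deg) (diagUnit F i) := by
  conv_lhs => rw [diagMat_eq_sum x]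
  simp only [map_sum, map_smul]

theorem adjoin_diagUnit : Algebra.adjoin F
    (Set.range fun i => sigma χ (torus p ε deg) (diagUnit F i)) = ⊤ := by
  rw [eq_top_iff, ← adjoin_range_sigma χ (torus p ε deg), Algebra.adjoin_le_iff]
  rintro _ ⟨x, rfl⟩
  rw [sigma_torus_eq_sum]
  exact Subalgebra.sum_mem _ fun i _ =>
    Subalgebra.smul_mem _ (Algebra.subset_adjoin (Set.mem_range_self i)) _

/-- Fix one weight `l₀`. Each generator `e_{ii}` is a root of a polynomial with the `p` distinct
roots `l₀(e_{ii}) + t`, `t < p`, and every choice of roots defines a weight. This gives uniqueness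
of the Harish-Chandra projection. -/
theorem eq_zero_of_evalWeight [IsAlgClosed F] [Fact p.Prime] [CharP F p]
    (hχ : IsStandardSemisimple deg χ) {w : ReducedEnv p ε deg χ (torus p ε deg)}
    (hw : ∀ (l : Module.Dual F (diagMat F m)) (hl : IsWeight p χ l), evalWeight ε hχ hl w = 0) :
    w = 0 := by
  obtain ⟨l₀, hl₀⟩ := exists_isWeight (p := p) hχ
  have hp := (Fact.out : p.Prime)
  have hr := hl₀.apply_diagUnit hp.ne_zero
  refine eq_zero_of_forall_character (F := F) (R := ReducedEnv p ε deg χ (torus p ε deg))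
    (h := fun i => sigma χ (torus p ε deg) (diagUnit F i)) (s := Finset.range p)
    (v := fun i t => l₀ (diagUnit F i) + t) adjoin_diagUnit
    ⟨0, Finset.mem_range.2 hp.pos⟩
    (fun i a ha b hb hab => natCast_injOn_range (F := F) p ha hb (add_left_cancel hab)) ?_ ?_
  · intro i
    have h1 := congrArg (Polynomial.aeval (sigma χ (torus p ε deg) (diagUnit F i) -
      algebraMap F _ (l₀ (diagUnit F i)))) (prod_X_sub_natCast (F := F) p)
    simp only [map_prod, map_sub, map_pow, Polynomial.aeval_X, Polynomial.aeval_C] at h1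
    simp only [map_add]
    rw [← Finset.prod_congr rfl fun t _ => sub_sub _ _ _, h1]
    -- The zero ring does not have characteristic `p`, so it is treated apart.
    have : CharP (ReducedEnv p ε deg χ (torus p ε deg)) p ∨
      Subsingleton (ReducedEnv p ε deg χ (torus p ε deg)) := by
      rcases subsingleton_or_nontrivial (ReducedEnv p ε deg χ (torus p ε deg)) with h | h
      · exact Or.inr h
      · exact Or.inl (charP_of_injective_algebraMap
          (algebraMap F (ReducedEnv p ε deg χ (torus p ε deg))).injective p)
    rcases this with h | h
    · have h2 := sigma_pow χ (torus p ε deg) 0 (diagUnit F i) (diagUnit F i)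
        (bichar_zero_left ε 0) (diagMat_le_glDegree deg (diagUnit F i).2)
        (single_self_pow i hp.ne_zero).symm
      rw [sub_pow_char, ← map_pow (algebraMap F _), sub_sub_sub_comm, h2, ← map_sub, hr]
      exact sub_self _
    · exact Subsingleton.elim _ _
  · intro r hr'
    have h1 : ∀ i, r i ^ p - r i = χ (Matrix.single i i 1) ^ p := by
      intro i
      obtain ⟨t, -, ht⟩ := hr' i
      have h2 : (t : F) ^ p = t := by rw [← frobenius_def, map_natCast]
      rw [ht, add_pow_char, h2, ← hr]
      ring
    refine ⟨evalWeight ε hχ (isWeight_weightOf hχ h1), fun i => ?_, hw _ _⟩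
    rw [evalWeight_sigma, weightOf_diagUnit]

/-- Crossing a root vector translates the elements of `H` by the root. In particular `N⁺`
annihilates the image of `u_χ(H)` modulo `u_χ(g) N⁺`. -/
theorem exists_envE_mul_envIncl [Fact p.Prime] [CharP F p] (hp : p ≠ 2)
    (hχ : IsStandardSemisimple deg χ) (i j : Fin m) (w : ReducedEnv p ε deg χ (torus p ε deg)) :
    ∃ w' : ReducedEnv p ε deg χ (torus p ε deg),
      envE p ε deg χ i j * envIncl χ (torus p ε deg) (glSub p ε deg) le_top w =
        envIncl χ (torus p ε deg) (glSub p ε deg) le_top w' * envE p ε deg χ i j := by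
  have hw : w ∈ Algebra.adjoin F
      (Set.range fun i => sigma χ (torus p ε deg) (diagUnit F i)) := by
    rw [adjoin_diagUnit]
    trivial
  induction hw using Algebra.adjoin_induction with
  | mem w hw =>
    obtain ⟨t, rfl⟩ := hw
    have h := (isGLFamily_envE (p := p) hp ε hχ).diag_mul t i j
    refine ⟨sigma χ (torus p ε deg) (diagUnit F t) - algebraMap F _
      (((if t = i then 1 else 0) - if t = j then 1 else 0 : ℤ) : F), ?_⟩
    rw [map_sub, AlgHom.commutes, envIncl_sigma]
    change _ * envE p ε deg χ t t = (envE p ε deg χ t t - _) * _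
    rw [sub_mul, h, ← Algebra.smul_def, add_sub_cancel_right]
  | algebraMap c => exact ⟨algebraMap F _ c, by simp [Algebra.commutes]⟩
  | add a b _ _ ha hb =>
    obtain ⟨a', ha⟩ := ha
    obtain ⟨b', hb⟩ := hb
    exact ⟨a' + b', by rw [map_add, map_add, mul_add, add_mul, ha, hb]⟩
  | mul a b _ _ ha hb =>
    obtain ⟨a', ha⟩ := ha
    obtain ⟨b', hb⟩ := hb
    exact ⟨a' * b', by rw [map_mul, map_mul, ← mul_assoc, ha, mul_assoc, hb, mul_assoc]⟩

theorem envIncl_torus_mem_envWeightZero (w : ReducedEnv p ε deg χ (torus p ε deg)) :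
    envIncl χ (torus p ε deg) (glSub p ε deg) le_top w ∈ envWeightZero p ε deg χ := by
  intro i
  have h := congrArg (envIncl χ (torus p ε deg) (glSub p ε deg) le_top)
    (torus_mul_comm (sigma χ (torus p ε deg) (diagUnit F i)) w)
  rw [map_mul, map_mul, envIncl_sigma] at h
  exact sub_eq_zero.2 h

end Torus

/-! ### The Harish-Chandra projection. -/

section HarishChandra

variable {F : Type u} {Γ : Type*} [Field F] [AddCommGroup Γ] {m : ℕ} {p : ℕ} {ε : Bicharacter Γ F}
  {deg : Fin m → Γ} {χ : Module.Dual F (Matrix (Fin m) (Fin m) F)} {N : ℕ} {δ : Fin N ≃ PosRoot m}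

theorem IsGLFamily.diag_mul_prod {A : Type*} [Ring A] [Algebra F A] {E : Fin m → Fin m → A}
    (H : IsGLFamily p ε deg E) (t : Fin m) {N : ℕ} (q : Fin N → Fin m × Fin m) (k : Fin N → ℕ) :
    E t t * (List.ofFn fun i => E (q i).1 (q i).2 ^ k i).prod =
      (List.ofFn fun i => E (q i).1 (q i).2 ^ k i).prod * E t t +
        ((∑ i, k i * rootVec (q i) t : ℤ) : F) •
          (List.ofFn fun i => E (q i).1 (q i).2 ^ k i).prod := by
  have hmul : ∀ {x y : A} {a b : ℤ}, E t t * x = x * E t t + (a : F) • x →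
      E t t * y = y * E t t + (b : F) • y →
        E t t * (x * y) = x * y * E t t + ((a + b : ℤ) : F) • (x * y) := by
    intro x y a b hx hy
    rw [← mul_assoc, hx, add_mul, mul_assoc, hy, mul_add, ← mul_assoc, smul_mul_assoc,
      mul_smul_comm, add_assoc, ← add_smul, add_comm (b : F), Int.cast_add]
  have hpow : ∀ (i j : Fin m) (n : ℕ), E t t * E i j ^ n =
      E i j ^ n * E t t + ((n * rootVec (i, j) t : ℤ) : F) • E i j ^ n := by
    intro i j n
    induction n with
    | zero => simp
    | succ n ih =>
      rw [pow_succ, hmul ih ((H.diag_mul t i j).trans (by rw [← rootVec_apply (i, j) t]))]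
      congr 3
      push_cast
      ring
  induction N with
  | zero => simp
  | succ N ih =>
    rw [List.ofFn_succ, List.prod_cons, hmul (hpow _ _ _) (ih _ _), Fin.sum_univ_succ]

theorem topProduct_mem_envWeightZero [Fact p.Prime] [CharP F p] (hp : p ≠ 2) (ε : Bicharacter Γ F)
    (hχ : IsStandardSemisimple deg χ) (δ : Fin N ≃ PosRoot m) :
    topProduct p ε deg χ δ ∈ envWeightZero p ε deg χ := by
  intro t
  have H := isGLFamily_envE (p := p) hp ε hχ
  have h1 := H.diag_mul_prod t (fun i => (δ i).1) fun i => pbar p ε deg (δ i).1 - 1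
  have h2 := H.diag_mul_prod t (fun i => (δ i).1.swap) fun i => pbar p ε deg (δ i).1 - 1
  simp only [Prod.fst_swap, Prod.snd_swap, ← neg_rootVec, Pi.neg_apply, mul_neg,
    Finset.sum_neg_distrib, Int.cast_neg, neg_smul] at h2
  rw [topProduct, ← mul_assoc, h1, add_mul, mul_assoc, h2, sub_eq_zero, smul_mul_assoc, mul_add,
    mul_neg, mul_smul_comm, mul_assoc]
  abel

/-- In `u_χ(g)/u_χ(g)N⁺` the image `V₀` of `u_χ(H)` is killed by raising operators and stable under
the diagonal ones. The product moves the class of `1` by total height zero, hence back into `V₀`. -/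
theorem exists_isHarishChandra [Fact p.Prime] [CharP F p] (hp : p ≠ 2) (ε : Bicharacter Γ F)
    (hχ : IsStandardSemisimple deg χ) (δ : Fin N ≃ PosRoot m) :
    ∃ w, IsHarishChandra (topProduct p ε deg χ δ) w := by
  let M := ReducedEnv p ε deg χ (glSub p ε deg) ⧸ envIdeal p ε deg χ
  let ι := envIncl χ (torus p ε deg) (glSub p ε deg) le_top
  let e : M := Submodule.Quotient.mk 1
  have he : ∀ u : ReducedEnv p ε deg χ (glSub p ε deg), u • e = Submodule.Quotient.mk u := by
    intro u
    rw [← Submodule.Quotient.mk_smul, smul_eq_mul, mul_one]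
  let V₀ : Submodule F M := LinearMap.range
    (((envIdeal p ε deg χ).mkQ.restrictScalars F) ∘ₗ ι.toLinearMap)
  have hV : ∀ w, ι w • e ∈ V₀ := fun w => ⟨w, (he _).symm⟩
  have hV' : ∀ z ∈ V₀, ∃ w, z = ι w • e := fun z ⟨w, hw⟩ => ⟨w, hw.symm.trans (he _).symm⟩
  have H := isGLFamily_envRep hp ε hχ M
  have hη : Function.Injective fun i : Fin m => (i.1 : ℤ) := fun i j h => Fin.ext (by simpa using h)
  have hup : ∀ i j : Fin m, (i.1 : ℤ) < j.1 → ∀ z ∈ V₀, envRep p ε deg χ M i j z = 0 := by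
    intro i j hij z hz
    obtain ⟨w, rfl⟩ := hV' z hz
    obtain ⟨w', hw'⟩ := exists_envE_mul_envIncl hp hχ i j w
    change envE p ε deg χ i j • ι w • e = 0
    rw [← mul_smul, hw', mul_smul, he, (Submodule.Quotient.mk_eq_zero _).2, smul_zero]
    exact Submodule.subset_span ⟨i, j, Fin.lt_def.2 (by exact_mod_cast hij), rfl⟩
  have hdiag : ∀ i, ∀ z ∈ V₀, envRep p ε deg χ M i i z ∈ V₀ := by
    intro i z hz
    obtain ⟨w, rfl⟩ := hV' z hz
    have h := hV (sigma χ (torus p ε deg) (diagUnit F i) * w)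
    rw [map_mul, mul_smul] at h
    change envE p ε deg χ i i • ι w • e ∈ V₀
    have h1 : ι (sigma χ (torus p ε deg) (diagUnit F i)) = envE p ε deg χ i i := envIncl_sigma ..
    rwa [h1] at h
  have h0 : e ∈ V₀ := by simpa using hV 1
  have h1 := apply_pow_mem_wordSpan H hη hup hdiag (fun i => (δ i).1.swap)
    (fun i => pbar p ε deg (δ i).1 - 1) (mem_wordSpan_zero _ (fun i : Fin m => (i.1 : ℤ)) h0)
  have h2 := apply_pow_mem_wordSpan H hη hup hdiag (fun i => (δ i).1)
    (fun i => pbar p ε deg (δ i).1 - 1) h1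
  have hsum : (0 : ℤ) + ∑ i, ((pbar p ε deg (δ i).1 - 1 : ℕ) : ℤ) *
      (((δ i).1.swap.1.1 : ℤ) - (δ i).1.swap.2.1) + ∑ i, ((pbar p ε deg (δ i).1 - 1 : ℕ) : ℤ) *
      (((δ i).1.1.1 : ℤ) - (δ i).1.2.1) = 0 := by
    rw [zero_add, ← Finset.sum_add_distrib]
    refine Finset.sum_eq_zero fun i _ => ?_
    rw [Prod.fst_swap, Prod.snd_swap]
    ring
  rw [hsum] at h2
  obtain ⟨w, hw⟩ := hV' _ (wordSpan_zero_le _ _ _ h2)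
  have h3 : ∀ q : Fin N → Fin m × Fin m, (List.ofFn fun i =>
      envRep p ε deg χ M (q i).1 (q i).2 ^ (pbar p ε deg (δ i).1 - 1)).prod =
        Algebra.lsmul F F M (List.ofFn fun i =>
          envE p ε deg χ (q i).1 (q i).2 ^ (pbar p ε deg (δ i).1 - 1)).prod := by
    intro q
    rw [map_list_prod, List.map_ofFn]
    simp only [Function.comp_def, map_pow]
    rfl
  rw [h3, h3, ← Module.End.mul_apply, ← map_mul] at hw
  have h4 : (topProduct p ε deg χ δ) • e = ι w • e := hw
  rw [he, he, Submodule.Quotient.eq] at h4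
  have h5 := topProduct_mem_envWeightZero hp ε hχ δ
  have h6 := envIncl_torus_mem_envWeightZero w
  refine ⟨w, h5, h4, fun i => ?_⟩
  rw [mul_sub, sub_mul, sub_sub_sub_comm, h5 i, h6 i, sub_zero]

variable (hχ : IsStandardSemisimple deg χ) {l : Module.Dual F (diagMat F m)} (hl : IsWeight p χ l)

/-- `u_χ(g) N⁺` kills the highest weight vector, so only the projection is felt. This identifies
`f(λ)` with the scalar by which the product acts. -/
theorem IsHarishChandra.smul_vermaVec {u : ReducedEnv p ε deg χ (glSub p ε deg)}
    {w : ReducedEnv p ε deg χ (torus p ε deg)} (h : IsHarishChandra u w) :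
    u • vermaVec hχ hl ε = evalWeight ε hχ hl w • vermaVec hχ hl ε := by
  rw [← envIncl_torus_smul_vermaVec, ← sub_eq_zero, ← sub_smul]
  have h1 : ∀ x ∈ envIdeal p ε deg χ, x • vermaVec hχ hl ε = 0 := by
    intro x hx
    induction hx using Submodule.span_induction with
    | mem x hx =>
      obtain ⟨i, j, hij, rfl⟩ := hx
      exact envE_smul_vermaVec hχ hl hij
    | zero => exact zero_smul _ _
    | add x y _ _ hx hy => rw [add_smul, hx, hy, add_zero]
    | smul a x _ hx => rw [smul_eq_mul, mul_smul, hx, smul_zero]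
  exact h1 _ h.2.1

theorem shiftedWeight_coroot (ε : Bicharacter Γ F) (l : Module.Dual F (diagMat F m)) (i : Fin N) :
    shiftedWeight p ε deg δ l i (coroot ε deg (δ i).1) =
      corootVal ε deg (stageWeight p ε deg δ (fun t => l (diagUnit F t)) i) (δ i).1 := by
  have h1 : ∀ (Λ : Module.Dual F (diagMat F m)) (q : Fin m × Fin m),
      Λ (coroot ε deg q) = corootVal ε deg (fun t => Λ (diagUnit F t)) q := by
    intro Λ q
    rw [corootVal]
    split_ifs with h
    · rw [← map_sub]
      exact congrArg Λ (Subtype.ext (if_pos h))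
    · rw [← map_add]
      exact congrArg Λ (Subtype.ext (if_neg h))
  have h2 : ∀ (q : Fin m × Fin m) (t : Fin m),
      rootDual F q (diagUnit F t) = (rootVec q t : F) := by
    intro q t
    change Matrix.single t t (1 : F) q.1 q.1 - Matrix.single t t (1 : F) q.2 q.2 = _
    rw [rootVec_apply, Matrix.single_apply, Matrix.single_apply]
    simp
  rw [h1]
  congr 1
  funext t
  rw [shiftedWeight, stageWeight, LinearMap.sub_apply, LinearMap.sum_apply]
  congr 1
  refine Finset.sum_congr rfl fun k _ => ?_
  rw [LinearMap.smul_apply, h2, nsmul_eq_mul]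

end HarishChandra

/-! ### The simplicity criterion and the product formula. -/

section Simplicity

variable {F : Type u} {Γ : Type*} [Field F] [AddCommGroup Γ] {m : ℕ} {p : ℕ} {ε : Bicharacter Γ F}
  {deg : Fin m → Γ} {χ : Module.Dual F (Matrix (Fin m) (Fin m) F)} {N : ℕ} {δ : Fin N ≃ PosRoot m}

/-- The product `f_{δ_N}^{p̄-1} ⋯ f_{δ_1}^{p̄-1}`. -/
def lowerTop (p : ℕ) (ε : Bicharacter Γ F) (deg : Fin m → Γ)
    (χ : Module.Dual F (Matrix (Fin m) (Fin m) F)) (δ : Fin N ≃ PosRoot m) :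
    ReducedEnv p ε deg χ (glSub p ε deg) :=
  (List.ofFn fun k =>
    envE p ε deg χ (δ k).1.2 (δ k).1.1 ^ (pbar p ε deg (δ k).1 - 1)).reverse.prod

/-- The product `e_{δ_1}^{p̄-1} ⋯ e_{δ_N}^{p̄-1}`. -/
def upperTop (p : ℕ) (ε : Bicharacter Γ F) (deg : Fin m → Γ)
    (χ : Module.Dual F (Matrix (Fin m) (Fin m) F)) (δ : Fin N ≃ PosRoot m) :
    ReducedEnv p ε deg χ (glSub p ε deg) :=
  (List.ofFn fun k => envE p ε deg χ (δ k).1.1 (δ k).1.2 ^ (pbar p ε deg (δ k).1 - 1)).prod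

/-- The scalar by which `upperTop * lowerTop` acts on a highest weight vector of weight `l`. -/
def topScalar (p : ℕ) (ε : Bicharacter Γ F) (deg : Fin m → Γ) (δ : Fin N ≃ PosRoot m)
    (l : Module.Dual F (diagMat F m)) : F :=
  ∏ k : Fin N, (((pbar p ε deg (δ k).1 - 1).factorial : F) *
    ((shiftedWeight p ε deg δ l k (coroot ε deg (δ k).1) + 1) ^ (pbar p ε deg (δ k).1 - 1) - 1))

section Module

variable {M : Type*} [AddCommGroup M] [Module F M]
  [Module (ReducedEnv p ε deg χ (glSub p ε deg)) M]
  [IsScalarTower F (ReducedEnv p ε deg χ (glSub p ε deg)) M]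

theorem lowerTop_smul (z : M) : (List.ofFn fun k => envRep p ε deg χ M (δ k).1.2 (δ k).1.1 ^
    (pbar p ε deg (δ k).1 - 1)).reverse.prod z = lowerTop p ε deg χ δ • z := by
  change _ = Algebra.lsmul F F M (lowerTop p ε deg χ δ) z
  rw [lowerTop, map_list_prod, List.map_reverse, List.map_ofFn]
  simp only [Function.comp_def, map_pow]
  rfl

theorem upperTop_smul (z : M) : (List.ofFn fun k => envRep p ε deg χ M (δ k).1.1 (δ k).1.2 ^
    (pbar p ε deg (δ k).1 - 1)).prod z = upperTop p ε deg χ δ • z := by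
  change _ = Algebra.lsmul F F M (upperTop p ε deg χ δ) z
  rw [upperTop, map_list_prod, List.map_ofFn]
  simp only [Function.comp_def, map_pow]
  rfl

/-- The submodule generated by a homogeneous element is graded. -/
theorem span_singleton_le_iSup {𝓜 : Γ → Submodule F M}
    (h : ∀ i j γ, ∀ z ∈ 𝓜 γ, envE p ε deg χ i j • z ∈ 𝓜 (deg i - deg j + γ)) {γ : Γ} {z : M}
    (hz : z ∈ 𝓜 γ) {P : Submodule (ReducedEnv p ε deg χ (glSub p ε deg)) M}
    (hP : P = Submodule.span _ {z}) :
    P.restrictScalars F ≤ ⨆ γ, P.restrictScalars F ⊓ 𝓜 γ := by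
  intro y hy
  obtain ⟨u, rfl⟩ : ∃ u : ReducedEnv p ε deg χ (glSub p ε deg), u • z = y := by
    rw [hP] at hy
    exact Submodule.mem_span_singleton.1 hy
  have hzP : z ∈ P := hP ▸ Submodule.mem_span_singleton_self z
  refine mem_of_envE_stable _ ?_ u z (Submodule.mem_iSup_of_mem γ ⟨hzP, hz⟩)
  intro i j s hs
  induction hs using Submodule.iSup_induction' with
  | mem γ s hs =>
    exact Submodule.mem_iSup_of_mem _ ⟨P.smul_mem _ hs.1, h i j γ s hs.2⟩
  | zero => rw [smul_zero]; exact Submodule.zero_mem _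
  | add s t _ _ hs ht => rw [smul_add]; exact Submodule.add_mem _ hs ht

end Module

variable (hχ : IsStandardSemisimple deg χ) {l : Module.Dual F (diagMat F m)} (hl : IsWeight p χ l)

theorem one_mem_envDegree : (1 : ReducedEnv p ε deg χ (glSub p ε deg)) ∈
    envDegree χ (glSub p ε deg) 0 :=
  Submodule.subset_span ⟨[], by simp, by simp, by simp⟩

theorem envE_mul_mem_envDegree (i j : Fin m) {α : Γ} {u : ReducedEnv p ε deg χ (glSub p ε deg)}
    (hu : u ∈ envDegree χ (glSub p ε deg) α) :
    envE p ε deg χ i j * u ∈ envDegree χ (glSub p ε deg) (deg i - deg j + α) := by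
  induction hu using Submodule.span_induction with
  | mem u hu =>
    obtain ⟨w, hw, rfl, rfl⟩ := hu
    refine Submodule.subset_span ⟨(deg i - deg j, ⟨Matrix.single i j 1, trivial⟩) :: w, ?_, by simp,
      by simp [envE]⟩
    intro q hq
    rcases List.mem_cons.1 hq with rfl | hq
    · exact single_mem_glDegree_of_eq rfl 1
    · exact hw q hq
  | zero => simp
  | add s t _ _ hs ht => rw [mul_add]; exact Submodule.add_mem _ hs ht
  | smul c t _ ht => rw [mul_smul_comm]; exact Submodule.smul_mem _ _ ht

theorem vermaVec_mem_vermaDegree (d : Γ) : vermaVec hχ hl ε ∈ vermaDegree ε hχ hl d d :=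
  Submodule.subset_span ⟨0, 1, 1, one_mem_envDegree, zero_add d, rfl⟩

theorem envE_smul_mem_vermaDegree (i j : Fin m) {d γ : Γ} {z : BabyVerma ε hχ hl}
    (hz : z ∈ vermaDegree ε hχ hl d γ) :
    envE p ε deg χ i j • z ∈ vermaDegree ε hχ hl d (deg i - deg j + γ) := by
  induction hz using Submodule.span_induction with
  | mem z hz =>
    obtain ⟨α, u, x, hu, rfl, rfl⟩ := hz
    exact Submodule.subset_span ⟨_, _, x, envE_mul_mem_envDegree i j hu, add_assoc _ _ _, rfl⟩
  | zero => rw [smul_zero]; exact Submodule.zero_mem _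
  | add s t _ _ hs ht => rw [smul_add]; exact Submodule.add_mem _ hs ht
  | smul c t _ ht => rw [smul_comm]; exact Submodule.smul_mem _ _ ht

/-- Homogeneity of the lowest weight vector makes the submodule it generates graded, so that graded
simplicity applies to it. -/
theorem lowerTop_smul_mem_vermaDegree (d : Γ) : ∃ γ,
    lowerTop p ε deg χ δ • vermaVec hχ hl ε ∈ vermaDegree ε hχ hl d γ := by
  have hpow : ∀ (i j : Fin m) (n : ℕ) (z : BabyVerma ε hχ hl), (∃ γ, z ∈ vermaDegree ε hχ hl d γ) →
      ∃ γ, envE p ε deg χ i j ^ n • z ∈ vermaDegree ε hχ hl d γ := by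
    intro i j n z hz
    induction n with
    | zero => simpa using hz
    | succ n ih =>
      obtain ⟨γ, h⟩ := ih
      exact ⟨_, by rw [pow_succ', mul_smul]; exact envE_smul_mem_vermaDegree hχ hl i j h⟩
  have hlist : ∀ w : List (ReducedEnv p ε deg χ (glSub p ε deg)),
      (∀ u ∈ w, ∃ i j n, u = envE p ε deg χ i j ^ n) →
        ∃ γ, w.prod • vermaVec hχ hl ε ∈ vermaDegree ε hχ hl d γ := by
    intro w
    induction w with
    | nil => exact fun _ => ⟨d, by simpa using vermaVec_mem_vermaDegree hχ hl d⟩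
    | cons u w ih =>
      intro h
      obtain ⟨i, j, n, rfl⟩ := h u (List.mem_cons_self ..)
      rw [List.prod_cons, mul_smul]
      exact hpow i j n _ (ih fun u hu => h u (List.mem_cons_of_mem _ hu))
  refine hlist _ fun u hu => ?_
  rw [List.mem_reverse, List.mem_ofFn] at hu
  obtain ⟨k, rfl⟩ := hu
  exact ⟨_, _, _, rfl⟩

variable [Fact p.Prime] [CharP F p]

theorem nontrivial_babyVerma (hp : 3 ≤ p) (ε : Bicharacter Γ F) (hδ : IsFPOrder δ) :
    Nontrivial (BabyVerma ε hχ hl) := by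
  have h := (finrank_babyVerma hχ hl hp ε hδ).2
  refine Module.nontrivial_of_finrank_pos (R := F) ?_
  rw [h]
  exact Finset.prod_pos fun k _ => pbar_pos (by omega) ε deg _

theorem vermaVec_ne_zero (hp : 3 ≤ p) (ε : Bicharacter Γ F) (hδ : IsFPOrder δ) :
    vermaVec hχ hl ε ≠ 0 := by
  intro h
  have := nontrivial_babyVerma hχ hl hp ε hδ
  obtain ⟨z, hz⟩ := exists_ne (0 : BabyVerma ε hχ hl)
  obtain ⟨u, rfl⟩ := exists_smul_vermaVec hχ hl z
  exact hz (by rw [h, smul_zero])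

theorem lowerTop_smul_mem (hp : 3 ≤ p) (ε : Bicharacter Γ F) (hδ : IsFPOrder δ)
    {P : Submodule (ReducedEnv p ε deg χ (glSub p ε deg)) (BabyVerma ε hχ hl)} (hP : P ≠ ⊥) :
    lowerTop p ε deg χ δ • vermaVec hχ hl ε ∈ P ∧
      lowerTop p ε deg χ δ • vermaVec hχ hl ε ≠ 0 := by
  have h := (isGLFamily_envRep (by omega) ε hχ (BabyVerma ε hχ hl)).exists_lowest_mem
    (by omega) hδ (fun i j hij => envE_smul_vermaVec hχ hl hij)
    (envE_diag_smul_vermaVec (ε := ε) hχ hl) (isCyclicVec_envRep (exists_smul_vermaVec hχ hl))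
    (finrank_babyVerma hχ hl hp ε hδ).2 (P := P.restrictScalars F)
    (fun h => hP (by simpa using h)) fun i j z hz => P.smul_mem _ hz
  rwa [lowerTop_smul] at h

theorem lowerTop_smul_ne_zero (hp : 3 ≤ p) (ε : Bicharacter Γ F) (hδ : IsFPOrder δ) :
    lowerTop p ε deg χ δ • vermaVec hχ hl ε ≠ 0 := by
  have := nontrivial_babyVerma hχ hl hp ε hδ
  exact (lowerTop_smul_mem hχ hl hp ε hδ (P := ⊤) top_ne_bot).2

theorem upperTop_smul_lowerTop_smul (hp : 3 ≤ p) (ε : Bicharacter Γ F) (hδ : IsFPOrder δ) :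
    upperTop p ε deg χ δ • lowerTop p ε deg χ δ • vermaVec hχ hl ε =
      topScalar p ε deg δ l • vermaVec hχ hl ε := by
  obtain ⟨w, rfl, -, -, h⟩ := (isGLFamily_envRep (by omega) ε hχ (BabyVerma ε hχ hl)).chain
    (by omega) hδ (fun i j hij => envE_smul_vermaVec hχ hl hij)
    (envE_diag_smul_vermaVec (ε := ε) hχ hl)
  rw [lowerTop_smul, upperTop_smul] at h
  rw [h, topScalar]
  simp only [shiftedWeight_coroot]

/-- The baby Verma module is graded simple if and only if `upperTop * lowerTop` does not kill its
highest weight vector. -/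
theorem isGradedSimple_iff (hp : 3 ≤ p) (ε : Bicharacter Γ F) (hδ : IsFPOrder δ) (d : Γ) :
    IsGradedSimple (U := ReducedEnv p ε deg χ (glSub p ε deg)) (vermaDegree ε hχ hl d) ↔
      topScalar p ε deg δ l ≠ 0 := by
  constructor
  · rintro ⟨-, h⟩ h0
    obtain ⟨γ, hγ⟩ := lowerTop_smul_mem_vermaDegree (δ := δ) (ε := ε) hχ hl d
    have h1 := lowerTop_smul_ne_zero hχ hl hp ε hδ
    -- By simplicity the lowest weight vector generates the whole module, as `top_apply_ne_zero`
    -- requires.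
    have htop := (h _ (span_singleton_le_iSup
      (fun i j _ _ hz => envE_smul_mem_vermaDegree hχ hl i j hz) hγ rfl)).resolve_left
      (fun h2 => h1 (Submodule.span_singleton_eq_bot.1 h2))
    have := (finrank_babyVerma hχ hl hp ε hδ).1
    have H := isGLFamily_envRep (p := p) (by omega) ε hχ (BabyVerma ε hχ hl)
    obtain ⟨w, hw, hlow, hdiag, -⟩ := H.chain
      (by omega) hδ (fun i j hij => envE_smul_vermaVec hχ hl hij)
      (envE_diag_smul_vermaVec (ε := ε) hχ hl)
    rw [lowerTop_smul] at hw
    subst hw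
    have h2 := H.top_apply_ne_zero (by omega) hδ hlow hdiag
      (isCyclicVec_envRep fun z => by
        have hz : z ∈ Submodule.span (ReducedEnv p ε deg χ (glSub p ε deg))
          {lowerTop p ε deg χ δ • vermaVec hχ hl ε} := by
          rw [htop]
          trivial
        obtain ⟨u, hu⟩ := Submodule.mem_span_singleton.1 hz
        exact ⟨u, hu.symm⟩)
      (finrank_babyVerma hχ hl hp ε hδ).2
    rw [upperTop_smul, upperTop_smul_lowerTop_smul hχ hl hp ε hδ, h0, zero_smul] at h2
    exact h2 rfl
  · intro h
    refine ⟨nontrivial_babyVerma hχ hl hp ε hδ, fun P _ => or_iff_not_imp_left.2 fun hP => ?_⟩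
    -- Returning from the lowest weight vector recovers the generator up to the nonzero scalar. The
    -- grading of `P` plays no role.
    have h1 := P.smul_mem (upperTop p ε deg χ δ) (lowerTop_smul_mem hχ hl hp ε hδ hP).1
    rw [upperTop_smul_lowerTop_smul hχ hl hp ε hδ] at h1
    have h2 := (Submodule.smul_mem_iff (P.restrictScalars F) h).1 h1
    refine eq_top_iff.2 fun z _ => ?_
    obtain ⟨u, rfl⟩ := exists_smul_vermaVec hχ hl z
    exact P.smul_mem u h2

/-- `topProduct` applies the powers of `f_{δ_N}` first, the chain those of `f_{δ_1}`. The two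
lowering products are proportional inside `u_χ(g)` itself, so one constant serves all weights. -/
theorem exists_evalWeight_eq [IsAlgClosed F] (hp : 3 ≤ p) (ε : Bicharacter Γ F)
    (hδ : IsFPOrder δ) {f : ReducedEnv p ε deg χ (torus p ε deg)}
    (hf : IsHarishChandra (topProduct p ε deg χ δ) f) :
    ∃ c : F, c ≠ 0 ∧ ∀ (l : Module.Dual F (diagMat F m)) (hl : IsWeight p χ l),
      evalWeight ε hχ hl f = c * topScalar p ε deg δ l := by
  obtain ⟨c, hc⟩ := exists_smul_top_eq ((isGLFamily_envE (p := p) (by omega) ε hχ).ore_lower hδ)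
    (fun k => pbar_pos (by omega) ε deg _) (rootHeight_pos δ)
  have hT : ∀ (l : Module.Dual F (diagMat F m)) (hl : IsWeight p χ l),
      (c * evalWeight ε hχ hl f) = topScalar p ε deg δ l := by
    intro l hl
    refine smul_left_injective F (vermaVec_ne_zero hχ hl hp ε hδ) ?_
    beta_reduce
    rw [← upperTop_smul_lowerTop_smul hχ hl hp ε hδ, mul_smul, ← hf.smul_vermaVec hχ hl, lowerTop,
      hc, topProduct, upperTop, mul_smul, smul_assoc, smul_comm]
  -- A zero constant would make the chain product vanish in `u_χ(g)`, although it acts nontrivially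
  -- on the baby Verma module of any weight.
  have hc0 : c ≠ 0 := by
    rintro rfl
    obtain ⟨l, hl⟩ := exists_isWeight (p := p) hχ
    refine lowerTop_smul_ne_zero hχ hl hp ε hδ ?_
    rw [lowerTop, hc, zero_smul, zero_smul]
  exact ⟨c⁻¹, inv_ne_zero hc0, fun l hl => by rw [← hT l hl, inv_mul_cancel_left₀ hc0]⟩

theorem topScalar_eq (p : ℕ) [Fact p.Prime] (ε : Bicharacter Γ F) (deg : Fin m → Γ)
    (δ : Fin N ≃ PosRoot m) (l : Module.Dual F (diagMat F m)) :
    topScalar p ε deg δ l = (∏ k, ((pbar p ε deg (δ k).1 - 1).factorial : F)) * ∏ k,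
      ((shiftedWeight p ε deg δ l k (coroot ε deg (δ k).1) + 1) ^ (pbar p ε deg (δ k).1 - 1) - 1) :=
  Finset.prod_mul_distrib

/-- Each `p̄ - 1` is less than `p`, so `p` divides none of the factorials and they can be absorbed
into the constant. -/
theorem prod_factorial_ne_zero (ε : Bicharacter Γ F) (deg : Fin m → Γ) (δ : Fin N ≃ PosRoot m) :
    ∏ k, ((pbar p ε deg (δ k).1 - 1).factorial : F) ≠ 0 := by
  have hp := (Fact.out : p.Prime)
  refine Finset.prod_ne_zero_iff.2 fun k _ h => ?_
  rw [CharP.cast_eq_zero_iff F p, hp.dvd_factorial] at h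
  have h1 := hp.two_le
  rw [pbar] at h
  split_ifs at h <;> omega

end Simplicity

end GLColor

end

theorem corollary4p3 {F Γ : Type*} [Field F] [IsAlgClosed F] [AddCommGroup Γ] [Finite Γ]
    (p : ℕ) [Fact p.Prime] [CharP F p] (hp : 3 < p) (ε : Bicharacter Γ F)
    (m : ℕ) (deg : Fin m → Γ)
    (χ : Module.Dual F (Matrix (Fin m) (Fin m) F)) (hχ : GLColor.IsStandardSemisimple deg χ)
    (N : ℕ) (δ : Fin N ≃ GLColor.PosRoot m) (hδ : GLColor.IsFPOrder δ) :
    ∃ f : GLColor.ReducedEnv p ε deg χ (GLColor.torus p ε deg),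
      (∀ w, GLColor.IsHarishChandra (GLColor.topProduct p ε deg χ δ) w ↔ w = f) ∧
      (∀ (l : Module.Dual F (GLColor.diagMat F m)) (hl : GLColor.IsWeight p χ l) (d : Γ),
        GLColor.IsGradedSimple (U := GLColor.ReducedEnv p ε deg χ (GLColor.glSub p ε deg))
            (GLColor.vermaDegree ε hχ hl d) ↔
          GLColor.evalWeight ε hχ hl f ≠ 0) ∧
      ∃ c : F, c ≠ 0 ∧
        ∀ (l : Module.Dual F (GLColor.diagMat F m)) (hl : GLColor.IsWeight p χ l),
          GLColor.evalWeight ε hχ hl f = c * ∏ i : Fin N,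
            ((GLColor.shiftedWeight p ε deg δ l i (GLColor.coroot ε deg (δ i).1) + 1) ^
              (GLColor.pbar p ε deg (δ i).1 - 1) - 1) := by
  have hp3 : 3 ≤ p := hp.le
  obtain ⟨f, hf⟩ := GLColor.exists_isHarishChandra (by omega) ε hχ δ
  obtain ⟨c, hc, hcf⟩ := GLColor.exists_evalWeight_eq hχ hp3 ε hδ hf
  refine ⟨f, fun w => ⟨fun hw => ?_, fun hw => hw ▸ hf⟩, fun l hl d => ?_,
    c * ∏ k, ((GLColor.pbar p ε deg (δ k).1 - 1).factorial : F),
    mul_ne_zero hc (GLColor.prod_factorial_ne_zero ε deg δ), fun l hl => ?_⟩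
  -- Two projections of the same element act by the same scalar on every nonzero highest weight
  -- vector, so their difference vanishes at all weights.
  · refine sub_eq_zero.1 (GLColor.eq_zero_of_evalWeight hχ fun l hl => ?_)
    have h := (hw.smul_vermaVec hχ hl).symm.trans (hf.smul_vermaVec hχ hl)
    rw [map_sub, sub_eq_zero]
    exact smul_left_injective F (GLColor.vermaVec_ne_zero hχ hl hp3 ε hδ) h
  · rw [GLColor.isGradedSimple_iff hχ hl hp3 ε hδ d, hcf l hl]
    exact (mul_ne_zero_iff.trans (and_iff_right hc)).symm
  · rw [hcf l hl, GLColor.topScalar_eq, mul_assoc]
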